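/- Fix a dimension $d\ge 1$, $\beta>0$ and $a>b>0$. **Model.** Let $q_k=(4\pi\beta)^{-d/2}k^{-1-d/2}$, $k\in\mathbb N=\{1,2,\dots\}$. For $\alpha<0$ and a centred box $\Lambda\subset\mathbb R^d$ of volume $|\Lambda|$, let under the reference law $\mathsf Q_\Lambda$ the numbers $N_k=|\Lambda|\lambda_k$, $k\in\mathbb N$, be independent Poisson variables with parameters $|\Lambda|q_k e^{\beta\alpha k}$, i.e. $\mathsf Q_\Lambda(N_k=n_k\ \forall k)=e^{-|\Lambda|\sum_k q_ke^{\beta\alpha k}}\prod_k \frac{(|\Lambda|q_ke^{\beta\alpha k})^{n_k}}{n_k!}$ for finitely supported $(n_k)\in\mathbb N_0^{\mathbb N}$. For $\mu\in\mathbb R$ and a cut-off $m_\Lambda\in\mathbb N_0$ let $$H_\Lambda=|\Lambda|\Big(-(\mu-\alpha)\sum_{k}k\lambda_k+\frac a2\Big(\sum_k k\lambda_k\Big)^2-\frac b2\sum_{k\ge m_\Lambda}k^2\lambda_k^2\Big),\qquad \frac{d\mathsf P_\Lambda}{d\mathsf Q_\Lambda}=\frac{e^{-\beta H_\Lambda}}{\mathsf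 E_{\mathsf Q_\Lambda}[e^{-\beta H_\Lambda}]},\qquad \mathbf M_\Lambda=\Big(\sum_{k<m_\Lambda}k\lambda_k,\ \sum_{k\ge m_\Lambda}k\lambda_k\Big).$$ For $\kappa\in[0,\infty]$, $\Lambda\uparrow\mathbb R^d$ denotes the limit along a sequence of centred boxes with $|\Lambda|\to\infty$, $m_\Lambda\to\infty$ and $m_\Lambda/|\Lambda|\to\kappa$. **Rate function.** Let $p_0(\beta,s)=\frac1\beta\sum_{k\ge1}q_ke^{\beta sk}\in[0,\infty]$, $f_0(\beta,x)=\sup_{s\in\mathbb R}\{sx-p_0(\beta,s)\}$ and $K(\kappa)=[0,\infty)\times(\{0\}\cup[\kappa,\infty))$, with $K(\infty)=[0,\infty)\times\{0\}$. Put $$I^{(\kappa)}(x,y)=f_0(\beta,x)-\mu(x+y)+\frac a2(x+y)^2-\frac b2y^2+\sup_{(u,v)\in K(\kappa)}\Big\{\mu(u+v)-\frac a2(u+v)^2+\frac b2v^2-f_0(\beta,u)\Big\}$$ for $(x,y)\in K(\kappa)$, and $I^{(\kappa)}=+\infty$ otherwise. Let $\mathscr M^{(\kappa)}(\mu)$ be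 the set of zeroes of $I^{(\kappa)}$. **Critical parameters.** Let $\varrho_c=(4\pi\beta)^{-d/2}\zeta(d/2)$ for $d\ge3$ and $\varrho_c=\infty$ for $d=1,2$; $\mu_c=a\varrho_c$. For $x>0$ let $s_\beta(x)=0$ if $x\ge\varrho_c$, and otherwise let $s_\beta(x)$ be the unique $s<0$ with $\partial_sp_0(\beta,s)=x$. Let $\mu_t=\inf_{s<0}\{a\,\partial_sp_0(\beta,s)-\frac{a-b}{b}s\}$. Let $\tilde x_1(\mu)$ be the unique $x>0$ with $s_\beta(x)=\mu-ax$; for $\mu\ge\mu_t$ let $\tilde x_2(\mu)$ be the minimal $x>0$ with $s_\beta(x)=-\frac b{a-b}(\mu-ax)$. For $\kappa\in(0,\infty)$ let $\tilde x_3(\mu)=\tilde x_1(\mu-a\kappa)$ and $\mu_r=\inf\{s\ge\mu_t:\tilde x_2(s)\le\frac1a(s-\kappa(a-b))\}$. **Corollary (Thermodynamic limit of the pair particle density).** Let $\kappa\in[0,\infty]$, $\mu\in\mathbb R$ and $\alpha<0$. If $I^{(\kappa)}$ has a unique zero $(x,y)$, then, for every such sequence $(\Lambda,m_\Lambda)$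 and every $\delta>0$, $$\lim_{\Lambda\uparrow\mathbb R^d}\mathsf P_\Lambda\big(\mathbf M_\Lambda\in B_\delta(x,y)\big)=1,$$ where $B_\delta(x,y)$ is the open Euclidean ball. The zero is unique in the following cases. * $\kappa=\infty$: for all $\mu\in\mathbb R$, $\mathscr M^{(\infty)}(\mu)=\{(\tilde x_1(\mu),0)\}$. * $\kappa=0$: there is $\mu^*\in\mathbb R$ with $\mu_t\le\mu^*\le\mu_c$ such that $\mathscr M^{(0)}(\mu)=\{(\tilde x_1(\mu),0)\}$ for $\mu<\mu^*$ and $\mathscr M^{(0)}(\mu)=\{(\tilde x_2(\mu),\frac{\mu-a\tilde x_2(\mu)}{a-b})\}$ for $\mu>\mu^*$. * $\kappa\in(0,\infty)$: there is $\mu^*_\kappa\in\mathbb R$, equal to $\mu^*$ if $\mu_r\le\mu^*$ and lying in $(\mu^*,\mu_r)$ if $\mu_r>\mu^*$, such that $\mathscr M^{(\kappa)}(\mu)$ is $\{(\tilde x_1(\mu),0)\}$ for $\mu<\mu^*_\kappa$, $\{(\tilde x_3(\mu),\kappa)\}$ for $\mu^*_\kappa<\mu\le\mu_r$, and $\{(\tilde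 x_2(\mu),\frac{\mu-a\tilde x_2(\mu)}{a-b})\}$ for $\mu>\mu^*_\kappa$ with $\mu\ge\mu_r$. -/

import Mathlib

open MeasureTheory Filter Topology
open scoped ENNReal

namespace HYL

noncomputable section

/-- The weight `q_k = 1 / ((4πβ)^{d/2} k^{1+d/2})` of a cycle of length `k` in dimension `d`. -/
def cycleWeight (d : ℕ) (β : ℝ) (k : ℕ+) : ℝ :=
  1 / ((4 * Real.pi * β) ^ ((d : ℝ) / 2) * ((k : ℕ) : ℝ) ^ (1 + (d : ℝ) / 2))

/-- A cycle configuration: `n k` is the number of cycles of length `k ≥ 1`; only finitely many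
cycles are present. In volume `V` the bosonic cycle count is `λ_k = n k / V`. -/
abbrev CycleCounts : Type := ℕ+ →₀ ℕ

instance : MeasurableSpace CycleCounts := ⊤

/-- The bosonic cycle count (number density) `λ_k` in volume `V`. -/
def cycleDensity (V : ℝ) (n : CycleCounts) (k : ℕ+) : ℝ := (n k : ℝ) / V

/-- `q̄^{(α)} = ∑_k q_k e^{βαk}`. -/
def totalWeight (d : ℕ) (β α : ℝ) : ℝ :=
  ∑' k : ℕ+, cycleWeight d β k * Real.exp (β * α * (k : ℕ))

/-- The probability, under the ideal Bose gas reference process in volume `V`, of the cycle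
configuration `n`: the numbers of cycles of the different lengths `k` are independent Poisson
variables with parameters `V q_k e^{βαk}`. -/
def referenceWeight (d : ℕ) (β α V : ℝ) (n : CycleCounts) : ℝ :=
  Real.exp (-(V * totalWeight d β α)) *
    ∏ k ∈ n.support,
      (V * cycleWeight d β k * Real.exp (β * α * (k : ℕ))) ^ (n k) / (Nat.factorial (n k) : ℝ)

/-- The law of the cycle configuration under the reference process. -/
def referenceMeasure (d : ℕ) (β α V : ℝ) : Measure CycleCounts :=
  Measure.sum fun n => ENNReal.ofReal (referenceWeight d β α V n) • Measure.dirac n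

/-- The density `∑_{k < m} k λ_k` of particles in cycles shorter than `m`. -/
def shortDensity (V : ℝ) (m : ℕ) (n : CycleCounts) : ℝ :=
  ∑ k ∈ n.support with PNat.val k < m, (k : ℕ) * cycleDensity V n k

/-- The density `∑_{k ≥ m} k λ_k` of particles in cycles of length at least `m`. -/
def longDensity (V : ℝ) (m : ℕ) (n : CycleCounts) : ℝ :=
  ∑ k ∈ n.support with m ≤ PNat.val k, (k : ℕ) * cycleDensity V n k

/-- The pair empirical particle density. -/
def pairDensity (V : ℝ) (m : ℕ) (n : CycleCounts) : EuclideanSpace ℝ (Fin 2) :=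
  !₂[shortDensity V m n, longDensity V m n]

/-- The Hamiltonian of the spatial cycle HYL model in volume `V` with cut-off `m`. -/
def hamiltonian (a b α μ V : ℝ) (m : ℕ) (n : CycleCounts) : ℝ :=
  V * (-(μ - α) * ∑ k ∈ n.support, (k : ℕ) * cycleDensity V n k
    + a / 2 * (∑ k ∈ n.support, (k : ℕ) * cycleDensity V n k) ^ 2
    - b / 2 * ∑ k ∈ n.support with m ≤ PNat.val k, ((k : ℕ) : ℝ) ^ 2 * cycleDensity V n k ^ 2)

/-- The Gibbs distribution of the spatial cycle HYL model: it has density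
`e^{-βH} / E[e^{-βH}]` with respect to the reference process. -/
def gibbsMeasure (d : ℕ) (β a b α μ V : ℝ) (m : ℕ) : Measure CycleCounts :=
  (referenceMeasure d β α V).tilted fun n => -β * hamiltonian a b α μ V m n

/-- The centred box in `ℝ^d` with side lengths `ℓ`. -/
def centredBox {d : ℕ} (ℓ : Fin d → ℝ) : Set (Fin d → ℝ) :=
  Set.univ.pi fun i => Set.Icc (-(ℓ i) / 2) (ℓ i / 2)

/-- The volume of the centred box with side lengths `ℓ`. -/
def boxVolume {d : ℕ} (ℓ : Fin d → ℝ) : ℝ := (volume : Measure (Fin d → ℝ)).real (centredBox ℓ)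

/-- A sequence of centred boxes with volumes tending to infinity, together with cut-offs `m`
such that `m → ∞` and `m / |Λ| → κ ∈ [0, ∞]`. -/
structure IsThermodynamicSequence {d : ℕ} (κ : ℝ≥0∞) (ℓ : ℕ → Fin d → ℝ) (m : ℕ → ℕ) : Prop where
  side_pos : ∀ j i, 0 < ℓ j i
  tendsto_volume : Tendsto (fun j => boxVolume (ℓ j)) atTop atTop
  tendsto_cutoff : Tendsto m atTop atTop
  tendsto_ratio : Tendsto (fun j => ENNReal.ofReal ((m j : ℝ) / boxVolume (ℓ j))) atTop (𝓝 κ)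

/-- The pair empirical particle density converges to `(x, y)` in probability under the Gibbs
distributions, along every thermodynamic sequence of parameter `κ`. -/
def PairDensityConcentratesAt (d : ℕ) (β a b α μ : ℝ) (κ : ℝ≥0∞) (x y : ℝ) : Prop :=
  ∀ (ℓ : ℕ → Fin d → ℝ) (m : ℕ → ℕ), IsThermodynamicSequence κ ℓ m → ∀ δ : ℝ, 0 < δ →
    Tendsto (fun j => gibbsMeasure d β a b α μ (boxVolume (ℓ j)) (m j)
      {n | pairDensity (boxVolume (ℓ j)) (m j) n ∈ Metric.ball !₂[x, y] δ}) atTop (𝓝 1)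

/-- The ideal Bose gas pressure `p₀(β, s) = β⁻¹ ∑_k q_k e^{βsk} ∈ [0, ∞]`
(it equals `∞` for `s > 0`). -/
def idealPressure (d : ℕ) (β s : ℝ) : ℝ≥0∞ :=
  ENNReal.ofReal (1 / β) *
    ∑' k : ℕ+, ENNReal.ofReal (cycleWeight d β k * Real.exp (β * s * (k : ℕ)))

/-- The ideal Bose gas free energy `f₀(β, x) = sup_s {s x - p₀(β, s)}`. -/
def idealFreeEnergy (d : ℕ) (β x : ℝ) : EReal :=
  ⨆ s : ℝ, ((s * x : ℝ) : EReal) - (idealPressure d β s : EReal)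

/-- The set `ℝ₊ × ({0} ∪ [κ, ∞))`; for `κ = ∞` it is `ℝ₊ × {0}`. -/
def admissible (κ : ℝ≥0∞) : Set (ℝ × ℝ) :=
  {z | 0 ≤ z.1 ∧ (z.2 = 0 ∨ (0 ≤ z.2 ∧ κ ≤ ENNReal.ofReal z.2))}

/-- The variational pressure
`sup {μ(x+y) - a/2 (x+y)² + b/2 y² - f₀(β,x)}` over the admissible `(x, y)`. -/
def pressure (d : ℕ) (β a b μ : ℝ) (κ : ℝ≥0∞) : EReal :=
  ⨆ z ∈ admissible κ,
    ((μ * (z.1 + z.2) - a / 2 * (z.1 + z.2) ^ 2 + b / 2 * z.2 ^ 2 : ℝ) : EReal)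
      - idealFreeEnergy d β z.1

open Classical in
/-- The rate function `I^{(κ)}`. -/
def rateFunction (d : ℕ) (β a b μ : ℝ) (κ : ℝ≥0∞) (z : ℝ × ℝ) : EReal :=
  if z ∈ admissible κ then
    idealFreeEnergy d β z.1
      + ((-μ * (z.1 + z.2) + a / 2 * (z.1 + z.2) ^ 2 - b / 2 * z.2 ^ 2 : ℝ) : EReal)
      + pressure d β a b μ κ
  else ⊤

/-- The zeroes of the rate function. -/
def zeroes (d : ℕ) (β a b μ : ℝ) (κ : ℝ≥0∞) : Set (ℝ × ℝ) :=
  {z | rateFunction d β a b μ κ z = 0}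

/-- The derivative `p₀'(β, s)` of the ideal pressure in `s` (used for `s < 0`). -/
def idealPressureDeriv (d : ℕ) (β s : ℝ) : ℝ :=
  deriv (fun t => (idealPressure d β t).toReal) s

open Classical in
/-- The critical density of the ideal Bose gas: `ζ(d/2) / (4πβ)^{d/2}` for `d ≥ 3`,
and `∞` for `d = 1, 2`. -/
def criticalDensity (d : ℕ) (β : ℝ) : ℝ≥0∞ :=
  if 3 ≤ d then
    ENNReal.ofReal (1 / (4 * Real.pi * β) ^ ((d : ℝ) / 2) *
      ∑' k : ℕ+, 1 / ((k : ℕ) : ℝ) ^ ((d : ℝ) / 2))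
  else ⊤

open Classical in
/-- `s_β(x)`: it is `0` above the critical density, and below it the unique solution `s < 0` of
`p₀'(β, s) = x`. -/
def sBeta (d : ℕ) (β x : ℝ) : ℝ :=
  if criticalDensity d β ≤ ENNReal.ofReal x then 0
  else Classical.epsilon fun s : ℝ => s < 0 ∧ idealPressureDeriv d β s = x

/-- `μ_t(β) = inf_{s<0} {a p₀'(β, s) - (a-b)/b s}`. -/
def muT (d : ℕ) (β a b : ℝ) : ℝ :=
  sInf ((fun s => a * idealPressureDeriv d β s - (a - b) / b * s) '' Set.Iio 0)

/-- `μ_c = a ϱ_c`, possibly infinite. -/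
def muC (d : ℕ) (β a : ℝ) : ℝ≥0∞ := ENNReal.ofReal a * criticalDensity d β

/-- `x̃₁(μ)`: the unique `x > 0` with `s_β(x) = μ - a x`. -/
def xOne (d : ℕ) (β a μ : ℝ) : ℝ :=
  Classical.epsilon fun x : ℝ => 0 < x ∧ sBeta d β x = μ - a * x

/-- `x̃₂(μ)`, for `μ ≥ μ_t`: the minimal `x > 0` with `s_β(x) = -b/(a-b) (μ - a x)`. -/
def xTwo (d : ℕ) (β a b μ : ℝ) : ℝ :=
  Classical.epsilon fun x : ℝ =>
    IsLeast {x : ℝ | 0 < x ∧ sBeta d β x = -(b / (a - b)) * (μ - a * x)} x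

/-- `x̃₃(μ) = x̃₁(μ - aκ)`. -/
def xThree (d : ℕ) (β a κ μ : ℝ) : ℝ := xOne d β a (μ - a * κ)

/-- `μ_r(β, κ) = inf {s ≥ μ_t : x̃₂(s) ≤ (s - κ(a-b))/a}`. -/
def muR (d : ℕ) (β a b κ : ℝ) : ℝ :=
  sInf {s : ℝ | muT d β a b ≤ s ∧ xTwo d β a b s ≤ 1 / a * (s - κ * (a - b))}

end

end HYL

namespace HYL

/-! The free energy is finite on `[0, ∞)` and the supremum in the rate function is minus the infimum
of `energy`, so the zeroes are exactly the minimisers of `energy` over the admissible set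
(`zeroes_eq_minimisers`). What remains is a calculus problem for these minimisers and a large
deviation estimate.

Calculus. Coercivity gives existence. Every minimiser has `x > 0` and `s_β(x) = μ - a(x + y)`
(`first_order_fst`). If `y = 0`, this forces `x = x̃₁`. If `y` may be varied in both directions,
then also `(a - b) y = μ - a x`, so `criticalPotential` takes the value `μ` at `x`; this function is
strictly quasi-convex below the critical density, and only its first crossing `x̃₂` can minimise
(`eq_xTwo_of_mem_minimisers`). If `y = κ`, the long cycles merely shift `μ` by `aκ`, which gives
`x̃₃`. Monotonicity in `μ` decides between the candidates. For `κ = 0`, once long cycles are optimal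
they are strictly better for every larger `μ` (`snd_ne_zero_of_lt`), so `μ*` is the infimum of the
condensed potentials. For `0 < κ < ∞`, `μ_r` is the threshold at which the condensate of `x̃₂`
reaches density `κ` (`muR_spec`). If `μ_r > μ*`, then `μ*_κ` is the zero of `advantage`, which
increases strictly up to `μ_r` and changes sign in between. These comparisons use duality: a
parameter `r ≤ 0` that is optimal for one `μ` still gives a valid bound for another, so the pressure
need not be differentiated in `μ`.

Probability. An exponential Chebyshev bound on the short cycles, together with the vanishing total
weight of long cycles, bounds the weight of any event of large energy (`tsum_gibbsWeight_le`). A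
single configuration, made of rounded optimal Poisson means and at most one macroscopic cycle,
bounds the partition function from below (`eventually_exists_gibbsWeight_ge`). Compactness provides
an energy gap away from the unique minimiser (`energy_gap`), and the quotient of the two bounds
decays exponentially in the volume. -/

theorem hasDerivAt_of_subgradient {f g : ℝ → ℝ} {s : Set ℝ} {x : ℝ} (hs : s ∈ 𝓝 x)
    (h : ∀ u ∈ s, ∀ v ∈ s, f u + g u * (v - u) ≤ f v) (hg : ContinuousAt g x) :
    HasDerivAt f (g x) x := by
  rw [hasDerivAt_iff_isLittleO, Asymptotics.isLittleO_iff]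
  intro c hc
  have hg' := Metric.continuousAt_iff'.1 hg c hc
  filter_upwards [hs, hg'] with v hv hgv
  have hx : x ∈ s := mem_of_mem_nhds hs
  -- The subgradient inequalities at `x` and at `v` place the remainder between `0` and `(g v - g x)
  -- * (v - x)`, which is `o(v - x)` by continuity of `g`.
  have h1 := h x hx v hv
  have h2 := h v hv x hx
  rw [Real.dist_eq] at hgv
  simp only [smul_eq_mul, Real.norm_eq_abs]
  have h3 : |(g v - g x) * (v - x)| ≤ c * |v - x| := by
    rw [abs_mul]
    exact mul_le_mul_of_nonneg_right hgv.le (abs_nonneg _)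
  have h4 := (abs_le.1 h3).2
  rw [abs_le]
  constructor
  · have : 0 ≤ c * |v - x| := by positivity
    nlinarith
  · nlinarith

/-! ### The series of the ideal gas: pressure, density and critical density. -/

section

variable {d : ℕ} {β : ℝ}

theorem cycleWeight_pos (hβ : 0 < β) (k : ℕ+) : 0 < cycleWeight d β k := by
  have : (0 : ℝ) < (k : ℕ) := by exact_mod_cast k.pos
  have := Real.pi_pos
  unfold cycleWeight
  positivity

theorem mul_cycleWeight (k : ℕ+) :
    ((k : ℕ) : ℝ) * cycleWeight d β k =
      1 / (4 * Real.pi * β) ^ ((d : ℝ) / 2) * (1 / ((k : ℕ) : ℝ) ^ ((d : ℝ) / 2)) := by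
  have hk : (0 : ℝ) < (k : ℕ) := by exact_mod_cast k.pos
  unfold cycleWeight
  rw [Real.rpow_add hk, Real.rpow_one]
  field_simp

theorem summable_pnat_rpow {p : ℝ} :
    Summable (fun k : ℕ+ => 1 / ((k : ℕ) : ℝ) ^ p) ↔ 1 < p := by
  rw [← Real.summable_one_div_nat_rpow]
  exact summable_pnat_iff_summable_nat (f := fun n : ℕ => 1 / (n : ℝ) ^ p)

theorem summable_cycleWeight (hd : 1 ≤ d) : Summable (cycleWeight d β) := by
  have h : (1 : ℝ) < 1 + (d : ℝ) / 2 := by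
    have : (1 : ℝ) ≤ d := by exact_mod_cast hd
    linarith
  refine ((summable_pnat_rpow.2 h).mul_left (1 / (4 * Real.pi * β) ^ ((d : ℝ) / 2))).congr ?_
  intro k
  unfold cycleWeight
  rw [div_mul_div_comm, one_mul]

theorem mul_cycleWeight_nonneg (hβ : 0 < β) (k : ℕ+) :
    0 ≤ ((k : ℕ) : ℝ) * cycleWeight d β k :=
  mul_nonneg (Nat.cast_nonneg _) (cycleWeight_pos hβ k).le

/-- For `d ≤ 2` the series diverges, so both sides are `⊤`. In this form all later arguments are
uniform in the dimension. -/
theorem criticalDensity_eq_tsum (hβ : 0 < β) :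
    criticalDensity d β = ∑' k : ℕ+, ENNReal.ofReal ((k : ℕ) * cycleWeight d β k) := by
  have hc : 0 < 1 / (4 * Real.pi * β) ^ ((d : ℝ) / 2) := by
    have := Real.pi_pos
    positivity
  unfold criticalDensity
  split_ifs with h
  · rw [← ENNReal.ofReal_tsum_of_nonneg (mul_cycleWeight_nonneg hβ)]
    · simp_rw [mul_cycleWeight]
      rw [tsum_mul_left]
    · simp_rw [mul_cycleWeight]
      refine (summable_pnat_rpow.2 ?_).mul_left _
      have : (3 : ℝ) ≤ d := by exact_mod_cast h
      linarith
  · by_contra hne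
    have h1 := ENNReal.summable_toReal (Ne.symm hne)
    simp_rw [ENNReal.toReal_ofReal (mul_cycleWeight_nonneg hβ _), mul_cycleWeight] at h1
    rw [summable_mul_left_iff hc.ne', summable_pnat_rpow] at h1
    have : (d : ℝ) ≤ 2 := by
      have : d ≤ 2 := by omega
      exact_mod_cast this
    linarith

/-- The series `β⁻¹ ∑_k q_k e^{βsk}` as a real number, for `s ≤ 0`. -/
noncomputable def realPressure (d : ℕ) (β s : ℝ) : ℝ :=
  1 / β * ∑' k : ℕ+, cycleWeight d β k * Real.exp (β * s * (k : ℕ))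

/-- The density `∑_k k q_k e^{βsk}` of the ideal gas at chemical potential `s < 0`. -/
noncomputable def realDensity (d : ℕ) (β s : ℝ) : ℝ :=
  ∑' k : ℕ+, ((k : ℕ) : ℝ) * cycleWeight d β k * Real.exp (β * s * (k : ℕ))

theorem exp_mul_le_one (hβ : 0 < β) {s : ℝ} (hs : s ≤ 0) (k : ℕ+) :
    Real.exp (β * s * (k : ℕ)) ≤ 1 := by
  rw [Real.exp_le_one_iff]
  have : (0 : ℝ) ≤ (k : ℕ) := Nat.cast_nonneg _
  have : β * s ≤ 0 := mul_nonpos_of_nonneg_of_nonpos hβ.le hs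
  exact mul_nonpos_of_nonpos_of_nonneg this (Nat.cast_nonneg _)

theorem summable_pressure (hd : 1 ≤ d) (hβ : 0 < β) {s : ℝ} (hs : s ≤ 0) :
    Summable fun k : ℕ+ => cycleWeight d β k * Real.exp (β * s * (k : ℕ)) := by
  refine Summable.of_nonneg_of_le (fun k => ?_) (fun k => ?_) (summable_cycleWeight (d := d) (β := β) hd)
  · have := cycleWeight_pos (d := d) hβ k
    positivity
  · exact mul_le_of_le_one_right (cycleWeight_pos hβ k).le (exp_mul_le_one hβ hs k)

/-- Half of the exponential absorbs the factor `k`: `k e^{βsk/2} ≤ -2/(βs)`. The other half leaves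
the summable pressure series at `s / 2`. -/
theorem summable_density (hd : 1 ≤ d) (hβ : 0 < β) {s : ℝ} (hs : s < 0) :
    Summable fun k : ℕ+ => ((k : ℕ) : ℝ) * cycleWeight d β k * Real.exp (β * s * (k : ℕ)) := by
  have h := (summable_pressure hd hβ (s := s / 2) (by linarith)).mul_left (-2 / (β * s))
  have hbs : 0 < -(β * s) := by nlinarith
  refine Summable.of_nonneg_of_le (fun k => ?_) (fun k => ?_) h
  · have := cycleWeight_pos (d := d) hβ k
    positivity
  · have hq := cycleWeight_pos (d := d) hβ k
    have hsplit : Real.exp (β * s * (k : ℕ)) =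
        Real.exp (β * (s / 2) * (k : ℕ)) * Real.exp (β * (s / 2) * (k : ℕ)) := by
      rw [← Real.exp_add]; ring_nf
    have hle : ((k : ℕ) : ℝ) * Real.exp (β * (s / 2) * (k : ℕ)) ≤ -2 / (β * s) := by
      have h1 := Real.add_one_le_exp (-(β * (s / 2) * (k : ℕ)))
      have h2 : Real.exp (-(β * (s / 2) * (k : ℕ))) * Real.exp (β * (s / 2) * (k : ℕ)) = 1 := by
        rw [← Real.exp_add]; simp
      have h3 := Real.exp_pos (β * (s / 2) * (k : ℕ))
      have h4 : (-2 : ℝ) / (β * s) = 2 / (-(β * s)) := by rw [div_neg, neg_div]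
      rw [h4, le_div_iff₀ hbs]
      nlinarith
    rw [hsplit]
    have h5 : 0 ≤ cycleWeight d β k * Real.exp (β * (s / 2) * (k : ℕ)) := by positivity
    calc _ = (cycleWeight d β k * Real.exp (β * (s / 2) * (k : ℕ))) *
          (((k : ℕ) : ℝ) * Real.exp (β * (s / 2) * (k : ℕ))) := by ring
      _ ≤ (cycleWeight d β k * Real.exp (β * (s / 2) * (k : ℕ))) * (-2 / (β * s)) :=
          mul_le_mul_of_nonneg_left hle h5
      _ = _ := by ring

theorem realPressure_nonneg (hβ : 0 < β) (s : ℝ) : 0 ≤ realPressure d β s := by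
  unfold realPressure
  refine mul_nonneg (by positivity) (tsum_nonneg fun k => ?_)
  have := cycleWeight_pos (d := d) hβ k
  positivity

/-- Tangent line inequality for the pressure. -/
theorem realPressure_tangent (hd : 1 ≤ d) (hβ : 0 < β) {s t : ℝ} (hs : s < 0) (ht : t ≤ 0) :
    realPressure d β s + realDensity d β s * (t - s) ≤ realPressure d β t := by
  unfold realPressure realDensity
  have h1 := (summable_pressure hd hβ hs.le).mul_left (1 / β)
  have h2 := (summable_density hd hβ hs).mul_right (t - s)
  have h3 := (summable_pressure hd hβ ht).mul_left (1 / β)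
  rw [← tsum_mul_left, ← tsum_mul_left, ← tsum_mul_right, ← h1.tsum_add h2]
  refine (h1.add h2).tsum_le_tsum (fun k => ?_) h3
  have hq := cycleWeight_pos (d := d) hβ k
  have he : Real.exp (β * t * (k : ℕ)) =
      Real.exp (β * s * (k : ℕ)) * Real.exp (β * (t - s) * (k : ℕ)) := by
    rw [← Real.exp_add]; ring_nf
  have h4 := Real.add_one_le_exp (β * (t - s) * (k : ℕ))
  have h5 : 0 < 1 / β * cycleWeight d β k * Real.exp (β * s * (k : ℕ)) := by positivity
  calc _ = (1 / β * cycleWeight d β k * Real.exp (β * s * (k : ℕ))) *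
        (β * (t - s) * (k : ℕ) + 1) := by field_simp; ring
    _ ≤ (1 / β * cycleWeight d β k * Real.exp (β * s * (k : ℕ))) *
        Real.exp (β * (t - s) * (k : ℕ)) := mul_le_mul_of_nonneg_left h4 h5.le
    _ = _ := by rw [he]; ring

/-- Replaces the tangent inequality at the endpoint `s = 0`, where no two-sided derivative exists:
termwise `1 - e^{βtk} ≤ -βtk`, and `∑ k q_k ≤ x`. It is the case of Young's inequality above the
critical density. -/
theorem realPressure_zero_sub_le (hd : 1 ≤ d) (hβ : 0 < β) {t x : ℝ} (ht : t ≤ 0)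
    (hx0 : 0 ≤ x) (hx : criticalDensity d β ≤ ENNReal.ofReal x) :
    realPressure d β 0 - realPressure d β t ≤ -t * x := by
  have hsum : Summable fun k : ℕ+ => ((k : ℕ) : ℝ) * cycleWeight d β k := by
    rw [criticalDensity_eq_tsum hβ] at hx
    have := ENNReal.summable_toReal (ne_top_of_le_ne_top ENNReal.ofReal_ne_top hx)
    simpa only [ENNReal.toReal_ofReal (mul_cycleWeight_nonneg hβ _)] using this
  have hle : ∑' k : ℕ+, ((k : ℕ) : ℝ) * cycleWeight d β k ≤ x := by
    rw [criticalDensity_eq_tsum hβ, ← ENNReal.ofReal_tsum_of_nonneg (mul_cycleWeight_nonneg hβ) hsum]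
      at hx
    exact (ENNReal.ofReal_le_ofReal_iff hx0).1 hx
  have h1 := (summable_pressure hd hβ (le_refl (0 : ℝ))).mul_left (1 / β)
  have h3 := (summable_pressure hd hβ ht).mul_left (1 / β)
  have h2 := hsum.mul_left (-t)
  refine le_trans ?_ (mul_le_mul_of_nonneg_left hle (neg_nonneg.2 ht))
  unfold realPressure
  rw [← tsum_mul_left, ← tsum_mul_left, ← tsum_mul_left, ← h1.tsum_sub h3]
  refine (h1.sub h3).tsum_le_tsum (fun k => ?_) h2
  have hq := cycleWeight_pos (d := d) hβ k
  have h4 := Real.add_one_le_exp (β * t * (k : ℕ))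
  have h5 : 0 < 1 / β * cycleWeight d β k := by positivity
  calc _ = (1 / β * cycleWeight d β k) * (1 - Real.exp (β * t * (k : ℕ))) := by simp; ring
    _ ≤ (1 / β * cycleWeight d β k) * (-(β * t * (k : ℕ))) :=
        mul_le_mul_of_nonneg_left (by linarith) h5.le
    _ = _ := by field_simp

/-- Convexity of the density, and not only of the pressure, makes `s ↦ a p₀'(s) - (a - b) s / b`
strictly convex. It also yields continuity of the density. -/
theorem strictConvexOn_realDensity (hd : 1 ≤ d) (hβ : 0 < β) :
    StrictConvexOn ℝ (Set.Iio 0) (realDensity d β) := by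
  refine ⟨convex_Iio _, ?_⟩
  intro s hs t ht hst u v hu hv huv
  simp only [smul_eq_mul, Set.mem_Iio] at *
  have hm : u * s + v * t < 0 := by nlinarith
  have h1 := (summable_density hd hβ hs).mul_left u
  have h2 := (summable_density hd hβ ht).mul_left v
  unfold realDensity
  rw [← tsum_mul_left, ← tsum_mul_left, ← h1.tsum_add h2]
  have key : ∀ k : ℕ+, ((k : ℕ) : ℝ) * cycleWeight d β k * Real.exp (β * (u * s + v * t) * (k : ℕ))
      < u * (((k : ℕ) : ℝ) * cycleWeight d β k * Real.exp (β * s * (k : ℕ))) +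
        v * (((k : ℕ) : ℝ) * cycleWeight d β k * Real.exp (β * t * (k : ℕ))) := by
    intro k
    have hk : (0 : ℝ) < (k : ℕ) := by exact_mod_cast k.pos
    have hq := cycleWeight_pos (d := d) hβ k
    have hne : β * s * (k : ℕ) ≠ β * t * (k : ℕ) := by
      intro h
      exact hst (mul_left_cancel₀ hβ.ne' (mul_right_cancel₀ hk.ne' h))
    have := strictConvexOn_exp.2 (Set.mem_univ (β * s * (k : ℕ))) (Set.mem_univ (β * t * (k : ℕ)))
      hne hu hv huv
    simp only [smul_eq_mul] at this
    have h5 : 0 < ((k : ℕ) : ℝ) * cycleWeight d β k := by positivity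
    have he : β * (u * s + v * t) * (k : ℕ) = u * (β * s * (k : ℕ)) + v * (β * t * (k : ℕ)) := by
      ring
    rw [he]
    nlinarith
  exact (summable_density hd hβ hm).tsum_lt_tsum (i := 1) (fun k => (key k).le) (key 1)
    (h1.add h2)

theorem realDensity_strictMono (hd : 1 ≤ d) (hβ : 0 < β) :
    StrictMonoOn (realDensity d β) (Set.Iio 0) := by
  intro s hs t ht hst
  have key : ∀ k : ℕ+, ((k : ℕ) : ℝ) * cycleWeight d β k * Real.exp (β * s * (k : ℕ))
      < ((k : ℕ) : ℝ) * cycleWeight d β k * Real.exp (β * t * (k : ℕ)) := by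
    intro k
    have hk : (0 : ℝ) < (k : ℕ) := by exact_mod_cast k.pos
    have hq := cycleWeight_pos (d := d) hβ k
    gcongr
  exact (summable_density hd hβ hs).tsum_lt_tsum (i := 1) (fun k => (key k).le) (key 1)
    (summable_density hd hβ ht)

theorem realDensity_pos (hd : 1 ≤ d) (hβ : 0 < β) {s : ℝ} (hs : s < 0) : 0 < realDensity d β s := by
  refine (summable_density hd hβ hs).tsum_pos (fun k => ?_) 1 ?_
  · have := cycleWeight_pos (d := d) hβ k
    positivity
  · have := cycleWeight_pos (d := d) hβ 1
    simp only [PNat.one_coe, Nat.cast_one]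
    positivity

theorem continuousOn_realDensity (hd : 1 ≤ d) (hβ : 0 < β) :
    ContinuousOn (realDensity d β) (Set.Iio 0) :=
  (strictConvexOn_realDensity hd hβ).convexOn.continuousOn isOpen_Iio

theorem hasDerivAt_realPressure (hd : 1 ≤ d) (hβ : 0 < β) {s : ℝ} (hs : s < 0) :
    HasDerivAt (realPressure d β) (realDensity d β s) s :=
  hasDerivAt_of_subgradient (Iio_mem_nhds hs)
    (fun _ hu _ hv => realPressure_tangent hd hβ hu (le_of_lt hv))
    ((continuousOn_realDensity hd hβ).continuousAt (Iio_mem_nhds hs))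

theorem idealPressure_of_nonpos (hd : 1 ≤ d) (hβ : 0 < β) {s : ℝ} (hs : s ≤ 0) :
    idealPressure d β s = ENNReal.ofReal (realPressure d β s) := by
  unfold idealPressure realPressure
  rw [ENNReal.ofReal_mul (by positivity), ENNReal.ofReal_tsum_of_nonneg _
    (summable_pressure hd hβ hs)]
  intro k
  have := cycleWeight_pos (d := d) hβ k
  positivity

/-- The exponential beats the power of `k`, so the terms do not tend to zero. -/
theorem idealPressure_of_pos (hβ : 0 < β) {s : ℝ} (hs : 0 < s) : idealPressure d β s = ⊤ := by
  unfold idealPressure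
  rw [ENNReal.mul_eq_top]
  left
  refine ⟨by simpa using hβ, ?_⟩
  by_contra hne
  have h1 := ENNReal.summable_toReal hne
  have hnn : ∀ k : ℕ+, 0 ≤ cycleWeight d β k * Real.exp (β * s * (k : ℕ)) := by
    intro k
    have := cycleWeight_pos (d := d) hβ k
    positivity
  simp_rw [ENNReal.toReal_ofReal (hnn _)] at h1
  have h2 : Summable fun n : ℕ => 1 / ((4 * Real.pi * β) ^ ((d : ℝ) / 2) *
      (n : ℝ) ^ (1 + (d : ℝ) / 2)) * Real.exp (β * s * n) :=
    (summable_pnat_iff_summable_nat (f := fun n : ℕ => 1 / ((4 * Real.pi * β) ^ ((d : ℝ) / 2) *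
      (n : ℝ) ^ (1 + (d : ℝ) / 2)) * Real.exp (β * s * n))).1 h1
  have h3 := h2.tendsto_atTop_zero
  have h4 : Tendsto (fun x : ℝ => Real.exp (β * s * x) / x ^ (1 + (d : ℝ) / 2)) atTop atTop :=
    tendsto_exp_mul_div_rpow_atTop _ _ (by positivity)
  have hc : 0 < 1 / (4 * Real.pi * β) ^ ((d : ℝ) / 2) := by
    have := Real.pi_pos
    positivity
  have h5 := (h4.comp tendsto_natCast_atTop_atTop).const_mul_atTop hc
  refine not_tendsto_nhds_of_tendsto_atTop h5 0 (h3.congr fun n => ?_)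
  simp only [Function.comp]
  ring

theorem idealPressureDeriv_eq (hd : 1 ≤ d) (hβ : 0 < β) {s : ℝ} (hs : s < 0) :
    idealPressureDeriv d β s = realDensity d β s := by
  unfold idealPressureDeriv
  refine HasDerivAt.deriv ((hasDerivAt_realPressure hd hβ hs).congr_of_eventuallyEq ?_)
  filter_upwards [Iio_mem_nhds hs] with t ht
  rw [idealPressure_of_nonpos hd hβ (le_of_lt ht), ENNReal.toReal_ofReal (realPressure_nonneg hβ _)]

theorem realDensity_lt_of_criticalDensity_le (hd : 1 ≤ d) (hβ : 0 < β) {x s : ℝ} (hs : s < 0)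
    (hx0 : 0 ≤ x)
    (hx : criticalDensity d β ≤ ENNReal.ofReal x) : realDensity d β s < x := by
  have hs2 : s / 2 < 0 := by linarith
  refine (realDensity_strictMono hd hβ hs hs2 (by linarith)).trans_le ?_
  rw [← ENNReal.ofReal_le_ofReal_iff hx0]
  refine le_trans ?_ hx
  unfold realDensity
  rw [criticalDensity_eq_tsum hβ, ENNReal.ofReal_tsum_of_nonneg _ (summable_density hd hβ hs2)]
  · refine ENNReal.tsum_le_tsum fun k => ENNReal.ofReal_le_ofReal ?_
    exact mul_le_of_le_one_right (mul_cycleWeight_nonneg hβ k) (exp_mul_le_one hβ hs2.le k)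
  · intro k
    have := cycleWeight_pos (d := d) hβ k
    positivity

/-- A finite partial sum at `s = 0` already exceeds `x`, and by continuity it still does for
slightly negative `s`. -/
theorem exists_lt_realDensity (hd : 1 ≤ d) (hβ : 0 < β) {x : ℝ}
    (hx : ENNReal.ofReal x < criticalDensity d β) : ∃ s < 0, x < realDensity d β s := by
  rw [criticalDensity_eq_tsum hβ, ENNReal.tsum_eq_iSup_sum, lt_iSup_iff] at hx
  obtain ⟨A, hA⟩ := hx
  rw [← ENNReal.ofReal_sum_of_nonneg fun k _ => mul_cycleWeight_nonneg hβ k] at hA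
  have hA' : x < ∑ k ∈ A, ((k : ℕ) : ℝ) * cycleWeight d β k := (ENNReal.ofReal_lt_ofReal_iff'.1 hA).1
  have hcont : Continuous fun s : ℝ =>
      ∑ k ∈ A, ((k : ℕ) : ℝ) * cycleWeight d β k * Real.exp (β * s * (k : ℕ)) := by fun_prop
  have h0 : ∀ᶠ s in 𝓝 (0 : ℝ), x <
      ∑ k ∈ A, ((k : ℕ) : ℝ) * cycleWeight d β k * Real.exp (β * s * (k : ℕ)) := by
    refine hcont.continuousAt.eventually_const_lt ?_
    simpa using hA'
  obtain ⟨ε, hε, hball⟩ := Metric.eventually_nhds_iff.1 h0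
  refine ⟨-(ε / 2), by linarith, ?_⟩
  have h1 := hball (y := -(ε / 2)) (by rw [Real.dist_eq, sub_zero, abs_neg, abs_of_pos] <;> linarith)
  refine h1.trans_le ((summable_density hd hβ (by linarith)).sum_le_tsum A fun k _ => ?_)
  have := cycleWeight_pos (d := d) hβ k
  positivity

theorem realDensity_le_exp (hd : 1 ≤ d) (hβ : 0 < β) {s : ℝ} (hs : s ≤ -1) :
    realDensity d β s ≤ Real.exp (β * (s + 1)) * realDensity d β (-1) := by
  unfold realDensity
  rw [← tsum_mul_left]
  refine (summable_density hd hβ (by linarith)).tsum_le_tsum (fun k => ?_)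
    ((summable_density hd hβ (by norm_num)).mul_left _)
  have hk : (1 : ℝ) ≤ (k : ℕ) := by exact_mod_cast k.pos
  have hq := cycleWeight_pos (d := d) hβ k
  have h : Real.exp (β * s * (k : ℕ)) ≤ Real.exp (β * (s + 1)) * Real.exp (β * (-1) * (k : ℕ)) := by
    rw [← Real.exp_add, Real.exp_le_exp]
    have : β * (s + 1) * (k : ℕ) ≤ β * (s + 1) * 1 :=
      mul_le_mul_of_nonpos_left hk (mul_nonpos_of_nonneg_of_nonpos hβ.le (by linarith))
    linarith
  calc _ ≤ ((k : ℕ) : ℝ) * cycleWeight d β k *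
        (Real.exp (β * (s + 1)) * Real.exp (β * (-1) * (k : ℕ))) := by gcongr
    _ = _ := by ring

theorem tendsto_realDensity_atBot (hd : 1 ≤ d) (hβ : 0 < β) :
    Tendsto (realDensity d β) atBot (𝓝 0) := by
  have h1 : Tendsto (fun s : ℝ => Real.exp (β * (s + 1)) * realDensity d β (-1)) atBot (𝓝 0) := by
    rw [← zero_mul (realDensity d β (-1))]
    refine Tendsto.mul_const _ (Real.tendsto_exp_atBot.comp ?_)
    exact (tendsto_atBot_add_const_right _ _ tendsto_id).const_mul_atBot hβ
  refine tendsto_of_tendsto_of_tendsto_of_le_of_le' tendsto_const_nhds h1 ?_ ?_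
  · filter_upwards [eventually_lt_atBot 0] with s hs using (realDensity_pos hd hβ hs).le
  · filter_upwards [eventually_le_atBot (-1)] with s hs using realDensity_le_exp hd hβ hs

theorem realPressure_le_realDensity (hd : 1 ≤ d) (hβ : 0 < β) {s : ℝ} (hs : s < 0) :
    realPressure d β s ≤ 1 / β * realDensity d β s := by
  unfold realPressure realDensity
  refine mul_le_mul_of_nonneg_left ?_ (by positivity)
  refine (summable_pressure hd hβ hs.le).tsum_le_tsum (fun k => ?_) (summable_density hd hβ hs)
  have hk : (1 : ℝ) ≤ (k : ℕ) := by exact_mod_cast k.pos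
  have hq := cycleWeight_pos (d := d) hβ k
  have := Real.exp_pos (β * s * (k : ℕ))
  have h5 : cycleWeight d β k ≤ (k : ℕ) * cycleWeight d β k := by nlinarith
  exact mul_le_mul_of_nonneg_right h5 this.le

theorem tendsto_realPressure_atBot (hd : 1 ≤ d) (hβ : 0 < β) :
    Tendsto (realPressure d β) atBot (𝓝 0) := by
  have h1 := (tendsto_realDensity_atBot hd hβ).const_mul (1 / β)
  rw [mul_zero] at h1
  refine tendsto_of_tendsto_of_tendsto_of_le_of_le' tendsto_const_nhds h1 ?_ ?_
  · exact Eventually.of_forall fun s => realPressure_nonneg hβ s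
  · filter_upwards [eventually_lt_atBot 0] with s hs using realPressure_le_realDensity hd hβ hs

end

/-! ### The inverse density `s_β` and the free energy `f₀`. -/

section

variable {d : ℕ} {β : ℝ}

theorem exists_realDensity_eq (hd : 1 ≤ d) (hβ : 0 < β) {x : ℝ} (hx0 : 0 < x)
    (hx : ENNReal.ofReal x < criticalDensity d β) : ∃ s < 0, realDensity d β s = x := by
  obtain ⟨t, ht, hxt⟩ := exists_lt_realDensity hd hβ hx
  have h1 := (tendsto_realDensity_atBot hd hβ).eventually_lt_const hx0
  obtain ⟨r, hr, hrt⟩ := (h1.and (eventually_lt_atBot t)).exists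
  have hsub : Set.Icc r t ⊆ Set.Iio 0 := fun z hz => lt_of_le_of_lt hz.2 ht
  obtain ⟨s, hs, hsx⟩ := intermediate_value_Icc hrt.le
    ((continuousOn_realDensity hd hβ).mono hsub) ⟨hr.le, hxt.le⟩
  exact ⟨s, hsub hs, hsx⟩

theorem sBeta_of_le {x : ℝ} (hx : criticalDensity d β ≤ ENNReal.ofReal x) : sBeta d β x = 0 := by
  unfold sBeta
  rw [if_pos hx]

theorem sBeta_spec (hd : 1 ≤ d) (hβ : 0 < β) {x : ℝ} (hx0 : 0 < x)
    (hx : ENNReal.ofReal x < criticalDensity d β) :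
    sBeta d β x < 0 ∧ realDensity d β (sBeta d β x) = x := by
  have h : ∃ s : ℝ, s < 0 ∧ idealPressureDeriv d β s = x := by
    obtain ⟨s, hs, hsx⟩ := exists_realDensity_eq hd hβ hx0 hx
    exact ⟨s, hs, by rw [idealPressureDeriv_eq hd hβ hs, hsx]⟩
  have h2 := Classical.epsilon_spec h
  unfold sBeta
  rw [if_neg (not_le.2 hx)]
  refine ⟨h2.1, ?_⟩
  rw [← idealPressureDeriv_eq hd hβ h2.1]
  exact h2.2

theorem sBeta_nonpos (hd : 1 ≤ d) (hβ : 0 < β) {x : ℝ} (hx0 : 0 < x) : sBeta d β x ≤ 0 := by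
  rcases lt_or_ge (ENNReal.ofReal x) (criticalDensity d β) with h | h
  · exact (sBeta_spec hd hβ hx0 h).1.le
  · exact (sBeta_of_le h).le

theorem realDensity_sBeta (hd : 1 ≤ d) (hβ : 0 < β) {x : ℝ} (hx0 : 0 < x)
    (hs : sBeta d β x < 0) : realDensity d β (sBeta d β x) = x := by
  rcases lt_or_ge (ENNReal.ofReal x) (criticalDensity d β) with h | h
  · exact (sBeta_spec hd hβ hx0 h).2
  · rw [sBeta_of_le h] at hs
    exact absurd hs (lt_irrefl 0)

/-- This adjunction between `s_β` and the density holds on both sides of the critical density.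
Monotonicity and continuity of `s_β` follow from it. -/
theorem le_sBeta_iff (hd : 1 ≤ d) (hβ : 0 < β) {x t : ℝ} (hx0 : 0 < x) (ht : t < 0) :
    t ≤ sBeta d β x ↔ realDensity d β t ≤ x := by
  rcases lt_or_ge (ENNReal.ofReal x) (criticalDensity d β) with h | h
  · obtain ⟨h1, h2⟩ := sBeta_spec hd hβ hx0 h
    rw [← (realDensity_strictMono hd hβ).le_iff_le ht h1, h2]
  · rw [sBeta_of_le h]
    exact ⟨fun _ => (realDensity_lt_of_criticalDensity_le hd hβ ht hx0.le h).le, fun _ => ht.le⟩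

theorem sBeta_lt_iff (hd : 1 ≤ d) (hβ : 0 < β) {x t : ℝ} (hx0 : 0 < x) (ht : t < 0) :
    sBeta d β x < t ↔ x < realDensity d β t := by
  rw [← not_le, le_sBeta_iff hd hβ hx0 ht, not_le]

theorem sBeta_realDensity (hd : 1 ≤ d) (hβ : 0 < β) {t : ℝ} (ht : t < 0) :
    sBeta d β (realDensity d β t) = t := by
  have hpos := realDensity_pos hd hβ ht
  have h1 : t ≤ sBeta d β (realDensity d β t) := (le_sBeta_iff hd hβ hpos ht).2 le_rfl
  refine le_antisymm (le_of_forall_gt fun r hr => ?_) h1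
  rcases lt_or_ge r 0 with h | h
  · exact (sBeta_lt_iff hd hβ hpos h).2 (realDensity_strictMono hd hβ ht h hr)
  · have : t / 2 < 0 := by linarith
    exact ((sBeta_lt_iff hd hβ hpos this).2
      (realDensity_strictMono hd hβ ht this (by linarith))).trans (by linarith)

theorem sBeta_mono (hd : 1 ≤ d) (hβ : 0 < β) {x y : ℝ} (hx0 : 0 < x) (hxy : x ≤ y) :
    sBeta d β x ≤ sBeta d β y := by
  refine le_of_forall_lt fun t ht => ?_
  have hy0 := hx0.trans_le hxy
  by_contra hcon
  push Not at hcon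
  obtain ⟨r, hr1, hr2⟩ := exists_between ht
  have hr0 : r < 0 := hr2.trans_le (sBeta_nonpos hd hβ hx0)
  have h3 := (le_sBeta_iff hd hβ hx0 hr0).1 hr2.le
  have h4 := (le_sBeta_iff hd hβ hy0 hr0).2 (h3.trans hxy)
  linarith

theorem sBeta_strictMono (hd : 1 ≤ d) (hβ : 0 < β) {x y : ℝ} (hx0 : 0 < x) (hxy : x < y)
    (hs : sBeta d β x < 0) : sBeta d β x < sBeta d β y := by
  refine lt_of_le_of_ne (sBeta_mono hd hβ hx0 hxy.le) fun h => ?_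
  have h1 := realDensity_sBeta hd hβ hx0 hs
  have h2 := realDensity_sBeta hd hβ (hx0.trans hxy) (h ▸ hs)
  rw [← h] at h2
  linarith

theorem continuousAt_sBeta (hd : 1 ≤ d) (hβ : 0 < β) {x : ℝ} (hx0 : 0 < x) :
    ContinuousAt (sBeta d β) x := by
  rw [ContinuousAt, tendsto_order]
  constructor
  · intro t ht
    obtain ⟨r, hr1, hr2⟩ := exists_between ht
    have hr0 : r < 0 := hr2.trans_le (sBeta_nonpos hd hβ hx0)
    have h1 : realDensity d β r ≤ x := (le_sBeta_iff hd hβ hx0 hr0).1 hr2.le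
    -- The midpoint of `t` and `r` makes the inequality strict, so that it persists for `y` near
    -- `x`.
    have h2' : realDensity d β ((t + r) / 2) < x :=
      (realDensity_strictMono hd hβ (show (t + r) / 2 < 0 by linarith) hr0 (by linarith)).trans_le h1
    filter_upwards [Ioi_mem_nhds h2'] with y hy
    have hy0 : 0 < y := (realDensity_pos hd hβ (show (t + r) / 2 < 0 by linarith)).trans hy
    have := (le_sBeta_iff hd hβ hy0 (show (t + r) / 2 < 0 by linarith)).2 (le_of_lt hy)
    linarith
  · intro t ht
    rcases lt_or_ge t 0 with h | h
    · have h1 := (sBeta_lt_iff hd hβ hx0 h).1 ht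
      filter_upwards [Iio_mem_nhds h1, Ioi_mem_nhds hx0] with y hy hy0
      exact (sBeta_lt_iff hd hβ hy0 h).2 hy
    · rcases lt_or_eq_of_le h with h' | h'
      · filter_upwards [Ioi_mem_nhds hx0] with y hy0
        exact (sBeta_nonpos hd hβ hy0).trans_lt h'
      · subst h'
        have h1 := realDensity_sBeta hd hβ hx0 ht
        have h2 : sBeta d β x / 2 < 0 := by linarith
        have h3 : x < realDensity d β (sBeta d β x / 2) := (sBeta_lt_iff hd hβ hx0 h2).1 (by linarith)
        filter_upwards [Iio_mem_nhds h3, Ioi_mem_nhds hx0] with y hy hy0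
        exact ((sBeta_lt_iff hd hβ hy0 h2).2 hy).trans h2

open Classical in
/-- The free energy `f₀(β, x)` as a real number, for `x ≥ 0`. -/
noncomputable def realFreeEnergy (d : ℕ) (β x : ℝ) : ℝ :=
  if x = 0 then 0 else sBeta d β x * x - realPressure d β (sBeta d β x)

theorem realFreeEnergy_zero : realFreeEnergy d β 0 = 0 := if_pos rfl

theorem realFreeEnergy_of_pos {x : ℝ} (hx : 0 < x) :
    realFreeEnergy d β x = sBeta d β x * x - realPressure d β (sBeta d β x) := if_neg hx.ne'

/-- Young's inequality for the free energy and the pressure. -/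
theorem le_realFreeEnergy (hd : 1 ≤ d) (hβ : 0 < β) {x s : ℝ} (hx : 0 ≤ x) (hs : s ≤ 0) :
    s * x - realPressure d β s ≤ realFreeEnergy d β x := by
  rcases hx.eq_or_lt with rfl | hx0
  · rw [realFreeEnergy_zero]
    have := realPressure_nonneg (d := d) hβ s
    linarith
  · rw [realFreeEnergy_of_pos hx0]
    rcases lt_or_ge (ENNReal.ofReal x) (criticalDensity d β) with h | h
    · obtain ⟨h1, h2⟩ := sBeta_spec hd hβ hx0 h
      have := realPressure_tangent hd hβ h1 hs
      rw [h2] at this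
      linarith
    · rw [sBeta_of_le h]
      have := realPressure_zero_sub_le hd hβ hs hx h
      linarith

/-- The supremum is only approached, not attained, when `x = 0`: there the maximising sequence is `s
→ -∞`. For `x > 0` the point `s_β(x)` attains it. -/
theorem exists_lt_of_lt_realFreeEnergy (hd : 1 ≤ d) (hβ : 0 < β) {x c : ℝ} (hx : 0 ≤ x)
    (hc : c < realFreeEnergy d β x) : ∃ s ≤ 0, c < s * x - realPressure d β s := by
  rcases hx.eq_or_lt with rfl | hx0
  · rw [realFreeEnergy_zero] at hc
    have h1 := (tendsto_realPressure_atBot hd hβ).eventually_lt_const (neg_pos.2 hc)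
    obtain ⟨s, hs, hs0⟩ := (h1.and (eventually_le_atBot 0)).exists
    exact ⟨s, hs0, by linarith⟩
  · rw [realFreeEnergy_of_pos hx0] at hc
    exact ⟨_, sBeta_nonpos hd hβ hx0, hc⟩

theorem idealFreeEnergy_eq (hd : 1 ≤ d) (hβ : 0 < β) {x : ℝ} (hx : 0 ≤ x) :
    idealFreeEnergy d β x = (realFreeEnergy d β x : EReal) := by
  unfold idealFreeEnergy
  have hterm : ∀ s ≤ 0, ((s * x : ℝ) : EReal) - (idealPressure d β s : EReal) =
      ((s * x - realPressure d β s : ℝ) : EReal) := by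
    intro s hs
    rw [idealPressure_of_nonpos hd hβ hs, EReal.coe_ennreal_ofReal,
      max_eq_left (realPressure_nonneg hβ s), ← EReal.coe_sub]
  refine le_antisymm (iSup_le fun s => ?_) (le_of_forall_lt fun c hc => ?_)
  · rcases le_or_gt s 0 with hs | hs
    · rw [hterm s hs]
      exact EReal.coe_le_coe_iff.2 (le_realFreeEnergy hd hβ hx hs)
    · rw [idealPressure_of_pos hβ hs, EReal.coe_ennreal_top, EReal.sub_top]
      exact bot_le
  · obtain ⟨r, hr1, hr2⟩ := EReal.lt_iff_exists_real_btwn.1 hc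
    obtain ⟨s, hs, hrs⟩ := exists_lt_of_lt_realFreeEnergy hd hβ hx (EReal.coe_lt_coe_iff.1 hr2)
    refine (hr1.trans (EReal.coe_lt_coe_iff.2 hrs)).trans_le ?_
    rw [← hterm s hs]
    exact le_iSup (fun s : ℝ => ((s * x : ℝ) : EReal) - (idealPressure d β s : EReal)) s

theorem realFreeEnergy_nonpos (hd : 1 ≤ d) (hβ : 0 < β) {x : ℝ} (hx : 0 ≤ x) :
    realFreeEnergy d β x ≤ 0 := by
  refine le_of_forall_lt fun c hc => ?_
  obtain ⟨s, hs, hcs⟩ := exists_lt_of_lt_realFreeEnergy hd hβ hx hc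
  have := realPressure_nonneg (d := d) hβ s
  nlinarith

theorem neg_realPressure_zero_le (hd : 1 ≤ d) (hβ : 0 < β) {x : ℝ} (hx : 0 ≤ x) :
    -realPressure d β 0 ≤ realFreeEnergy d β x := by
  have := le_realFreeEnergy hd hβ hx (le_refl (0 : ℝ))
  linarith

theorem realFreeEnergy_subgradient (hd : 1 ≤ d) (hβ : 0 < β) {x y : ℝ} (hx : 0 < x) (hy : 0 ≤ y) :
    realFreeEnergy d β x + sBeta d β x * (y - x) ≤ realFreeEnergy d β y := by
  have := le_realFreeEnergy hd hβ hy (sBeta_nonpos hd hβ hx)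
  rw [realFreeEnergy_of_pos hx]
  linarith

theorem hasDerivAt_realFreeEnergy (hd : 1 ≤ d) (hβ : 0 < β) {x : ℝ} (hx : 0 < x) :
    HasDerivAt (realFreeEnergy d β) (sBeta d β x) x :=
  hasDerivAt_of_subgradient (Ioi_mem_nhds hx)
    (fun _ hu _ hv => realFreeEnergy_subgradient hd hβ hu (le_of_lt hv))
    (continuousAt_sBeta hd hβ hx)

theorem continuousOn_realFreeEnergy (hd : 1 ≤ d) (hβ : 0 < β) :
    ContinuousOn (realFreeEnergy d β) (Set.Ici 0) := by
  intro x hx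
  rcases (show (0 : ℝ) ≤ x from hx).eq_or_lt with rfl | hx0
  · rw [ContinuousWithinAt, realFreeEnergy_zero, tendsto_order]
    constructor
    · intro c hc
      have hc' : c < realFreeEnergy d β 0 := by rwa [realFreeEnergy_zero]
      obtain ⟨s, hs, hcs⟩ := exists_lt_of_lt_realFreeEnergy hd hβ le_rfl hc'
      have hcont : ContinuousAt (fun y : ℝ => s * y - realPressure d β s) 0 := by fun_prop
      have := hcont.eventually_const_lt hcs
      filter_upwards [self_mem_nhdsWithin, nhdsWithin_le_nhds this] with y hy0 hy
      exact hy.trans_le (le_realFreeEnergy hd hβ hy0 hs)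
    · intro c hc
      filter_upwards [self_mem_nhdsWithin] with y hy
      exact (realFreeEnergy_nonpos hd hβ hy).trans_lt hc
  · exact (hasDerivAt_realFreeEnergy hd hβ hx0).continuousAt.continuousWithinAt

/-- The infinite negative slope of `f₀` at `0`. It keeps minimisers away from `x = 0` and makes the
critical potential blow up there. -/
theorem exists_sBeta_lt (hd : 1 ≤ d) (hβ : 0 < β) (t : ℝ) :
    ∃ ε > 0, ∀ x, 0 < x → x < ε → sBeta d β x < t := by
  have h : min t (-1) < 0 := (min_le_right _ _).trans_lt (by norm_num)
  refine ⟨realDensity d β (min t (-1)), realDensity_pos hd hβ h, fun x hx hxe => ?_⟩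
  exact ((sBeta_lt_iff hd hβ hx h).2 hxe).trans_le (min_le_left _ _)

end

/-! ### Minimisers of the energy: existence, first order conditions, `x̃₁` and `x̃₂`. -/

section

variable {d : ℕ} {β a b μ : ℝ} {κ : ℝ≥0∞}

/-- The rate function without its normalisation, on `[0, ∞)²`. -/
noncomputable def energy (d : ℕ) (β a b μ : ℝ) (z : ℝ × ℝ) : ℝ :=
  realFreeEnergy d β z.1 - μ * (z.1 + z.2) + a / 2 * (z.1 + z.2) ^ 2 - b / 2 * z.2 ^ 2

/-- The minimisers of the energy over the admissible set. -/
def minimisers (d : ℕ) (β a b μ : ℝ) (κ : ℝ≥0∞) : Set (ℝ × ℝ) :=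
  {z | z ∈ admissible κ ∧ ∀ w ∈ admissible κ, energy d β a b μ z ≤ energy d β a b μ w}

theorem admissible_nonneg {z : ℝ × ℝ} (hz : z ∈ admissible κ) : 0 ≤ z.2 := by
  rcases hz.2 with h | h
  · exact h.ge
  · exact h.1

/-- On the admissible set every term is a real number, so the pressure is minus the infimum of the
energy, and the rate function vanishes exactly where that infimum is attained. -/
theorem zeroes_eq_minimisers (hd : 1 ≤ d) (hβ : 0 < β) :
    zeroes d β a b μ κ = minimisers d β a b μ κ := by
  have hterm : ∀ w ∈ admissible κ,
      ((μ * (w.1 + w.2) - a / 2 * (w.1 + w.2) ^ 2 + b / 2 * w.2 ^ 2 : ℝ) : EReal)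
        - idealFreeEnergy d β w.1 = ((-energy d β a b μ w : ℝ) : EReal) := by
    intro w hw
    rw [idealFreeEnergy_eq hd hβ hw.1, ← EReal.coe_sub]
    congr 1
    unfold energy
    ring
  have hsum : ∀ z ∈ admissible κ, idealFreeEnergy d β z.1
      + ((-μ * (z.1 + z.2) + a / 2 * (z.1 + z.2) ^ 2 - b / 2 * z.2 ^ 2 : ℝ) : EReal) =
      ((energy d β a b μ z : ℝ) : EReal) := by
    intro z hz
    rw [idealFreeEnergy_eq hd hβ hz.1, ← EReal.coe_add]
    congr 1
    unfold energy
    ring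
  have hpress : pressure d β a b μ κ =
      ⨆ z ∈ admissible κ, ((-energy d β a b μ z : ℝ) : EReal) :=
    iSup_congr fun w => iSup_congr (hterm w)
  ext z
  simp only [zeroes, minimisers, Set.mem_ofPred_eq, rateFunction]
  split_ifs with hz
  · rw [hsum z hz, hpress]
    simp only [hz, true_and]
    constructor
    · intro h w hw
      have h1 : ((-energy d β a b μ w : ℝ) : EReal) ≤
          ⨆ z ∈ admissible κ, ((-energy d β a b μ z : ℝ) : EReal) :=
        le_iSup₂ (f := fun z (_ : z ∈ admissible κ) => ((-energy d β a b μ z : ℝ) : EReal)) w hw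
      have h2 : ((energy d β a b μ z : ℝ) : EReal) + ((-energy d β a b μ w : ℝ) : EReal) ≤ 0 := by
        rw [← h]
        gcongr
      rw [← EReal.coe_add, ← EReal.coe_zero, EReal.coe_le_coe_iff] at h2
      linarith
    · intro h
      have h1 : (⨆ z ∈ admissible κ, ((-energy d β a b μ z : ℝ) : EReal)) =
          ((-energy d β a b μ z : ℝ) : EReal) := by
        refine le_antisymm (iSup₂_le fun w hw => ?_)
          (le_iSup₂ (f := fun z (_ : z ∈ admissible κ) => ((-energy d β a b μ z : ℝ) : EReal)) z hz)
        rw [EReal.coe_le_coe_iff]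
        exact neg_le_neg (h w hw)
      rw [h1, ← EReal.coe_add, add_neg_cancel, EReal.coe_zero]
  · simp [hz]

theorem isClosed_admissible : IsClosed (admissible κ) := by
  have : admissible κ = {z : ℝ × ℝ | 0 ≤ z.1} ∩ ({z | z.2 = 0} ∪
      ({z | 0 ≤ z.2} ∩ {z | κ ≤ ENNReal.ofReal z.2})) := by
    ext z; simp [admissible]
  rw [this]
  refine (isClosed_le continuous_const continuous_fst).inter
    ((isClosed_eq continuous_snd continuous_const).union
      ((isClosed_le continuous_const continuous_snd).inter
        (isClosed_le continuous_const (ENNReal.continuous_ofReal.comp continuous_snd))))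

theorem continuousOn_energy (hd : 1 ≤ d) (hβ : 0 < β) :
    ContinuousOn (energy d β a b μ) {z | 0 ≤ z.1} := by
  unfold energy
  have h1 : ContinuousOn (fun z : ℝ × ℝ => realFreeEnergy d β z.1) {z | 0 ≤ z.1} :=
    (continuousOn_realFreeEnergy hd hβ).comp continuousOn_fst fun z hz => hz
  fun_prop

/-- Since `x, y ≥ 0`, replacing `b y² / 2` by `b (x + y)² / 2` only lowers the energy. What is left
is quadratic in `x + y` with positive leading coefficient because `b < a`. -/
theorem le_energy (hd : 1 ≤ d) (hβ : 0 < β) (hb : 0 < b) {z : ℝ × ℝ} (h1 : 0 ≤ z.1)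
    (h2 : 0 ≤ z.2) :
    -realPressure d β 0 - μ * (z.1 + z.2) + (a - b) / 2 * (z.1 + z.2) ^ 2 ≤
      energy d β a b μ z := by
  have := neg_realPressure_zero_le hd hβ h1
  unfold energy
  have h3 : 0 ≤ b * (z.1 ^ 2 + 2 * (z.1 * z.2)) := by positivity
  nlinarith

/-- The energy grows superlinearly. -/
theorem energy_coercive (hd : 1 ≤ d) (hβ : 0 < β) (hb : 0 < b) (hab : b < a) (μ c : ℝ) :
    ∃ R > 0, ∀ z : ℝ × ℝ, 0 ≤ z.1 → 0 ≤ z.2 → R ≤ z.1 + z.2 →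
      c + (z.1 + z.2) ≤ energy d β a b μ z := by
  have hab' : 0 < a - b := sub_pos.2 hab
  have h1 : Tendsto (fun t : ℝ => t * ((a - b) / 2 * t + (-μ - 1))) atTop atTop := by
    refine tendsto_id.atTop_mul_atTop₀ (tendsto_atTop_add_const_right _ _ ?_)
    exact tendsto_id.const_mul_atTop (by linarith)
  obtain ⟨R, hR⟩ := eventually_atTop.1 (h1.eventually_ge_atTop (c + realPressure d β 0))
  refine ⟨max R 1, by positivity, fun z hz1 hz2 hz => ?_⟩
  have h2 := hR (z.1 + z.2) ((le_max_left _ _).trans hz)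
  have h3 := le_energy (a := a) (μ := μ) hd hβ hb hz1 hz2
  nlinarith

theorem minimisers_nonempty (hd : 1 ≤ d) (hβ : 0 < β) (hb : 0 < b) (hab : b < a) :
    (minimisers d β a b μ κ).Nonempty := by
  have h0 : ((0, 0) : ℝ × ℝ) ∈ admissible κ := ⟨le_rfl, Or.inl rfl⟩
  have hcont : ContinuousOn (energy d β a b μ) (admissible κ) :=
    (continuousOn_energy hd hβ).mono fun z hz => hz.1
  obtain ⟨R, hR, hco⟩ := energy_coercive hd hβ hb hab μ (energy d β a b μ (0, 0))
  obtain ⟨z, hz, hmin⟩ := hcont.exists_isMinOn' isClosed_admissible h0 (by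
    have hK : IsCompact (Set.Icc ((0 : ℝ), (0 : ℝ)) (R, R)) := isCompact_Icc
    rw [eventually_inf_principal]
    filter_upwards [hK.compl_mem_cocompact] with w hw hwA
    have hw2 := admissible_nonneg hwA
    have hw1 := hwA.1
    have hsum : R ≤ w.1 + w.2 := by
      by_contra hcon
      push Not at hcon
      exact hw ⟨⟨hw1, hw2⟩, ⟨by simp only; linarith, by simp only; linarith⟩⟩
    have := hco w hw1 hw2 hsum
    linarith)
  exact ⟨z, hz, fun w hw => hmin hw⟩

theorem minimisers_eq_singleton (hd : 1 ≤ d) (hβ : 0 < β) (hb : 0 < b) (hab : b < a) {z : ℝ × ℝ}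
    (h : ∀ w ∈ minimisers d β a b μ κ, w = z) : minimisers d β a b μ κ = {z} :=
  Set.eq_singleton_iff_nonempty_unique_mem.2 ⟨minimisers_nonempty hd hβ hb hab, h⟩

/-- First order condition in the first variable. -/
theorem first_order_fst (hd : 1 ≤ d) (hβ : 0 < β) {x y : ℝ}
    (h : (x, y) ∈ minimisers d β a b μ κ) : 0 < x ∧ sBeta d β x = μ - a * (x + y) := by
  have hadm : ∀ u, 0 ≤ u → (u, y) ∈ admissible κ := fun u hu => ⟨hu, h.1.2⟩
  have hx0 : 0 ≤ x := h.1.1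
  have hpos : 0 < x := by
    refine lt_of_le_of_ne hx0 fun hx => ?_
    subst hx
    -- Moving from `0` to a small `u ≤ 1` must lower the energy. The term `|a|` in the threshold
    -- absorbs `a * u`, no sign of `a` being assumed.
    obtain ⟨ε, hε, hS⟩ := exists_sBeta_lt hd hβ (μ - a * y - |a|)
    set u := min (ε / 2) 1 with hu
    have hu0 : 0 < u := by positivity
    have hu1 : u ≤ 1 := min_le_right _ _
    have hue : u < ε := (min_le_left _ _).trans_lt (by linarith)
    have h1 := hS u hu0 hue
    have h2 := realFreeEnergy_subgradient hd hβ hu0 le_rfl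
    have h3 := h.2 (u, y) (hadm u hu0.le)
    simp only [energy, realFreeEnergy_zero] at h3
    rw [realFreeEnergy_zero] at h2
    have h4 : a * u ≤ |a| := by
      have := le_abs_self a
      have := abs_nonneg a
      nlinarith
    have h5 : 0 ≤ |a| := abs_nonneg a
    have h6 : u * (sBeta d β u - μ + a * y + a * u / 2) < 0 := by
      refine mul_neg_of_pos_of_neg hu0 ?_
      linarith
    nlinarith
  refine ⟨hpos, ?_⟩
  have hmin : IsLocalMin (fun u => energy d β a b μ (u, y)) x := by
    filter_upwards [Ioi_mem_nhds hpos] with u hu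
    exact h.2 (u, y) (hadm u (le_of_lt hu))
  have hder : HasDerivAt (fun u => energy d β a b μ (u, y))
      (sBeta d β x - μ * 1 + a / 2 * (2 * (x + y)) - 0) x := by
    unfold energy
    have hid := (hasDerivAt_id x).add_const y
    refine (((hasDerivAt_realFreeEnergy hd hβ hpos).sub (hid.const_mul μ)).add
      ((hid.pow 2).const_mul (a / 2))).sub (hasDerivAt_const x (b / 2 * y ^ 2)) |>.congr_deriv ?_
    simp
  have := hmin.hasDerivAt_eq_zero hder
  linarith

/-- First order condition in the second variable. -/
theorem first_order_snd {x y : ℝ} (h : (x, y) ∈ minimisers d β a b μ κ)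
    (hint : ∀ᶠ v in 𝓝 y, (x, v) ∈ admissible κ) : (a - b) * y = μ - a * x := by
  have hmin : IsLocalMin (fun v => energy d β a b μ (x, v)) y := by
    filter_upwards [hint] with v hv
    exact h.2 (x, v) hv
  have hder : HasDerivAt (fun v => energy d β a b μ (x, v))
      (-μ + a * (x + y) - b * y) y := by
    unfold energy
    have hid := (hasDerivAt_id y).const_add x
    refine ((((hid.const_mul μ).const_sub (realFreeEnergy d β x)).add
      ((hid.pow 2).const_mul (a / 2)))).sub (((hasDerivAt_id y).pow 2).const_mul (b / 2))
      |>.congr_deriv ?_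
    simp
    ring
  have := hmin.hasDerivAt_eq_zero hder
  linarith

theorem sBeta_add_strictMono (hd : 1 ≤ d) (hβ : 0 < β) (ha : 0 < a) {x y : ℝ} (hx : 0 < x)
    (hxy : x < y) : sBeta d β x + a * x < sBeta d β y + a * y := by
  have := sBeta_mono hd hβ hx hxy.le
  nlinarith

theorem xOne_eq (hd : 1 ≤ d) (hβ : 0 < β) (ha : 0 < a) {x : ℝ} (hx : 0 < x)
    (h : sBeta d β x = μ - a * x) : xOne d β a μ = x := by
  have hs := Classical.epsilon_spec (p := fun x : ℝ => 0 < x ∧ sBeta d β x = μ - a * x) ⟨x, hx, h⟩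
  change 0 < xOne d β a μ ∧ sBeta d β (xOne d β a μ) = μ - a * xOne d β a μ at hs
  rcases lt_trichotomy (xOne d β a μ) x with h1 | h1 | h1
  · have := sBeta_add_strictMono hd hβ ha hs.1 h1
    linarith [hs.2]
  · exact h1
  · have := sBeta_add_strictMono hd hβ ha hx h1
    linarith [hs.2]

/-- The defining equation is the first order condition of the problem without long cycles (`κ = ∞`),
so existence of a minimiser gives a solution. Uniqueness is the strict monotonicity of `s_β(x) + a
x`. -/
theorem xOne_spec (hd : 1 ≤ d) (hβ : 0 < β) (hb : 0 < b) (hab : b < a) (μ : ℝ) :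
    0 < xOne d β a μ ∧ sBeta d β (xOne d β a μ) = μ - a * xOne d β a μ := by
  obtain ⟨⟨x, y⟩, h⟩ := minimisers_nonempty (μ := μ) (κ := ⊤) hd hβ hb hab
  have hy : y = 0 := by
    rcases h.1.2 with h1 | h1
    · exact h1
    · exact absurd (top_le_iff.1 h1.2) ENNReal.ofReal_ne_top
  subst hy
  obtain ⟨hx, hs⟩ := first_order_fst hd hβ h
  rw [add_zero] at hs
  rw [xOne_eq hd hβ (hb.trans hab) hx hs]
  exact ⟨hx, hs⟩

theorem eq_xOne_of_mem_minimisers (hd : 1 ≤ d) (hβ : 0 < β) (ha : 0 < a) {x : ℝ}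
    (h : (x, 0) ∈ minimisers d β a b μ κ) : x = xOne d β a μ := by
  obtain ⟨hx, hs⟩ := first_order_fst hd hβ h
  rw [add_zero] at hs
  exact (xOne_eq hd hβ ha hx hs).symm

/-- The chemical potential for which a given short cycle density is critical for the energy
with optimised long cycle density. -/
noncomputable def criticalPotential (d : ℕ) (β a b x : ℝ) : ℝ :=
  a * x - (a - b) / b * sBeta d β x

theorem criticalPotential_eq_iff (hb : 0 < b) (hab : b < a) {x : ℝ} :
    criticalPotential d β a b x = μ ↔ sBeta d β x = -(b / (a - b)) * (μ - a * x) := by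
  have : 0 < a - b := sub_pos.2 hab
  unfold criticalPotential
  field_simp
  constructor <;> intro h <;> linarith

theorem continuousAt_criticalPotential (hd : 1 ≤ d) (hβ : 0 < β) {x : ℝ} (hx : 0 < x) :
    ContinuousAt (criticalPotential d β a b) x := by
  unfold criticalPotential
  have := continuousAt_sBeta hd hβ hx
  fun_prop

theorem exists_lt_criticalPotential (hd : 1 ≤ d) (hβ : 0 < β) (hb : 0 < b) (hab : b < a) (c : ℝ) :
    ∃ ε > 0, ∀ x, 0 < x → x < ε → c < criticalPotential d β a b x := by
  have hab' : 0 < (a - b) / b := div_pos (sub_pos.2 hab) hb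
  obtain ⟨ε, hε, h⟩ := exists_sBeta_lt (d := d) hd hβ (-(c / ((a - b) / b)))
  refine ⟨ε, hε, fun x hx hxe => ?_⟩
  have h1 := h x hx hxe
  have h2 : c < (a - b) / b * (-sBeta d β x) := by
    rw [← div_lt_iff₀' hab']
    linarith
  have : 0 < a * x := mul_pos (hb.trans hab) hx
  unfold criticalPotential
  linarith

/-- Strict quasi-convexity of the critical potential below the critical density. -/
theorem criticalPotential_lt (hd : 1 ≤ d) (hβ : 0 < β) (hb : 0 < b) (hab : b < a) {x u v c : ℝ}
    (hx : 0 < x) (hxu : x < u) (huv : u < v) (hv : sBeta d β v < 0)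
    (h1 : criticalPotential d β a b x ≤ c) (h2 : criticalPotential d β a b v ≤ c) :
    criticalPotential d β a b u < c := by
  have hu0 := hx.trans hxu
  have hu : sBeta d β u < 0 := (sBeta_mono hd hβ hu0 huv.le).trans_lt hv
  have hxs : sBeta d β x < 0 := (sBeta_mono hd hβ hx hxu.le).trans_lt hu
  have hs1 := sBeta_strictMono hd hβ hx hxu hxs
  have hs2 := sBeta_strictMono hd hβ hu0 huv hu
  -- In the variable `s = s_β(x)` the critical potential is strictly convex. As `s_β` is strictly
  -- increasing below the critical density, this becomes strict quasi-convexity in `x`.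
  have hconv : StrictConvexOn ℝ (Set.Iio 0)
      (fun s => a * realDensity d β s - (a - b) / b * s) := by
    refine ⟨convex_Iio _, fun p hp q hq hpq m n hm hn hmn => ?_⟩
    have h3 := (strictConvexOn_realDensity hd hβ).2 hp hq hpq hm hn hmn
    simp only [smul_eq_mul] at h3 ⊢
    have ha : 0 < a := hb.trans hab
    nlinarith
  have hg : ∀ w, 0 < w → sBeta d β w < 0 → criticalPotential d β a b w =
      a * realDensity d β (sBeta d β w) - (a - b) / b * sBeta d β w := by
    intro w hw hws
    rw [realDensity_sBeta hd hβ hw hws]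
    rfl
  rw [hg u hu0 hu]
  rw [hg x hx hxs] at h1
  rw [hg v (hu0.trans huv) hv] at h2
  have := hconv.lt_on_openSegment hxs hv (hs1.trans hs2).ne
    (by rw [openSegment_eq_Ioo (hs1.trans hs2)]; exact ⟨hs1, hs2⟩)
  exact this.trans_le (max_le h1 h2)

/-- The half-open interval `(0, X]` causes no loss of compactness, since the potential exceeds its
value at `X` near `0`. -/
theorem exists_isMinOn_criticalPotential (hd : 1 ≤ d) (hβ : 0 < β) (hb : 0 < b) (hab : b < a)
    {X : ℝ} (hX : 0 < X) : ∃ x, 0 < x ∧ x ≤ X ∧ ∀ u, 0 < u → u ≤ X →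
      criticalPotential d β a b x ≤ criticalPotential d β a b u := by
  obtain ⟨ε, hε, h⟩ := exists_lt_criticalPotential (d := d) (a := a) hd hβ hb hab (criticalPotential d β a b X)
  set e := min (ε / 2) X with he
  have he0 : 0 < e := by positivity
  have heX : e ≤ X := min_le_right _ _
  have hee : e < ε := (min_le_left _ _).trans_lt (by linarith)
  have hcont : ContinuousOn (criticalPotential d β a b) (Set.Icc e X) := fun u hu =>
    (continuousAt_criticalPotential hd hβ (he0.trans_le hu.1)).continuousWithinAt
  obtain ⟨x, hx, hmin⟩ := isCompact_Icc.exists_isMinOn ⟨X, heX, le_rfl⟩ hcont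
  refine ⟨x, he0.trans_le hx.1, hx.2, fun u hu huX => ?_⟩
  rcases le_or_gt e u with h1 | h1
  · exact hmin ⟨h1, huX⟩
  · exact (hmin (show X ∈ Set.Icc e X from ⟨heX, le_rfl⟩)).trans (h u hu (h1.trans hee)).le

theorem criticalPotential_realDensity (hd : 1 ≤ d) (hβ : 0 < β) {s : ℝ} (hs : s < 0) :
    criticalPotential d β a b (realDensity d β s) =
      a * idealPressureDeriv d β s - (a - b) / b * s := by
  unfold criticalPotential
  rw [sBeta_realDensity hd hβ hs, idealPressureDeriv_eq hd hβ hs]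

theorem muT_bddBelow (hd : 1 ≤ d) (hβ : 0 < β) (hb : 0 < b) (hab : b < a) :
    BddBelow ((fun s => a * idealPressureDeriv d β s - (a - b) / b * s) '' Set.Iio 0) := by
  refine ⟨0, ?_⟩
  rintro _ ⟨s, hs, rfl⟩
  have hs : s < 0 := hs
  simp only
  rw [idealPressureDeriv_eq hd hβ hs]
  have h1 := realDensity_pos hd hβ hs
  have ha : 0 < a := hb.trans hab
  have hab' : 0 < (a - b) / b := div_pos (sub_pos.2 hab) hb
  nlinarith [mul_pos ha h1]

theorem muT_le_criticalPotential (hd : 1 ≤ d) (hβ : 0 < β) (hb : 0 < b) (hab : b < a) {x : ℝ}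
    (hx : 0 < x) : muT d β a b ≤ criticalPotential d β a b x := by
  have ha : 0 < a := hb.trans hab
  have hab' : 0 < (a - b) / b := div_pos (sub_pos.2 hab) hb
  refine le_of_forall_pos_le_add fun ε hε => ?_
  -- The infimum runs over `s < 0` only, while `s_β(x)` may be `0`. Shifting it down by this amount
  -- costs exactly `ε` in the linear term, and the density can only decrease.
  set t := sBeta d β x - ε / ((a - b) / b) with ht
  have hε' : 0 < ε / ((a - b) / b) := by positivity
  have ht0 : t < 0 := by
    have := sBeta_nonpos hd hβ hx
    linarith
  have h1 : realDensity d β t ≤ x := (le_sBeta_iff hd hβ hx ht0).1 (by linarith)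
  have h2 : muT d β a b ≤ a * idealPressureDeriv d β t - (a - b) / b * t :=
    csInf_le (muT_bddBelow hd hβ hb hab) ⟨t, ht0, rfl⟩
  rw [idealPressureDeriv_eq hd hβ ht0] at h2
  unfold criticalPotential
  have h3 : (a - b) / b * (ε / ((a - b) / b)) = ε := mul_div_cancel₀ _ hab'.ne'
  have h4 : (a - b) / b * t = (a - b) / b * sBeta d β x - ε := by rw [ht, mul_sub, h3]
  nlinarith

theorem exists_criticalPotential_le (hd : 1 ≤ d) (hβ : 0 < β) (hb : 0 < b) (hab : b < a)
    (hμ : muT d β a b ≤ μ) : ∃ x, 0 < x ∧ criticalPotential d β a b x ≤ μ := by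
  have ha : 0 < a := hb.trans hab
  have hab' : 0 < (a - b) / b := div_pos (sub_pos.2 hab) hb
  -- Beyond this `X` the potential is at least `a x > |μ| + 1`, because `s_β ≤ 0`. Only the compact
  -- part can come near `μ_t ≤ μ`.
  set X := max ((|μ| + 1) / a) 1
  obtain ⟨x, hx, -, hmin⟩ := exists_isMinOn_criticalPotential (d := d) (a := a) hd hβ hb hab
    (X := X) (by positivity)
  refine ⟨x, hx, ?_⟩
  by_contra hcon
  push Not at hcon
  have h1 : min (criticalPotential d β a b x) (|μ| + 1) ≤ muT d β a b := by
    refine le_csInf (Set.nonempty_Iio.image _) ?_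
    rintro _ ⟨s, hs, rfl⟩
    have hs : s < 0 := hs
    have hpos := realDensity_pos hd hβ hs
    simp only
    rw [← criticalPotential_realDensity hd hβ hs]
    rcases le_or_gt (realDensity d β s) X with h | h
    · exact (min_le_left _ _).trans (hmin _ hpos h)
    · refine (min_le_right _ _).trans ?_
      have h2 : (|μ| + 1) / a < realDensity d β s := (le_max_left _ _).trans_lt h
      rw [div_lt_iff₀ ha] at h2
      have h3 := sBeta_nonpos hd hβ hpos
      unfold criticalPotential
      nlinarith
  have h2 := le_abs_self μ
  rcases min_le_iff.1 (h1.trans hμ) with h | h <;> linarith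

/-- The potential exceeds `μ` near `0`, so before any point of its sublevel set it crosses the level
`μ`. Hence the first solution also lies below every `x` with potential at most `μ`, which is
stronger than minimality among solutions. -/
theorem xTwo_spec (hd : 1 ≤ d) (hβ : 0 < β) (hb : 0 < b) (hab : b < a)
    (hμ : muT d β a b ≤ μ) :
    0 < xTwo d β a b μ ∧ criticalPotential d β a b (xTwo d β a b μ) = μ ∧
      ∀ x, 0 < x → criticalPotential d β a b x ≤ μ → xTwo d β a b μ ≤ x := by
  obtain ⟨x0, hx0, hle⟩ := exists_criticalPotential_le hd hβ hb hab hμ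
  obtain ⟨ε, hε, hlt⟩ := exists_lt_criticalPotential (d := d) (a := a) hd hβ hb hab μ
  set e := ε / 2
  have he0 : 0 < e := by positivity
  have hee : e < ε := half_lt_self hε
  have hIVT : ∀ x, 0 < x → criticalPotential d β a b x ≤ μ →
      ∃ u, e ≤ u ∧ u ≤ x ∧ criticalPotential d β a b u = μ := by
    intro x hx hxμ
    have hex : e ≤ x := by
      by_contra hcon
      push Not at hcon
      exact absurd hxμ (not_le.2 (hlt x hx (hcon.trans hee)))
    have hcont : ContinuousOn (criticalPotential d β a b) (Set.Icc e x) := fun u hu =>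
      (continuousAt_criticalPotential hd hβ (he0.trans_le hu.1)).continuousWithinAt
    obtain ⟨u, hu, huμ⟩ := intermediate_value_Icc' hex hcont ⟨hxμ, (hlt e he0 hee).le⟩
    exact ⟨u, hu.1, hu.2, huμ⟩
  obtain ⟨u0, hu0, -, hu0μ⟩ := hIVT x0 hx0 hle
  have hcont : ContinuousOn (criticalPotential d β a b) (Set.Icc e u0) := fun u hu =>
    (continuousAt_criticalPotential hd hβ (he0.trans_le hu.1)).continuousWithinAt
  have hcomp : IsCompact (Set.Icc e u0 ∩ criticalPotential d β a b ⁻¹' {μ}) :=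
    isCompact_Icc.of_isClosed_subset
      (hcont.preimage_isClosed_of_isClosed isClosed_Icc isClosed_singleton) Set.inter_subset_left
  obtain ⟨m, hm, hleast⟩ := hcomp.exists_isLeast ⟨u0, ⟨hu0, le_rfl⟩, hu0μ⟩
  have hall : ∀ x, 0 < x → criticalPotential d β a b x ≤ μ → m ≤ x := by
    intro x hx hxμ
    obtain ⟨u, hu1, hu2, hu3⟩ := hIVT x hx hxμ
    rcases le_or_gt u u0 with h | h
    · exact (hleast ⟨⟨hu1, h⟩, hu3⟩).trans hu2
    · exact (hm.1.2.trans h.le).trans hu2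
  have hex : ∃ x, IsLeast {x : ℝ | 0 < x ∧ sBeta d β x = -(b / (a - b)) * (μ - a * x)} x := by
    refine ⟨m, ⟨he0.trans_le hm.1.1, (criticalPotential_eq_iff hb hab).1 hm.2⟩, ?_⟩
    rintro x ⟨hx, hxs⟩
    exact hall x hx ((criticalPotential_eq_iff hb hab).2 hxs).le
  have hs := Classical.epsilon_spec hex
  change IsLeast _ (xTwo d β a b μ) at hs
  have h1 := (criticalPotential_eq_iff hb hab).2 hs.1.2
  refine ⟨hs.1.1, h1, fun x hx hxμ => ?_⟩
  exact (hs.2 ⟨he0.trans_le hm.1.1, (criticalPotential_eq_iff hb hab).1 hm.2⟩).trans (hall x hx hxμ)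

/-- A minimiser whose long cycle density lies in the interior of the admissible set. -/
theorem eq_xTwo_of_mem_minimisers (hd : 1 ≤ d) (hβ : 0 < β) (hb : 0 < b) (hab : b < a) {x y : ℝ}
    (h : (x, y) ∈ minimisers d β a b μ κ) (hy : 0 < y)
    (hint : ∀ᶠ v in 𝓝 y, (x, v) ∈ admissible κ) :
    muT d β a b ≤ μ ∧ x = xTwo d β a b μ ∧ y = (μ - a * x) / (a - b) ∧ sBeta d β x = -b * y := by
  have hab' : 0 < a - b := sub_pos.2 hab
  obtain ⟨hx, hs⟩ := first_order_fst hd hβ h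
  have hy2 := first_order_snd h hint
  have hsy : sBeta d β x = -b * y := by linarith
  have hcrit : criticalPotential d β a b x = μ := by
    unfold criticalPotential
    rw [hsy]
    field_simp
    linarith
  have hμ : muT d β a b ≤ μ := hcrit ▸ muT_le_criticalPotential hd hβ hb hab hx
  have hydef : y = (μ - a * x) / (a - b) := by
    rw [eq_div_iff hab'.ne']
    linarith
  refine ⟨hμ, ?_, hydef, hsy⟩
  obtain ⟨h1, h2, h3⟩ := xTwo_spec hd hβ hb hab hμ
  set x2 := xTwo d β a b μ with hx2
  rcases (h3 x hx hcrit.le).lt_or_eq with hlt | heq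
  swap
  · exact heq.symm
  exfalso
  have ha : 0 < a := hb.trans hab
  have hsx : sBeta d β x < 0 := by rw [hsy]; nlinarith
  -- Along the line of optimal `y` the energy has derivative proportional to `μ -
  -- criticalPotential`. Quasi-convexity makes this positive strictly between `x̃₂` and `x`, so a
  -- later crossing has larger energy than `x̃₂`.
  set φ : ℝ → ℝ := fun u => energy d β a b μ (u, (μ - a * u) / (a - b)) with hφ
  have hder : ∀ u, 0 < u → HasDerivAt φ (b / (a - b) * (μ - criticalPotential d β a b u)) u := by
    intro u hu
    have hl : HasDerivAt (fun u => (μ - a * u) / (a - b)) (-a / (a - b)) u := by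
      refine ((((hasDerivAt_id u).const_mul a).const_sub μ).div_const (a - b)).congr_deriv ?_
      simp
    have hid := (hasDerivAt_id u).add hl
    refine ((((hasDerivAt_realFreeEnergy hd hβ hu).sub (hid.const_mul μ)).add
      ((hid.pow 2).const_mul (a / 2)))).sub ((hl.pow 2).const_mul (b / 2)) |>.congr_deriv ?_
    simp [criticalPotential]
    field_simp
    ring
  have hmono : StrictMonoOn φ (Set.Icc x2 x) := by
    refine strictMonoOn_of_deriv_pos (convex_Icc _ _) (fun u hu =>
      (hder u (h1.trans_le hu.1)).continuousAt.continuousWithinAt) fun u hu => ?_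
    rw [interior_Icc] at hu
    rw [(hder u (h1.trans hu.1)).deriv]
    have := criticalPotential_lt hd hβ hb hab h1 hu.1 hu.2 hsx h2.le hcrit.le
    exact mul_pos (by positivity) (by linarith)
  have h4 := hmono ⟨le_rfl, hlt.le⟩ ⟨hlt.le, le_rfl⟩ hlt
  -- A smaller `x` gives a larger `y`, so the competitor is still admissible.
  have hyy : y ≤ (μ - a * x2) / (a - b) := by
    rw [hydef]
    gcongr
  have h5 : (x2, (μ - a * x2) / (a - b)) ∈ admissible κ := by
    refine ⟨h1.le, Or.inr ⟨hy.le.trans hyy, ?_⟩⟩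
    rcases h.1.2 with h6 | h6
    · exact absurd h6 hy.ne'
    · exact h6.2.trans (ENNReal.ofReal_le_ofReal hyy)
  have h6 := h.2 _ h5
  have h7 : φ x = energy d β a b μ (x, y) := by rw [hφ, hydef]
  rw [← h7] at h6
  exact absurd h4 (not_lt.2 h6)

end

/-! ### The phase diagram: the cases `κ = ∞` and `κ = 0`. -/

section

variable {d : ℕ} {β a b μ : ℝ} {κ : ℝ≥0∞}

theorem eventually_admissible_zero {x y : ℝ} (hx : 0 ≤ x) (hy : 0 < y) :
    ∀ᶠ v in 𝓝 y, (x, v) ∈ admissible 0 := by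
  filter_upwards [Ioi_mem_nhds hy] with v hv
  exact ⟨hx, Or.inr ⟨le_of_lt hv, zero_le⟩⟩

theorem mem_admissible_zero {z : ℝ × ℝ} (h1 : 0 ≤ z.1) (h2 : 0 ≤ z.2) : z ∈ admissible 0 :=
  ⟨h1, Or.inr ⟨h2, zero_le⟩⟩

theorem minimisers_top (hd : 1 ≤ d) (hβ : 0 < β) (hb : 0 < b) (hab : b < a) (μ : ℝ) :
    minimisers d β a b μ ⊤ = {(xOne d β a μ, 0)} := by
  refine minimisers_eq_singleton hd hβ hb hab fun w hw => ?_
  obtain ⟨x, y⟩ := w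
  have hy : y = 0 := by
    rcases hw.1.2 with h1 | h1
    · exact h1
    · exact absurd (top_le_iff.1 h1.2) ENNReal.ofReal_ne_top
  subst hy
  rw [← eq_xOne_of_mem_minimisers hd hβ (hb.trans hab) hw]

/-- The chemical potentials for which some minimiser has a positive density of long cycles. -/
def condensedSet (d : ℕ) (β a b : ℝ) : Set ℝ :=
  {μ | ∃ x y, 0 < y ∧ (x, y) ∈ minimisers d β a b μ 0}

/-- The value `-sup_x {μ x - a x² / 2 - f₀(β, x)}` in dual form. -/
noncomputable def dualPressure (d : ℕ) (β a μ : ℝ) : ℝ :=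
  realPressure d β (sBeta d β (xOne d β a μ)) + (μ - sBeta d β (xOne d β a μ)) ^ 2 / (2 * a)

/-- Substituting `x = (μ - s_β(x)) / a` turns the energy into its dual expression. With weak
duality, `x̃₁` minimises the energy on `y = 0`, and `s_β(x̃₁)` minimises the dual functional over `r
≤ 0`. -/
theorem energy_xOne (hd : 1 ≤ d) (hβ : 0 < β) (hb : 0 < b) (hab : b < a) (μ : ℝ) :
    energy d β a b μ (xOne d β a μ, 0) = -dualPressure d β a μ := by
  have ha : 0 < a := hb.trans hab
  obtain ⟨h1, h2⟩ := xOne_spec hd hβ hb hab μ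
  have h3 : xOne d β a μ = (μ - sBeta d β (xOne d β a μ)) / a := by
    rw [h2]; field_simp; ring
  unfold energy dualPressure
  simp only [add_zero]
  rw [realFreeEnergy_of_pos h1]
  set s := sBeta d β (xOne d β a μ)
  rw [h3]
  field_simp
  ring

/-- Weak duality. -/
theorem neg_le_energy_zero (hd : 1 ≤ d) (hβ : 0 < β) (ha : 0 < a) {x r : ℝ} (hx : 0 ≤ x)
    (hr : r ≤ 0) :
    -(realPressure d β r + (μ - r) ^ 2 / (2 * a)) ≤ energy d β a b μ (x, 0) := by
  have h1 := le_realFreeEnergy hd hβ hx hr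
  have h2 : 0 ≤ (a * x - (μ - r)) ^ 2 / (2 * a) := by positivity
  have h3 : (a * x - (μ - r)) ^ 2 / (2 * a) = a / 2 * x ^ 2 - (μ - r) * x + (μ - r) ^ 2 / (2 * a) := by
    field_simp
    ring
  unfold energy
  simp only [add_zero]
  nlinarith

theorem dualPressure_le (hd : 1 ≤ d) (hβ : 0 < β) (hb : 0 < b) (hab : b < a) {r : ℝ}
    (hr : r ≤ 0) : dualPressure d β a μ ≤ realPressure d β r + (μ - r) ^ 2 / (2 * a) := by
  have h1 := energy_xOne hd hβ hb hab μ
  have h2 := neg_le_energy_zero (b := b) (μ := μ) hd hβ (hb.trans hab)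
    (xOne_spec hd hβ hb hab μ).1.le hr
  linarith

theorem neg_dualPressure_le (hd : 1 ≤ d) (hβ : 0 < β) (hb : 0 < b) (hab : b < a) {x : ℝ}
    (hx : 0 ≤ x) : -dualPressure d β a μ ≤ energy d β a b μ (x, 0) :=
  neg_le_energy_zero hd hβ (hb.trans hab) hx (sBeta_nonpos hd hβ (xOne_spec hd hβ hb hab μ).1)

/-- Once long cycles are favourable they stay so for larger chemical potentials. -/
theorem snd_ne_zero_of_lt (hd : 1 ≤ d) (hβ : 0 < β) (hb : 0 < b) (hab : b < a) {ν x : ℝ}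
    (hμ : μ ∈ condensedSet d β a b) (hμν : μ < ν) : (x, 0) ∉ minimisers d β a b ν 0 := by
  intro hmin
  have ha : 0 < a := hb.trans hab
  have hab' : 0 < a - b := sub_pos.2 hab
  obtain ⟨u, y, hy, huy⟩ := hμ
  obtain ⟨hu, hs⟩ := first_order_fst hd hβ huy
  have hy2 := first_order_snd huy (eventually_admissible_zero hu.le hy)
  obtain ⟨h1, h2⟩ := xOne_spec hd hβ hb hab μ
  set r := sBeta d β (xOne d β a μ) with hr
  have hr0 : r ≤ 0 := sBeta_nonpos hd hβ h1
  -- The increasing function `s_β(x) + a x` equals `μ - a y` at `u` and the larger value `μ` at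
  -- `x̃₁`.
  have hux : u ≤ xOne d β a μ := by
    by_contra hcon
    push Not at hcon
    have := sBeta_add_strictMono hd hβ ha h1 hcon
    have : 0 < a * y := mul_pos ha hy
    linarith
  have hsr : sBeta d β u ≤ r := sBeta_mono hd hβ hu hux
  have e1 : energy d β a b μ (u, y) ≤ -(realPressure d β r + (μ - r) ^ 2 / (2 * a)) := by
    have := huy.2 (xOne d β a μ, 0) (mem_admissible_zero h1.le le_rfl)
    rw [energy_xOne hd hβ hb hab] at this
    exact this
  -- Here `r` is frozen at its optimal value for `μ`; weak duality keeps the bound valid at `ν`. It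
  -- then suffices that passing from `μ` to `ν` lowers the condensed energy by more than this bound
  -- (`e6`), which follows from `s_β(u) ≤ r`.
  have e2 : -(realPressure d β r + (ν - r) ^ 2 / (2 * a)) ≤ energy d β a b ν (x, 0) :=
    neg_le_energy_zero hd hβ ha hmin.1.1 hr0
  have hyν : y ≤ (ν - a * u) / (a - b) := by
    rw [le_div_iff₀ hab']
    linarith
  have e3 := hmin.2 (u, (ν - a * u) / (a - b)) (mem_admissible_zero hu.le (hy.le.trans hyν))
  have hydef : y = (μ - a * u) / (a - b) := by
    rw [eq_div_iff hab'.ne']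
    linarith
  have e4 : energy d β a b ν (u, (ν - a * u) / (a - b)) = energy d β a b μ (u, y) -
      (ν - μ) * ((μ + ν) / 2 - b * u) / (a - b) := by
    unfold energy
    simp only
    rw [hydef]
    field_simp
    ring
  have e5 : (μ - r) ^ 2 / (2 * a) - (ν - r) ^ 2 / (2 * a) = -((ν - μ) * ((μ + ν) / 2 - r) / a) := by
    field_simp
    ring
  have e6 : (ν - μ) * ((μ + ν) / 2 - r) / a < (ν - μ) * ((μ + ν) / 2 - b * u) / (a - b) := by
    rw [mul_div_assoc, mul_div_assoc]
    refine mul_lt_mul_of_pos_left ?_ (sub_pos.2 hμν)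
    rw [div_lt_div_iff₀ ha hab']
    have h5 : sBeta d β u * (a - b) ≤ r * (a - b) := mul_le_mul_of_nonneg_right hsr hab'.le
    have h6 : sBeta d β u * (a - b) = b * a * u - b * μ := by
      rw [hs]
      have : y * (a - b) = μ - a * u := by linarith
      linear_combination -a * this
    nlinarith
  linarith

/-- Long cycles alone reach energy `-μ² / (2(a - b))`, whereas without them the energy is at least
`-p₀(0) - μ² / (2a)`. For large `μ` the first is smaller. -/
theorem condensedSet_nonempty (hd : 1 ≤ d) (hβ : 0 < β) (hb : 0 < b) (hab : b < a) :
    (condensedSet d β a b).Nonempty := by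
  have ha : 0 < a := hb.trans hab
  have hab' : 0 < a - b := sub_pos.2 hab
  set c := 1 / (2 * (a - b)) - 1 / (2 * a) with hc
  have hc0 : 0 < c := by
    rw [hc, sub_pos]
    exact one_div_lt_one_div_of_lt (by linarith) (by linarith)
  set μ := realPressure d β 0 / c + 1 with hμ
  have hp : 0 ≤ realPressure d β 0 / c := div_nonneg (realPressure_nonneg hβ 0) hc0.le
  have hbig : realPressure d β 0 < c * μ ^ 2 := by
    have h1 : c * (realPressure d β 0 / c) = realPressure d β 0 := mul_div_cancel₀ _ hc0.ne'
    have h2 : c * μ = realPressure d β 0 + c := by rw [hμ, mul_add, h1, mul_one]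
    have h3 : μ ≤ μ ^ 2 := by
      have : 1 ≤ μ := by linarith
      nlinarith
    nlinarith
  refine ⟨μ, ?_⟩
  obtain ⟨⟨x, y⟩, h⟩ := minimisers_nonempty (d := d) (μ := μ) (κ := 0) hd hβ hb hab
  rcases (admissible_nonneg h.1).eq_or_lt with hy | hy
  · exfalso
    simp only at hy
    subst hy
    have h1 := h.2 (0, μ / (a - b)) (mem_admissible_zero le_rfl (by
      have : 0 ≤ μ := by linarith
      exact div_nonneg this hab'.le))
    have h2 := neg_le_energy_zero (b := b) (μ := μ) hd hβ ha h.1.1 (le_refl 0)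
    have h3 : energy d β a b μ (0, μ / (a - b)) = -(μ ^ 2 * (1 / (2 * (a - b)))) := by
      unfold energy
      simp only [realFreeEnergy_zero]
      field_simp
      ring
    rw [h3] at h1
    have h4 : (μ - 0) ^ 2 / (2 * a) = μ ^ 2 * (1 / (2 * a)) := by ring
    rw [h4] at h2
    have h5 : c * μ ^ 2 = μ ^ 2 * (1 / (2 * (a - b))) - μ ^ 2 * (1 / (2 * a)) := by rw [hc]; ring
    simp only at h2
    linarith
  · exact ⟨x, y, hy, h⟩

theorem muT_le_of_mem_condensedSet (hd : 1 ≤ d) (hβ : 0 < β) (hb : 0 < b) (hab : b < a)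
    (hμ : μ ∈ condensedSet d β a b) : muT d β a b ≤ μ := by
  obtain ⟨x, y, hy, h⟩ := hμ
  exact (eq_xTwo_of_mem_minimisers hd hβ hb hab h hy (eventually_admissible_zero h.1.1 hy)).1

/-- Above the critical density `f₀` is constant. Lowering the short density from `μ / a` to a point
`u` still above critical, with `y` optimal, therefore costs no free energy and gains `(μ - a u)²
(1/(2(a - b)) - 1/(2a)) > 0`. -/
theorem mem_condensedSet_of_muC_lt (hd : 1 ≤ d) (hβ : 0 < β) (hb : 0 < b) (hab : b < a)
    (hμ : (muC d β a : EReal) < (μ : EReal)) : μ ∈ condensedSet d β a b := by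
  have ha : 0 < a := hb.trans hab
  have hab' : 0 < a - b := sub_pos.2 hab
  have hμ0 : 0 < μ := by
    have h1 : ((0 : ℝ) : EReal) ≤ (muC d β a : EReal) := by
      rw [EReal.coe_zero]; exact EReal.coe_ennreal_nonneg _
    exact EReal.coe_lt_coe_iff.1 (h1.trans_lt hμ)
  have hμ' : muC d β a < ENNReal.ofReal μ := by
    rw [← EReal.coe_ennreal_lt_coe_ennreal_iff, EReal.coe_ennreal_ofReal, max_eq_left hμ0.le]
    exact hμ
  have hρ : criticalDensity d β < ENNReal.ofReal (μ / a) := by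
    rw [ENNReal.ofReal_div_of_pos ha, ENNReal.lt_div_iff_mul_lt (by simp [ha]) (by simp), mul_comm]
    exact hμ'
  obtain ⟨u, hu1, hu2⟩ := ENNReal.lt_iff_exists_nnreal_btwn.1 hρ
  have hu3 : (u : ℝ) < μ / a := by
    have h2 : 0 < μ / a := by positivity
    rw [← ENNReal.ofReal_coe_nnreal, ENNReal.ofReal_lt_ofReal_iff h2] at hu2
    exact hu2
  have hupos : (0 : ℝ) < u := by
    have : (0 : ℝ≥0∞) < u := (zero_le).trans_lt hu1
    exact_mod_cast this
  have hu4 : criticalDensity d β ≤ ENNReal.ofReal u := by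
    rw [ENNReal.ofReal_coe_nnreal]; exact hu1.le
  have hs1 : sBeta d β u = 0 := sBeta_of_le hu4
  have hs2 : sBeta d β (μ / a) = 0 := sBeta_of_le hρ.le
  obtain ⟨⟨x, y⟩, h⟩ := minimisers_nonempty (d := d) (μ := μ) (κ := 0) hd hβ hb hab
  rcases (admissible_nonneg h.1).eq_or_lt with hy | hy
  · exfalso
    simp only at hy
    subst hy
    have hx : x = μ / a := by
      rw [eq_xOne_of_mem_minimisers hd hβ ha h]
      refine xOne_eq hd hβ ha (by positivity) ?_
      rw [hs2]; field_simp; ring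
    subst hx
    have hau : a * u < μ := by rwa [lt_div_iff₀ ha, mul_comm] at hu3
    have h1 := h.2 (u, (μ - a * u) / (a - b)) (mem_admissible_zero hupos.le
      (div_nonneg (by linarith) hab'.le))
    have h2 : energy d β a b μ (μ / a, 0) - energy d β a b μ (u, (μ - a * u) / (a - b)) =
        (μ - a * u) ^ 2 * (1 / (2 * (a - b)) - 1 / (2 * a)) := by
      unfold energy
      simp only
      rw [realFreeEnergy_of_pos hupos, realFreeEnergy_of_pos (show 0 < μ / a by positivity), hs1, hs2]
      field_simp
      ring
    have h3 : 0 < (μ - a * u) ^ 2 * (1 / (2 * (a - b)) - 1 / (2 * a)) := by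
      refine mul_pos (pow_pos (by linarith) 2) (sub_pos.2 ?_)
      exact one_div_lt_one_div_of_lt (by linarith) (by linarith)
    linarith
  · exact ⟨x, y, hy, h⟩

/-- The transition point for `κ = 0`. -/
noncomputable def transitionPoint (d : ℕ) (β a b : ℝ) : ℝ := sInf (condensedSet d β a b)

theorem condensedSet_bddBelow (hd : 1 ≤ d) (hβ : 0 < β) (hb : 0 < b) (hab : b < a) :
    BddBelow (condensedSet d β a b) :=
  ⟨muT d β a b, fun _ h => muT_le_of_mem_condensedSet hd hβ hb hab h⟩

theorem muT_le_transitionPoint (hd : 1 ≤ d) (hβ : 0 < β) (hb : 0 < b) (hab : b < a) :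
    muT d β a b ≤ transitionPoint d β a b :=
  le_csInf (condensedSet_nonempty hd hβ hb hab)
    fun _ h => muT_le_of_mem_condensedSet hd hβ hb hab h

theorem transitionPoint_le_muC (hd : 1 ≤ d) (hβ : 0 < β) (hb : 0 < b) (hab : b < a) :
    (transitionPoint d β a b : EReal) ≤ (muC d β a : EReal) := by
  by_contra hcon
  push Not at hcon
  obtain ⟨r, hr1, hr2⟩ := EReal.lt_iff_exists_real_btwn.1 hcon
  have h1 := csInf_le (condensedSet_bddBelow hd hβ hb hab)
    (mem_condensedSet_of_muC_lt hd hβ hb hab hr1)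
  exact absurd (EReal.coe_lt_coe_iff.1 hr2) (not_lt.2 h1)

theorem minimisers_zero_of_lt (hd : 1 ≤ d) (hβ : 0 < β) (hb : 0 < b) (hab : b < a)
    (hμ : μ < transitionPoint d β a b) : minimisers d β a b μ 0 = {(xOne d β a μ, 0)} := by
  refine minimisers_eq_singleton hd hβ hb hab fun w hw => ?_
  obtain ⟨x, y⟩ := w
  rcases (admissible_nonneg hw.1).eq_or_lt with hy | hy
  · simp only at hy
    subst hy
    rw [← eq_xOne_of_mem_minimisers hd hβ (hb.trans hab) hw]
  · exact absurd hμ (not_lt.2 (csInf_le (condensedSet_bddBelow hd hβ hb hab) ⟨x, y, hy, hw⟩))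

theorem minimisers_zero_of_gt (hd : 1 ≤ d) (hβ : 0 < β) (hb : 0 < b) (hab : b < a)
    (hμ : transitionPoint d β a b < μ) :
    minimisers d β a b μ 0 = {(xTwo d β a b μ, (μ - a * xTwo d β a b μ) / (a - b))} := by
  obtain ⟨ν, hν, hνμ⟩ := exists_lt_of_csInf_lt (condensedSet_nonempty hd hβ hb hab) hμ
  refine minimisers_eq_singleton hd hβ hb hab fun w hw => ?_
  obtain ⟨x, y⟩ := w
  rcases (admissible_nonneg hw.1).eq_or_lt with hy | hy
  · simp only at hy
    subst hy
    exact absurd hw (snd_ne_zero_of_lt hd hβ hb hab hν hνμ)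
  · obtain ⟨-, h1, h2, -⟩ := eq_xTwo_of_mem_minimisers hd hβ hb hab hw hy
      (eventually_admissible_zero hw.1.1 hy)
    rw [h2, h1]

/-- Optimality below the transition passes to the limit from the left. Freezing the dual parameter
`r` at its transition value leaves a bound that is polynomial in `μ`, so continuity of `x̃₁` is not
needed. -/
theorem xOne_mem_minimisers_transitionPoint (hd : 1 ≤ d) (hβ : 0 < β) (hb : 0 < b) (hab : b < a) :
    (xOne d β a (transitionPoint d β a b), 0) ∈
      minimisers d β a b (transitionPoint d β a b) 0 := by
  set t := transitionPoint d β a b with ht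
  obtain ⟨hx, -⟩ := xOne_spec hd hβ hb hab t
  refine ⟨mem_admissible_zero hx.le le_rfl, fun w hw => ?_⟩
  rw [energy_xOne hd hβ hb hab]
  unfold dualPressure
  set r := sBeta d β (xOne d β a t)
  have hr0 : r ≤ 0 := sBeta_nonpos hd hβ hx
  have hev : ∀ᶠ μ in 𝓝[<] t, -(realPressure d β r + (μ - r) ^ 2 / (2 * a)) ≤ energy d β a b μ w := by
    filter_upwards [self_mem_nhdsWithin] with μ hμ
    have h1 : (xOne d β a μ, 0) ∈ minimisers d β a b μ 0 := by
      rw [minimisers_zero_of_lt hd hβ hb hab hμ]; rfl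
    exact (neg_le_energy_zero hd hβ (hb.trans hab) h1.1.1 hr0).trans (h1.2 w hw)
  have c1 : ContinuousAt (fun μ : ℝ => -(realPressure d β r + (μ - r) ^ 2 / (2 * a))) t := by fun_prop
  have c2 : ContinuousAt (fun μ : ℝ => energy d β a b μ w) t := by
    unfold energy; fun_prop
  exact le_of_tendsto_of_tendsto (c1.tendsto.mono_left nhdsWithin_le_nhds)
    (c2.tendsto.mono_left nhdsWithin_le_nhds) hev

/-- The dual functionals for different `r` share the quadratic part `μ² / (2a)`. Without it they are
affine in `μ`, and the expression is a supremum of affine functions. It serves to prove continuity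
of `dualPressure`. -/
theorem convexOn_neg_dualPressure (hd : 1 ≤ d) (hβ : 0 < β) (hb : 0 < b) (hab : b < a) :
    ConvexOn ℝ Set.univ (fun μ => μ ^ 2 / (2 * a) - dualPressure d β a μ) := by
  have ha : 0 < a := hb.trans hab
  refine ⟨convex_univ, fun x _ y _ u v hu hv huv => ?_⟩
  simp only [smul_eq_mul]
  set z := u * x + v * y with hz
  set r := sBeta d β (xOne d β a z) with hr
  have hr0 : r ≤ 0 := sBeta_nonpos hd hβ (xOne_spec hd hβ hb hab z).1
  have hx := dualPressure_le (μ := x) hd hβ hb hab hr0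
  have hy := dualPressure_le (μ := y) hd hβ hb hab hr0
  have hzz : dualPressure d β a z = realPressure d β r + (z - r) ^ 2 / (2 * a) := rfl
  have e : ∀ w, w ^ 2 / (2 * a) - (realPressure d β r + (w - r) ^ 2 / (2 * a)) =
      w * (r / a) - (realPressure d β r + r ^ 2 / (2 * a)) := by
    intro w
    field_simp
    ring
  rw [hzz, e]
  have hx' : x * (r / a) - (realPressure d β r + r ^ 2 / (2 * a)) ≤
      x ^ 2 / (2 * a) - dualPressure d β a x := by rw [← e]; linarith
  have hy' : y * (r / a) - (realPressure d β r + r ^ 2 / (2 * a)) ≤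
      y ^ 2 / (2 * a) - dualPressure d β a y := by rw [← e]; linarith
  have h1 := mul_le_mul_of_nonneg_left hx' hu
  have h2 := mul_le_mul_of_nonneg_left hy' hv
  have h3 : z * (r / a) - (realPressure d β r + r ^ 2 / (2 * a)) =
      u * (x * (r / a) - (realPressure d β r + r ^ 2 / (2 * a))) +
      v * (y * (r / a) - (realPressure d β r + r ^ 2 / (2 * a))) := by
    rw [hz]
    linear_combination (realPressure d β r + r ^ 2 / (2 * a)) * huv
  linarith

theorem continuous_dualPressure (hd : 1 ≤ d) (hβ : 0 < β) (hb : 0 < b) (hab : b < a) :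
    Continuous (dualPressure d β a) := by
  have h1 := (convexOn_neg_dualPressure (d := d) hd hβ hb hab).continuousOn isOpen_univ
  rw [continuousOn_univ] at h1
  have h2 : Continuous fun μ : ℝ => μ ^ 2 / (2 * a) - (μ ^ 2 / (2 * a) - dualPressure d β a μ) := by
    fun_prop
  simpa using h2

/-! ### The phase diagram for `0 < κ < ∞`. -/

/-- Chains steps of length `ε / 2`. It is needed because the duality comparison for `advantage`
works only over distances below `aκ`. -/
theorem strictMonoOn_of_local {f : ℝ → ℝ} {B ε : ℝ} (hε : 0 < ε)
    (h : ∀ x y, x < y → y ≤ B → y < x + ε → f x < f y) : StrictMonoOn f (Set.Iic B) := by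
  have key : ∀ n : ℕ, ∀ x y, x < y → y ≤ B → y < x + (n + 1) * (ε / 2) → f x < f y := by
    intro n
    induction n with
    | zero =>
      intro x y hxy hy hlt
      refine h x y hxy hy ?_
      simp at hlt
      linarith
    | succ n ih =>
      intro x y hxy hy hlt
      rcases lt_or_ge y (x + ε) with h1 | h1
      · exact h x y hxy hy h1
      · push_cast at hlt
        exact (ih x (y - ε / 2) (by linarith) (by linarith) (by linarith)).trans
          (h _ _ (by linarith) hy (by linarith))
  intro x _ y hy hxy
  obtain ⟨n, hn⟩ := exists_nat_gt ((y - x) / (ε / 2))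
  rw [div_lt_iff₀ (by linarith)] at hn
  exact key n x y hxy hy (by nlinarith)

/-- The advantage of putting density `κ` into long cycles over having no long cycles. -/
noncomputable def advantage (d : ℕ) (β a b κ μ : ℝ) : ℝ :=
  dualPressure d β a (μ - a * κ) + μ * κ - (a - b) / 2 * κ ^ 2 - dualPressure d β a μ

/-- The cross term `a κ x` acts on the short cycles as a lowering of the chemical potential by `aκ`.
-/
theorem energy_shift (κ x : ℝ) : energy d β a b μ (x, κ) =
    energy d β a b (μ - a * κ) (x, 0) - μ * κ + (a - b) / 2 * κ ^ 2 := by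
  unfold energy
  ring

theorem energy_xThree (hd : 1 ≤ d) (hβ : 0 < β) (hb : 0 < b) (hab : b < a) (κ μ : ℝ) :
    energy d β a b μ (xThree d β a κ μ, κ) = -dualPressure d β a μ - advantage d β a b κ μ := by
  rw [energy_shift, xThree, energy_xOne hd hβ hb hab, advantage]
  ring

theorem energy_xThree_le (hd : 1 ≤ d) (hβ : 0 < β) (hb : 0 < b) (hab : b < a) (κ : ℝ) {x : ℝ}
    (hx : 0 ≤ x) :
    energy d β a b μ (xThree d β a κ μ, κ) ≤ energy d β a b μ (x, κ) := by
  rw [energy_shift κ x, energy_shift κ, xThree, energy_xOne hd hβ hb hab]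
  have := neg_dualPressure_le (μ := μ - a * κ) hd hβ hb hab hx
  linarith

theorem xOne_strictMono (hd : 1 ≤ d) (hβ : 0 < β) (hb : 0 < b) (hab : b < a) {μ ν : ℝ}
    (h : μ < ν) : xOne d β a μ < xOne d β a ν := by
  obtain ⟨h1, h2⟩ := xOne_spec hd hβ hb hab μ
  obtain ⟨h3, h4⟩ := xOne_spec hd hβ hb hab ν
  by_contra hcon
  push Not at hcon
  rcases hcon.lt_or_eq with h5 | h5
  · have := sBeta_add_strictMono hd hβ (hb.trans hab) h3 h5
    linarith
  · rw [h5] at h4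
    linarith

/-- Formally the derivative is `x̃₃ + κ - x̃₁ = (s_β(x̃₁) - s_β(x̃₃)) / a`. The proof uses
increments, with `r` optimal at the left end `μ` and `t` at the right end `ν`; the restriction `ν <
μ + aκ` ensures `t < r`. -/
theorem advantage_strictMonoOn (hd : 1 ≤ d) (hβ : 0 < β) (hb : 0 < b) (hab : b < a) {κ B : ℝ}
    (hκ : 0 < κ) (hB : sBeta d β (xThree d β a κ B) < 0) :
    StrictMonoOn (advantage d β a b κ) (Set.Iic B) := by
  have ha : 0 < a := hb.trans hab
  refine strictMonoOn_of_local (mul_pos ha hκ) fun μ ν hμν hνB hlt => ?_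
  set r := sBeta d β (xOne d β a μ) with hr
  set t := sBeta d β (xOne d β a (ν - a * κ)) with ht
  obtain ⟨hx, -⟩ := xOne_spec hd hβ hb hab μ
  obtain ⟨hx', -⟩ := xOne_spec hd hβ hb hab (ν - a * κ)
  have hr0 : r ≤ 0 := sBeta_nonpos hd hβ hx
  have ht0 : t < 0 := by
    refine lt_of_le_of_lt ?_ hB
    refine sBeta_mono hd hβ hx' ?_
    rcases hνB.lt_or_eq with h | h
    · exact (xOne_strictMono hd hβ hb hab (by linarith)).le
    · rw [h]; rfl
  have htr : t < r :=
    sBeta_strictMono hd hβ hx' (xOne_strictMono hd hβ hb hab (by linarith)) ht0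
  have h1 := dualPressure_le (μ := ν) hd hβ hb hab hr0
  have h2 := dualPressure_le (μ := μ - a * κ) hd hβ hb hab ht0.le
  have e1 : dualPressure d β a μ = realPressure d β r + (μ - r) ^ 2 / (2 * a) := rfl
  have e2 : dualPressure d β a (ν - a * κ) =
      realPressure d β t + (ν - a * κ - t) ^ 2 / (2 * a) := rfl
  have e3 : ((ν - a * κ - t) ^ 2 / (2 * a) - (μ - a * κ - t) ^ 2 / (2 * a)) + (ν - μ) * κ
      - ((ν - r) ^ 2 / (2 * a) - (μ - r) ^ 2 / (2 * a)) = (ν - μ) / a * (r - t) := by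
    field_simp
    ring
  have e4 : 0 < (ν - μ) / a * (r - t) := mul_pos (div_pos (by linarith) ha) (by linarith)
  unfold advantage
  linarith

/-- On the critical curve `s_β(x) = -b y`, so a long density `y ≥ κ` means `x ≤ X := p₀'(-bκ)`.
Hence `μ_r` is the minimum of the critical potential over `(0, X]`. -/
theorem muR_spec (hd : 1 ≤ d) (hβ : 0 < β) (hb : 0 < b) (hab : b < a) {κ : ℝ} (hκ : 0 < κ) :
    muT d β a b ≤ muR d β a b κ ∧
    (∀ x, 0 < x → sBeta d β x ≤ -b * κ → muR d β a b κ ≤ criticalPotential d β a b x) ∧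
    (∀ s, muT d β a b ≤ s → (κ ≤ (s - a * xTwo d β a b s) / (a - b) ↔ muR d β a b κ ≤ s)) ∧
    (muT d β a b < muR d β a b κ →
      (muR d β a b κ - a * xTwo d β a b (muR d β a b κ)) / (a - b) = κ) := by
  have ha : 0 < a := hb.trans hab
  have hab' : 0 < a - b := sub_pos.2 hab
  have hbκ : -b * κ < 0 := by nlinarith
  set X := realDensity d β (-b * κ) with hX
  have hX0 : 0 < X := realDensity_pos hd hβ hbκ
  have hSX : sBeta d β X = -b * κ := sBeta_realDensity hd hβ hbκ
  have hiff : ∀ x, 0 < x → (sBeta d β x ≤ -b * κ ↔ x ≤ X) := by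
    intro x hx
    constructor
    · intro h
      by_contra hcon
      push Not at hcon
      have := sBeta_strictMono hd hβ hX0 hcon (by rw [hSX]; exact hbκ)
      linarith
    · intro h
      rw [← hSX]
      exact sBeta_mono hd hβ hx h
  obtain ⟨xm, hxm, hxmX, hmin⟩ := exists_isMinOn_criticalPotential (d := d) (a := a) hd hβ hb hab hX0
  set m := criticalPotential d β a b xm with hm
  have hTm : muT d β a b ≤ m := muT_le_criticalPotential hd hβ hb hab hxm
  have hcond : ∀ s, muT d β a b ≤ s →
      (κ ≤ (s - a * xTwo d β a b s) / (a - b) ↔ m ≤ s) := by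
    intro s hs
    obtain ⟨h1, h2, h3⟩ := xTwo_spec hd hβ hb hab hs
    have h4 : sBeta d β (xTwo d β a b s) = -b * ((s - a * xTwo d β a b s) / (a - b)) := by
      rw [(criticalPotential_eq_iff hb hab).1 h2]
      ring
    have h5 : κ ≤ (s - a * xTwo d β a b s) / (a - b) ↔ xTwo d β a b s ≤ X := by
      rw [← hiff _ h1, h4]
      constructor
      · intro h; nlinarith
      · intro h; nlinarith
    rw [h5]
    constructor
    · intro h
      rw [← h2]
      exact hmin _ h1 h
    · intro h
      exact (h3 xm hxm h).trans hxmX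
  have hR : muR d β a b κ = m := by
    have hset : {s : ℝ | muT d β a b ≤ s ∧ xTwo d β a b s ≤ 1 / a * (s - κ * (a - b))} =
        Set.Ici m := by
      ext s
      simp only [Set.mem_ofPred_eq, Set.mem_Ici]
      have h6 : xTwo d β a b s ≤ 1 / a * (s - κ * (a - b)) ↔
          κ ≤ (s - a * xTwo d β a b s) / (a - b) := by
        rw [le_div_iff₀ hab', one_div, inv_mul_eq_div, le_div_iff₀ ha]
        constructor <;> intro h <;> linarith
      rw [h6]
      constructor
      · rintro ⟨h1, h2⟩
        exact (hcond s h1).1 h2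
      · intro h
        exact ⟨hTm.trans h, (hcond s (hTm.trans h)).2 h⟩
    unfold muR
    rw [hset, csInf_Ici]
  rw [hR]
  refine ⟨hTm, fun x hx hxs => hmin x hx ((hiff x hx).1 hxs), hcond, fun hlt => ?_⟩
  -- If `μ_t < μ_r`, the potential takes a value below its minimum over `(0, X]` at some `v > X` of
  -- subcritical density. Quasi-convexity then leaves only the endpoint `X` as minimiser on `(0,
  -- X]`, and there the long density is exactly `κ`.
  obtain ⟨_, ⟨s, hs, rfl⟩, hsm⟩ := exists_lt_of_csInf_lt (Set.nonempty_Iio.image _) hlt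
  have hs : s < 0 := hs
  simp only at hsm
  rw [← criticalPotential_realDensity hd hβ hs] at hsm
  set v := realDensity d β s with hv
  have hv0 : 0 < v := realDensity_pos hd hβ hs
  have hXv : X < v := by
    by_contra hcon
    push Not at hcon
    exact absurd hsm (not_lt.2 (hmin v hv0 hcon))
  have hSv : sBeta d β v < 0 := by rw [hv, sBeta_realDensity hd hβ hs]; exact hs
  have huniq : ∀ x, 0 < x → x ≤ X → criticalPotential d β a b x = m → x = X := by
    intro x hx hxX hxm
    by_contra hne
    have := criticalPotential_lt hd hβ hb hab hx (lt_of_le_of_ne hxX hne) hXv hSv hxm.le hsm.le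
    exact absurd this (not_lt.2 (hmin X hX0 le_rfl))
  obtain ⟨h1, h2, h3⟩ := xTwo_spec hd hβ hb hab hTm
  have h4 := huniq _ h1 ((h3 xm hxm le_rfl).trans hxmX) h2
  have h5 := (criticalPotential_eq_iff hb hab).1 h2
  rw [h4] at h5 ⊢
  rw [hSX] at h5
  have h6 : -b * κ = -b * ((m - a * X) / (a - b)) := by rw [h5]; ring
  exact (mul_left_cancel₀ (neg_ne_zero.2 hb.ne') h6).symm

theorem mem_admissible_ofReal {κ : ℝ} {z : ℝ × ℝ} (hκ : 0 < κ) (h1 : 0 ≤ z.1) (h2 : κ ≤ z.2) :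
    z ∈ admissible (ENNReal.ofReal κ) :=
  ⟨h1, Or.inr ⟨hκ.le.trans h2, ENNReal.ofReal_le_ofReal h2⟩⟩

theorem admissible_ofReal_cases {κ : ℝ} {z : ℝ × ℝ}
    (h : z ∈ admissible (ENNReal.ofReal κ)) : z.2 = 0 ∨ z.2 = κ ∨ κ < z.2 := by
  rcases h.2 with h1 | h1
  · exact Or.inl h1
  · right
    rcases ((ENNReal.ofReal_le_ofReal_iff h1.1).1 h1.2).lt_or_eq with h2 | h2
    · exact Or.inr h2
    · exact Or.inl h2.symm

theorem admissible_subset_zero : admissible κ ⊆ admissible 0 := fun _ hz =>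
  mem_admissible_zero hz.1 (admissible_nonneg hz)

/-- If the unconstrained minimiser is admissible, it is the only constrained one. -/
theorem minimisers_eq_of_mem {z : ℝ × ℝ} (h0 : minimisers d β a b μ 0 = {z})
    (hz : z ∈ admissible κ) : minimisers d β a b μ κ = {z} := by
  have hz0 : z ∈ minimisers d β a b μ 0 := by rw [h0]; rfl
  ext w
  constructor
  · intro hw
    rw [← h0]
    refine ⟨admissible_subset_zero hw.1, fun v hv => (hw.2 z hz).trans (hz0.2 v hv)⟩
  · rintro rfl
    exact ⟨hz, fun v hv => hz0.2 v (admissible_subset_zero hv)⟩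

/-- A minimiser with `y > κ` is the `x̃₂` state, so `μ ≥ μ_r`. Equality would give `y = κ`, except
when `μ_r = μ_t`, where the endpoint description of `μ_r` is not available. -/
theorem interior_case (hd : 1 ≤ d) (hβ : 0 < β) (hb : 0 < b) (hab : b < a) {κ x y : ℝ}
    (hκ : 0 < κ) (h : (x, y) ∈ minimisers d β a b μ (ENNReal.ofReal κ)) (hy : κ < y) :
    muR d β a b κ < μ ∨ muR d β a b κ = muT d β a b := by
  have hint : ∀ᶠ v in 𝓝 y, (x, v) ∈ admissible (ENNReal.ofReal κ) := by
    filter_upwards [Ioi_mem_nhds hy] with v hv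
    exact mem_admissible_ofReal hκ h.1.1 (le_of_lt hv)
  obtain ⟨h1, h2, h3, h4⟩ := eq_xTwo_of_mem_minimisers hd hβ hb hab h (hκ.trans hy) hint
  obtain ⟨r1, r2, r3, r4⟩ := muR_spec hd hβ hb hab hκ
  have h5 : muR d β a b κ ≤ μ := by
    rw [← r3 μ h1, ← h2, ← h3]
    exact hy.le
  rcases h5.lt_or_eq with h6 | h6
  · exact Or.inl h6
  · rcases r1.lt_or_eq with h7 | h7
    · exfalso
      have := r4 h7
      rw [h6, ← h2, ← h3] at this
      exact hy.ne' this
    · exact Or.inr h7.symm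

theorem exists_transition_ofReal (hd : 1 ≤ d) (hβ : 0 < β) (hb : 0 < b) (hab : b < a) {κ : ℝ}
    (hκ : 0 < κ) : ∃ t : ℝ,
      (muR d β a b κ ≤ transitionPoint d β a b → t = transitionPoint d β a b) ∧
      (transitionPoint d β a b < muR d β a b κ →
        transitionPoint d β a b < t ∧ t < muR d β a b κ) ∧
      (∀ μ, μ < t → minimisers d β a b μ (ENNReal.ofReal κ) = {(xOne d β a μ, 0)}) ∧
      (∀ μ, t < μ → μ ≤ muR d β a b κ →
        minimisers d β a b μ (ENNReal.ofReal κ) = {(xThree d β a κ μ, κ)}) ∧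
      (∀ μ, t < μ → muR d β a b κ ≤ μ → minimisers d β a b μ (ENNReal.ofReal κ) =
        {(xTwo d β a b μ, (μ - a * xTwo d β a b μ) / (a - b))}) := by
  have ha : 0 < a := hb.trans hab
  obtain ⟨r1, r2, r3, r4⟩ := muR_spec hd hβ hb hab hκ
  set T := transitionPoint d β a b with hT
  have hTT : muT d β a b ≤ T := muT_le_transitionPoint hd hβ hb hab
  have hupper : ∀ μ, T < μ → muR d β a b κ ≤ μ → minimisers d β a b μ (ENNReal.ofReal κ) =
        {(xTwo d β a b μ, (μ - a * xTwo d β a b μ) / (a - b))} := by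
    intro μ h1 h2
    refine minimisers_eq_of_mem (minimisers_zero_of_gt hd hβ hb hab h1) ?_
    have hs := r1.trans h2
    exact mem_admissible_ofReal hκ (xTwo_spec hd hβ hb hab hs).1.le ((r3 μ hs).2 h2)
  rcases le_or_gt (muR d β a b κ) T with hcase | hcase
  · refine ⟨T, fun _ => rfl, fun h => absurd hcase (not_le.2 h), fun μ hμ => ?_, fun μ h1 h2 => ?_,
      hupper⟩
    · exact minimisers_eq_of_mem (minimisers_zero_of_lt hd hβ hb hab hμ)
        ⟨(xOne_spec hd hβ hb hab μ).1.le, Or.inl rfl⟩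
    · exact absurd (h1.trans_le h2) (not_lt.2 hcase)
  · set R := muR d β a b κ with hR
    have hTR : muT d β a b < R := hTT.trans_lt hcase
    have hmin0 := minimisers_zero_of_gt hd hβ hb hab hcase
    rw [r4 hTR] at hmin0
    have hmemR : (xTwo d β a b R, κ) ∈ minimisers d β a b R 0 := by rw [hmin0]; rfl
    obtain ⟨hx2, hs2⟩ := first_order_fst hd hβ hmemR
    have hx3 : xThree d β a κ R = xTwo d β a b R := xOne_eq hd hβ ha hx2 (by rw [hs2]; ring)
    have hsneg : sBeta d β (xThree d β a κ R) < 0 := by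
      rw [hx3]
      obtain ⟨-, -, -, h⟩ := eq_xTwo_of_mem_minimisers hd hβ hb hab hmemR hκ
        (eventually_admissible_zero hx2.le hκ)
      rw [h]
      nlinarith
    have hmono := advantage_strictMonoOn hd hβ hb hab hκ hsneg
    have hcont : Continuous (advantage d β a b κ) := by
      have := continuous_dualPressure (d := d) hd hβ hb hab
      unfold advantage
      fun_prop
    -- At `μ_r` the unique unconstrained minimiser has `y = κ`. It is therefore the `x̃₃` state and
    -- strictly beats `y = 0`.
    have hposR : 0 < advantage d β a b κ R := by
      by_contra hcon
      push Not at hcon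
      have h1 : (xOne d β a R, 0) ∈ minimisers d β a b R 0 := by
        refine ⟨mem_admissible_zero (xOne_spec hd hβ hb hab R).1.le le_rfl, fun w hw => ?_⟩
        refine le_trans ?_ (hmemR.2 w hw)
        rw [← hx3, energy_xThree hd hβ hb hab, energy_xOne hd hβ hb hab]
        linarith
      rw [hmin0] at h1
      have := congrArg Prod.snd h1
      exact hκ.ne this
    -- At `μ*` the state `x̃₁` is optimal. Were `y = κ` as good, it would be an unconstrained
    -- minimiser with `y > 0`, hence the `x̃₂` state with density `κ`, forcing `μ_r ≤ μ*`.
    have hnegT : advantage d β a b κ T < 0 := by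
      by_contra hcon
      push Not at hcon
      have h0 := xOne_mem_minimisers_transitionPoint (d := d) hd hβ hb hab
      rw [← hT] at h0
      have hx0 : 0 < xThree d β a κ T := (xOne_spec hd hβ hb hab _).1
      have h1 : (xThree d β a κ T, κ) ∈ minimisers d β a b T 0 := by
        refine ⟨mem_admissible_zero hx0.le hκ.le, fun w hw => ?_⟩
        refine le_trans ?_ (h0.2 w hw)
        rw [energy_xThree hd hβ hb hab, energy_xOne hd hβ hb hab]
        linarith
      obtain ⟨-, h2, h3, -⟩ := eq_xTwo_of_mem_minimisers hd hβ hb hab h1 hκ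
        (eventually_admissible_zero hx0.le hκ)
      rw [h2] at h3
      exact absurd ((r3 T hTT).1 h3.le) (not_le.2 hcase)
    obtain ⟨t, ht, ht0⟩ := intermediate_value_Ioo hcase.le hcont.continuousOn
      (show (0 : ℝ) ∈ Set.Ioo _ _ from ⟨hnegT, hposR⟩)
    have hxOne : ∀ μ, (xOne d β a μ, (0 : ℝ)) ∈ admissible (ENNReal.ofReal κ) := fun μ =>
      ⟨(xOne_spec hd hβ hb hab μ).1.le, Or.inl rfl⟩
    have hxThree : ∀ μ, (xThree d β a κ μ, κ) ∈ admissible (ENNReal.ofReal κ) := fun μ =>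
      mem_admissible_ofReal hκ (xOne_spec hd hβ hb hab _).1.le le_rfl
    refine ⟨t, fun h => absurd h (not_le.2 hcase), fun _ => ht, fun μ hμ => ?_, fun μ h1 h2 => ?_,
      fun μ h1 h2 => hupper μ (ht.1.trans h1) h2⟩
    · refine minimisers_eq_singleton hd hβ hb hab fun w hw => ?_
      obtain ⟨x, y⟩ := w
      have hadv : advantage d β a b κ μ < 0 := by
        rw [← ht0]
        exact hmono (hμ.trans ht.2).le ht.2.le hμ
      rcases admissible_ofReal_cases hw.1 with hy | hy | hy
      · simp only at hy
        subst hy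
        rw [← eq_xOne_of_mem_minimisers hd hβ ha hw]
      · simp only at hy
        subst hy
        exfalso
        have h1 := hw.2 _ (hxOne μ)
        have h2 := (energy_xThree_le (μ := μ) hd hβ hb hab y hw.1.1).trans h1
        rw [energy_xThree hd hβ hb hab, energy_xOne hd hβ hb hab] at h2
        linarith
      · rcases interior_case hd hβ hb hab hκ hw hy with h | h
        · exact absurd h (not_lt.2 (hμ.trans ht.2).le)
        · exact absurd h hTR.ne'
    · refine minimisers_eq_singleton hd hβ hb hab fun w hw => ?_
      obtain ⟨x, y⟩ := w
      have hadv : 0 < advantage d β a b κ μ := by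
        rw [← ht0]
        exact hmono ht.2.le h2 h1
      rcases admissible_ofReal_cases hw.1 with hy | hy | hy
      · simp only at hy
        subst hy
        exfalso
        have h3 := hw.2 _ (hxThree μ)
        have h4 := (neg_dualPressure_le (μ := μ) hd hβ hb hab hw.1.1).trans h3
        rw [energy_xThree hd hβ hb hab] at h4
        linarith
      · simp only at hy
        subst hy
        obtain ⟨hx, hs⟩ := first_order_fst hd hβ hw
        have : xThree d β a y μ = x := xOne_eq hd hβ ha hx (by rw [hs]; ring)
        rw [this]
      · rcases interior_case hd hβ hb hab hκ hw hy with h | h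
        · exact absurd h (not_lt.2 h2)
        · exact absurd h hTR.ne'

end

/-! ### Upper bounds for Gibbs weights. -/

section

variable {d : ℕ} {β a b α μ V : ℝ} {m : ℕ}

/-- The unnormalised product Poisson weight with parameters `c`. -/
noncomputable def poissonWeight (c : ℕ+ → ℝ) (n : CycleCounts) : ℝ :=
  n.prod fun k j => c k ^ j / (Nat.factorial j : ℝ)

theorem poissonWeight_nonneg {c : ℕ+ → ℝ} (hc : ∀ k, 0 ≤ c k) (n : CycleCounts) :
    0 ≤ poissonWeight c n := by
  unfold poissonWeight Finsupp.prod
  exact Finset.prod_nonneg fun k _ => by have := hc k; positivity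

theorem poissonWeight_mul_exp (c e : ℕ+ → ℝ) (n : CycleCounts) :
    poissonWeight (fun k => c k * Real.exp (e k)) n =
      poissonWeight c n * Real.exp (n.sum fun k j => e k * j) := by
  unfold poissonWeight Finsupp.prod Finsupp.sum
  rw [Real.exp_sum, ← Finset.prod_mul_distrib]
  refine Finset.prod_congr rfl fun k _ => ?_
  beta_reduce
  rw [mul_pow, ← Real.exp_nat_mul, mul_comm (e k)]
  ring

/-- Any finite family of configurations lies in a box of bounded lengths and multiplicities. Over
the box the sum factorises into truncated exponential series. -/
theorem tsum_poissonWeight_le {c : ℕ+ → ℝ} (hc : ∀ k, 0 ≤ c k) (hs : Summable c) :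
    ∑' n, ENNReal.ofReal (poissonWeight c n) ≤ ENNReal.ofReal (Real.exp (∑' k, c k)) := by
  classical
  rw [ENNReal.tsum_eq_iSup_sum]
  refine iSup_le fun F => ?_
  rw [← ENNReal.ofReal_sum_of_nonneg fun n _ => poissonWeight_nonneg hc n]
  refine ENNReal.ofReal_le_ofReal ?_
  set S : Finset ℕ+ := F.sup Finsupp.support with hS
  set J : ℕ := F.sup fun n => S.sup n with hJ
  have hsub : F ⊆ S.finsupp fun _ => Finset.range (J + 1) := by
    intro n hn
    rw [Finset.mem_finsupp_iff]
    refine ⟨Finset.le_sup (f := Finsupp.support) hn, fun k hk => ?_⟩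
    rw [Finset.mem_range, Nat.lt_succ_iff]
    exact (Finset.le_sup (f := n) hk).trans (Finset.le_sup (f := fun n : CycleCounts => S.sup n) hn)
  calc ∑ n ∈ F, poissonWeight c n
      ≤ ∑ n ∈ S.finsupp fun _ => Finset.range (J + 1), poissonWeight c n :=
        Finset.sum_le_sum_of_subset_of_nonneg hsub fun n _ _ => poissonWeight_nonneg hc n
    _ = ∏ k ∈ S, ∑ j ∈ Finset.range (J + 1), c k ^ j / (Nat.factorial j : ℝ) := by
        rw [Finset.prod_sum, Finset.finsupp, Finset.sum_map]
        refine Finset.sum_congr (by congr!) fun p hp => ?_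
        rw [Function.Embedding.coeFn_mk, poissonWeight, Finsupp.prod_of_support_subset _
          (Finsupp.support_indicator_subset _ _) _ (by simp), ← Finset.prod_attach]
        refine Finset.prod_congr rfl fun k _ => ?_
        rw [Finsupp.indicator_of_mem k.2]
    _ ≤ ∏ k ∈ S, Real.exp (c k) := by
        refine Finset.prod_le_prod (fun k _ => Finset.sum_nonneg fun j _ => ?_) fun k _ => ?_
        · have := hc k
          positivity
        · exact Real.sum_le_exp_of_nonneg (hc k) _
    _ = Real.exp (∑ k ∈ S, c k) := (Real.exp_sum _ _).symm
    _ ≤ Real.exp (∑' k, c k) := Real.exp_le_exp.2 (hs.sum_le_tsum S fun k _ => hc k)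

/-- The number of particles in cycles shorter than `m`. -/
def shortCount (m : ℕ) (n : CycleCounts) : ℕ :=
  ∑ k ∈ n.support with PNat.val k < m, (k : ℕ) * n k

theorem shortDensity_eq : ∀ n, shortDensity V m n = (shortCount m n : ℝ) / V := by
  intro n
  unfold shortDensity shortCount cycleDensity
  push_cast
  rw [Finset.sum_div]
  exact Finset.sum_congr rfl fun k _ => by ring

theorem shortDensity_nonneg (hV : 0 < V) (n : CycleCounts) : 0 ≤ shortDensity V m n := by
  rw [shortDensity_eq]; positivity

theorem longDensity_nonneg (hV : 0 < V) (n : CycleCounts) : 0 ≤ longDensity V m n := by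
  unfold longDensity cycleDensity
  exact Finset.sum_nonneg fun k _ => by positivity

/-- A single long cycle already contributes at least `m / V`. This is the origin of the gap between
`0` and `κ` in the admissible set. -/
theorem longDensity_cases (hV : 0 < V) (n : CycleCounts) :
    longDensity V m n = 0 ∨ (m : ℝ) / V ≤ longDensity V m n := by
  unfold longDensity
  rcases (n.support.filter fun k => m ≤ PNat.val k).eq_empty_or_nonempty with h | ⟨k, hk⟩
  · left; rw [h, Finset.sum_empty]
  · right
    have hnn : ∀ i ∈ n.support.filter fun k => m ≤ PNat.val k,
        0 ≤ ((i : ℕ) : ℝ) * cycleDensity V n i := fun i _ => by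
      unfold cycleDensity; positivity
    refine le_trans ?_ (Finset.single_le_sum hnn hk)
    rw [Finset.mem_filter, Finsupp.mem_support_iff] at hk
    unfold cycleDensity
    rw [← mul_div_assoc]
    have h1 : (m : ℝ) ≤ (k : ℕ) := by exact_mod_cast hk.2
    have h2 : (1 : ℝ) ≤ n k := by exact_mod_cast Nat.one_le_iff_ne_zero.2 hk.1
    gcongr
    nlinarith

theorem shortDensity_add_longDensity (n : CycleCounts) :
    ∑ k ∈ n.support, ((k : ℕ) : ℝ) * cycleDensity V n k =
      shortDensity V m n + longDensity V m n := by
  unfold shortDensity longDensity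
  rw [← Finset.sum_filter_add_sum_filter_not n.support fun k => PNat.val k < m]
  simp only [not_lt]

/-- The sum of squares in the counter term. -/
noncomputable def longSquare (V : ℝ) (m : ℕ) (n : CycleCounts) : ℝ :=
  ∑ k ∈ n.support with m ≤ PNat.val k, ((k : ℕ) : ℝ) ^ 2 * cycleDensity V n k ^ 2

theorem longSquare_le (hV : 0 < V) (n : CycleCounts) :
    longSquare V m n ≤ longDensity V m n ^ 2 := by
  unfold longSquare longDensity
  simp_rw [← mul_pow]
  exact Finset.sum_sq_le_sq_sum_of_nonneg fun k _ => by unfold cycleDensity; positivity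

/-- The weight of a configuration under the unnormalised Gibbs measure. -/
noncomputable def gibbsWeight (d : ℕ) (β a b α μ V : ℝ) (m : ℕ) (n : CycleCounts) : ℝ :=
  referenceWeight d β α V n * Real.exp (-β * hamiltonian a b α μ V m n)

/-- The reference factor `e^{βαk}` cancels the `α` in the Hamiltonian, so `α` survives only in a
factor common to all configurations. -/
theorem gibbsWeight_eq (hV : 0 < V) (n : CycleCounts) :
    gibbsWeight d β a b α μ V m n = Real.exp (-(V * totalWeight d β α)) *
      (poissonWeight (fun k => V * cycleWeight d β k) n *
        Real.exp (β * V * (μ * (shortDensity V m n + longDensity V m n)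
          - a / 2 * (shortDensity V m n + longDensity V m n) ^ 2 + b / 2 * longSquare V m n))) := by
  have h1 : referenceWeight d β α V n = Real.exp (-(V * totalWeight d β α)) *
      poissonWeight (fun k => V * cycleWeight d β k * Real.exp (β * α * (k : ℕ))) n := rfl
  have h2 : (n.sum fun k j => β * α * ((k : ℕ) : ℝ) * j) =
      β * α * V * (shortDensity V m n + longDensity V m n) := by
    rw [← shortDensity_add_longDensity, Finsupp.sum, Finset.mul_sum]
    refine Finset.sum_congr rfl fun k _ => ?_
    unfold cycleDensity
    field_simp
  unfold gibbsWeight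
  rw [h1, poissonWeight_mul_exp, h2, mul_assoc, mul_assoc, ← Real.exp_add]
  congr 3
  unfold hamiltonian
  rw [shortDensity_add_longDensity (m := m)]
  change _ + -β * (V * (_ - b / 2 * longSquare V m n)) = _
  ring

theorem gibbsWeight_le (hβ : 0 < β) (hb : 0 < b) (hV : 0 < V) (n : CycleCounts) :
    gibbsWeight d β a b α μ V m n ≤ Real.exp (-(V * totalWeight d β α)) *
      (poissonWeight (fun k => V * cycleWeight d β k) n *
        Real.exp (β * V * (realFreeEnergy d β (shortDensity V m n)
          - energy d β a b μ (shortDensity V m n, longDensity V m n)))) := by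
  rw [gibbsWeight_eq hV]
  have h1 := poissonWeight_nonneg (c := fun k => V * cycleWeight d β k)
    (fun k => (mul_pos hV (cycleWeight_pos hβ k)).le) n
  have h2 := mul_le_mul_of_nonneg_left (longSquare_le (m := m) hV n) (by linarith : 0 ≤ b / 2)
  refine mul_le_mul_of_nonneg_left (mul_le_mul_of_nonneg_left (Real.exp_le_exp.2 ?_) h1)
    (Real.exp_nonneg _)
  refine mul_le_mul_of_nonneg_left ?_ (by positivity)
  unfold energy
  simp only
  linarith

/-- The weight of the long cycles. -/
noncomputable def tailWeight (d : ℕ) (β : ℝ) (m : ℕ) : ℝ :=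
  ∑' k : ℕ+, if m ≤ PNat.val k then cycleWeight d β k else 0

theorem tendsto_tailWeight (hd : 1 ≤ d) (hβ : 0 < β) :
    Tendsto (tailWeight d β) atTop (𝓝 0) := by
  have h := tendsto_tsum_of_dominated_convergence (𝓕 := atTop)
    (f := fun (m : ℕ) (k : ℕ+) => if m ≤ PNat.val k then cycleWeight d β k else 0)
    (g := fun _ => (0 : ℝ)) (summable_cycleWeight (d := d) (β := β) hd) (fun k => ?_) ?_
  · rw [tsum_zero] at h
    exact h
  · refine tendsto_const_nhds.congr' ?_
    filter_upwards [eventually_gt_atTop (PNat.val k)] with m hm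
    rw [if_neg (not_le.2 hm)]
  · refine Eventually.of_forall fun m k => ?_
    have := cycleWeight_pos (d := d) hβ k
    split_ifs
    · rw [Real.norm_of_nonneg this.le]
    · rw [norm_zero]; exact this.le

/-- Exponential Chebyshev bound for configurations with given short cycle particle number. -/
theorem tsum_poissonWeight_fiber_le (hd : 1 ≤ d) (hβ : 0 < β) (hV : 0 < V) (i : ℕ) :
    ∑' n : CycleCounts, (if shortCount m n = i then
      ENNReal.ofReal (poissonWeight (fun k => V * cycleWeight d β k) n *
        Real.exp (β * V * realFreeEnergy d β (i / V))) else 0) ≤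
      ENNReal.ofReal (Real.exp (V * tailWeight d β m + 1)) := by
  have hε : (0 : ℝ) < 1 / (β * V) := by positivity
  -- The optimal `s` need not exist when `i = 0`. A loss of `1 / (βV)` in the free energy costs only
  -- the `+ 1` in the exponent.
  obtain ⟨s, hs, hlt⟩ := exists_lt_of_lt_realFreeEnergy hd hβ (x := i / V) (by positivity)
    (sub_lt_self (realFreeEnergy d β (i / V)) hε)
  have hle : β * V * realFreeEnergy d β (i / V) ≤ β * s * i - β * V * realPressure d β s + 1 := by
    have h1 := mul_le_mul_of_nonneg_left hlt.le (mul_pos hβ hV).le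
    have h2 : β * V * (realFreeEnergy d β (i / V) - 1 / (β * V)) =
        β * V * realFreeEnergy d β (i / V) - 1 := by field_simp
    have h3 : β * V * (s * (i / V) - realPressure d β s) =
        β * s * i - β * V * realPressure d β s := by field_simp
    linarith
  -- Only short cycles are tilted. The total exponent is then `βV p₀(s)` plus the untilted weight of
  -- the long cycles, which is `V` times `tailWeight`.
  set e : ℕ+ → ℝ := fun k => if PNat.val k < m then β * s * (k : ℕ) else 0 with he
  have hsum : ∀ n : CycleCounts, (n.sum fun k j => e k * j) = β * s * shortCount m n := by
    intro n
    unfold shortCount Finsupp.sum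
    push_cast
    rw [Finset.mul_sum, Finset.sum_filter]
    refine Finset.sum_congr rfl fun k _ => ?_
    simp only [he]
    split_ifs <;> ring
  set c : ℕ+ → ℝ := fun k => V * cycleWeight d β k * Real.exp (e k) with hc
  have hc0 : ∀ k, 0 ≤ c k := fun k => by
    have := cycleWeight_pos (d := d) hβ k
    simp only [hc]
    positivity
  have htail : Summable fun k : ℕ+ => if m ≤ PNat.val k then cycleWeight d β k else 0 := by
    refine Summable.of_nonneg_of_le (fun k => ?_) (fun k => ?_)
      (summable_cycleWeight (d := d) (β := β) hd)
    · have := cycleWeight_pos (d := d) hβ k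
      split_ifs <;> positivity
    · have := cycleWeight_pos (d := d) hβ k
      split_ifs <;> linarith
  have hdom := ((summable_pressure hd hβ hs).mul_left V).add (htail.mul_left V)
  have hcle : ∀ k, c k ≤ V * (cycleWeight d β k * Real.exp (β * s * (k : ℕ))) +
      V * (if m ≤ PNat.val k then cycleWeight d β k else 0) := by
    intro k
    have := cycleWeight_pos (d := d) hβ k
    simp only [hc, he]
    by_cases h : PNat.val k < m
    · rw [if_pos h, if_neg (not_le.2 h)]
      exact le_of_eq (by ring)
    · rw [if_neg h, if_pos (not_lt.1 h), Real.exp_zero, mul_one]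
      have : 0 ≤ V * (cycleWeight d β k * Real.exp (β * s * (k : ℕ))) := by positivity
      linarith
  have hcs : Summable c := Summable.of_nonneg_of_le hc0 hcle hdom
  have hctot : ∑' k, c k ≤ β * V * realPressure d β s + V * tailWeight d β m := by
    refine (hcs.tsum_le_tsum hcle hdom).trans ?_
    rw [((summable_pressure hd hβ hs).mul_left V).tsum_add (htail.mul_left V), tsum_mul_left,
      tsum_mul_left]
    unfold realPressure tailWeight
    refine le_of_eq ?_
    field_simp
  have hterm : ∀ n : CycleCounts, (if shortCount m n = i then
      ENNReal.ofReal (poissonWeight (fun k => V * cycleWeight d β k) n *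
        Real.exp (β * V * realFreeEnergy d β (i / V))) else 0) ≤
      ENNReal.ofReal (Real.exp (1 - β * V * realPressure d β s)) *
        ENNReal.ofReal (poissonWeight c n) := by
    intro n
    split_ifs with h
    · rw [← ENNReal.ofReal_mul (Real.exp_nonneg _)]
      refine ENNReal.ofReal_le_ofReal ?_
      have h1 := poissonWeight_nonneg (c := fun k => V * cycleWeight d β k)
        (fun k => (mul_pos hV (cycleWeight_pos hβ k)).le) n
      rw [hc, poissonWeight_mul_exp, hsum, h, mul_left_comm, ← Real.exp_add]
      refine mul_le_mul_of_nonneg_left (Real.exp_le_exp.2 ?_) h1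
      linarith
    · exact zero_le
  refine (ENNReal.tsum_le_tsum hterm).trans ?_
  rw [ENNReal.tsum_mul_left]
  refine (mul_le_mul_right (tsum_poissonWeight_le hc0 hcs) _).trans ?_
  rw [← ENNReal.ofReal_mul (Real.exp_nonneg _), ← Real.exp_add]
  exact ENNReal.ofReal_le_ofReal (Real.exp_le_exp.2 (by linarith))

/-- Upper bound for the Gibbs weight of a set of configurations with large energy. -/
theorem tsum_gibbsWeight_le (hd : 1 ≤ d) (hβ : 0 < β) (hb : 0 < b) (hV : 0 < V)
    {S : Set CycleCounts} {c τ : ℝ} (hτ : 0 < τ)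
    (hS : ∀ n ∈ S, c + τ * shortDensity V m n ≤
      energy d β a b μ (shortDensity V m n, longDensity V m n)) :
    ∑' n, S.indicator (fun n => ENNReal.ofReal (gibbsWeight d β a b α μ V m n)) n ≤
      ENNReal.ofReal (Real.exp (-(V * totalWeight d β α)) *
        (Real.exp (V * tailWeight d β m + 1 - β * V * c) * (1 - Real.exp (-(β * τ)))⁻¹)) := by
  set E := Real.exp (-(V * totalWeight d β α)) with hE
  -- Configurations are sorted by their number `i` of short-cycle particles. The term `τ *
  -- shortDensity` supplies a factor `e^{-βτ i}`, so the sum over `i` is geometric.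
  have hterm : ∀ n, S.indicator (fun n => ENNReal.ofReal (gibbsWeight d β a b α μ V m n)) n ≤
      ∑' i : ℕ, ENNReal.ofReal (E * Real.exp (-(β * V * c)) * Real.exp (-(β * τ)) ^ i) *
        (if shortCount m n = i then
        ENNReal.ofReal (poissonWeight (fun k => V * cycleWeight d β k) n *
        Real.exp (β * V * realFreeEnergy d β (i / V))) else 0) := by
    intro n
    by_cases hn : n ∈ S
    swap
    · rw [Set.indicator_of_notMem hn]; exact zero_le
    rw [Set.indicator_of_mem hn]
    refine le_trans ?_ (ENNReal.le_tsum (shortCount m n))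
    rw [if_pos rfl, ← ENNReal.ofReal_mul (by positivity)]
    refine ENNReal.ofReal_le_ofReal ((gibbsWeight_le hβ hb hV n).trans ?_)
    have h1 := poissonWeight_nonneg (c := fun k => V * cycleWeight d β k)
      (fun k => (mul_pos hV (cycleWeight_pos hβ k)).le) n
    have h2 := mul_le_mul_of_nonneg_left (hS n hn) (mul_pos hβ hV).le
    have h3 : β * V * (c + τ * shortDensity V m n) = β * V * c + shortCount m n * (β * τ) := by
      rw [shortDensity_eq]; field_simp
    rw [← shortDensity_eq, ← Real.exp_nat_mul]
    calc E * (poissonWeight (fun k => V * cycleWeight d β k) n *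
          Real.exp (β * V * (realFreeEnergy d β (shortDensity V m n)
          - energy d β a b μ (shortDensity V m n, longDensity V m n))))
        ≤ E * (poissonWeight (fun k => V * cycleWeight d β k) n *
          Real.exp (-(β * V * c) + shortCount m n * -(β * τ) +
            β * V * realFreeEnergy d β (shortDensity V m n))) := by
          refine mul_le_mul_of_nonneg_left (mul_le_mul_of_nonneg_left (Real.exp_le_exp.2 ?_) h1)
            (Real.exp_nonneg _)
          linarith
      _ = _ := by rw [Real.exp_add, Real.exp_add]; ring
  refine (ENNReal.tsum_le_tsum hterm).trans ?_
  rw [ENNReal.tsum_comm]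
  have hr1 : Real.exp (-(β * τ)) < 1 := by
    rw [Real.exp_lt_one_iff]
    have := mul_pos hβ hτ
    linarith
  have hgeo := hasSum_geometric_of_lt_one (Real.exp_nonneg (-(β * τ))) hr1
  calc _ ≤ ∑' i : ℕ, ENNReal.ofReal (E * Real.exp (-(β * V * c)) * Real.exp (-(β * τ)) ^ i) *
        ENNReal.ofReal (Real.exp (V * tailWeight d β m + 1)) := by
        refine ENNReal.tsum_le_tsum fun i => ?_
        rw [ENNReal.tsum_mul_left]
        exact mul_le_mul_right (tsum_poissonWeight_fiber_le hd hβ hV i) _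
    _ = ENNReal.ofReal (E * Real.exp (-(β * V * c)) * (1 - Real.exp (-(β * τ)))⁻¹) *
        ENNReal.ofReal (Real.exp (V * tailWeight d β m + 1)) := by
        rw [ENNReal.tsum_mul_right, ← ENNReal.ofReal_tsum_of_nonneg (fun i => by positivity)
          (hgeo.summable.mul_left _), tsum_mul_left, hgeo.tsum_eq]
    _ = _ := by
        rw [← ENNReal.ofReal_mul' (Real.exp_nonneg _)]
        congr 1
        rw [show V * tailWeight d β m + 1 - β * V * c = (V * tailWeight d β m + 1) +
          -(β * V * c) by ring, Real.exp_add (V * tailWeight d β m + 1)]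
        ring

theorem lintegral_referenceMeasure (f : CycleCounts → ℝ≥0∞) :
    ∫⁻ n, f n ∂(referenceMeasure d β α V) =
      ∑' n, ENNReal.ofReal (referenceWeight d β α V n) * f n := by
  have hf : Measurable f := measurable_from_top
  unfold referenceMeasure
  rw [lintegral_sum_measure]
  refine tsum_congr fun n => ?_
  rw [lintegral_smul_measure, lintegral_dirac' _ hf, smul_eq_mul]

theorem referenceWeight_nonneg (hβ : 0 < β) (hV : 0 < V) (n : CycleCounts) :
    0 ≤ referenceWeight d β α V n := by
  unfold referenceWeight
  refine mul_nonneg (Real.exp_nonneg _) (Finset.prod_nonneg fun k _ => ?_)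
  have := cycleWeight_pos (d := d) hβ k
  positivity

/-- `tilted` normalises by a Bochner integral, which defaults to `0` without integrability.
Finiteness and positivity of the total weight make it agree with the sum in `ℝ≥0∞`. -/
theorem gibbsMeasure_apply (hβ : 0 < β) (hV : 0 < V)
    (hfin : ∑' n, ENNReal.ofReal (gibbsWeight d β a b α μ V m n) ≠ ⊤)
    (hpos : ∑' n, ENNReal.ofReal (gibbsWeight d β a b α μ V m n) ≠ 0) (S : Set CycleCounts) :
    gibbsMeasure d β a b α μ V m S =
      (∑' n, S.indicator (fun n => ENNReal.ofReal (gibbsWeight d β a b α μ V m n)) n) /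
        ∑' n, ENNReal.ofReal (gibbsWeight d β a b α μ V m n) := by
  have hmeas : ∀ T : Set CycleCounts, MeasurableSet T := fun T => trivial
  have hf : Measurable fun n : CycleCounts => Real.exp (-β * hamiltonian a b α μ V m n) :=
    measurable_from_top
  have hint : ∫ n, Real.exp (-β * hamiltonian a b α μ V m n) ∂(referenceMeasure d β α V) =
      (∑' n, ENNReal.ofReal (gibbsWeight d β a b α μ V m n)).toReal := by
    rw [integral_eq_lintegral_of_nonneg_ae (Eventually.of_forall fun n => Real.exp_nonneg _)
      hf.aestronglyMeasurable, lintegral_referenceMeasure]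
    congr 1
    refine tsum_congr fun n => ?_
    rw [← ENNReal.ofReal_mul (referenceWeight_nonneg hβ hV n)]
    rfl
  have hZ : 0 < (∑' n, ENNReal.ofReal (gibbsWeight d β a b α μ V m n)).toReal :=
    ENNReal.toReal_pos hpos hfin
  unfold gibbsMeasure
  rw [tilted_apply' _ _ (hmeas S), hint, ← lintegral_indicator (hmeas S),
    lintegral_referenceMeasure, div_eq_mul_inv, ← ENNReal.tsum_mul_right]
  refine tsum_congr fun n => ?_
  by_cases hn : n ∈ S
  · rw [Set.indicator_of_mem hn, Set.indicator_of_mem hn, ENNReal.ofReal_div_of_pos hZ,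
      ENNReal.ofReal_toReal hfin, div_eq_mul_inv, ← mul_assoc,
      ← ENNReal.ofReal_mul (referenceWeight_nonneg hβ hV n)]
    rfl
  · rw [Set.indicator_of_notMem hn, Set.indicator_of_notMem hn, mul_zero, zero_mul]

end

/-! ### Entropy of explicit configurations. -/

section

variable {d : ℕ} {β a b α μ V : ℝ} {m : ℕ}

/-- A finite tilted family of cycle weights with density `x` and nearly optimal free energy. -/
theorem exists_finite_tilt (hd : 1 ≤ d) (hβ : 0 < β) {x ε : ℝ} (hx : 0 < x) (hε : 0 < ε) :
    ∃ (A : Finset ℕ+) (s : ℝ),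
      ∑ k ∈ A, ((k : ℕ) : ℝ) * cycleWeight d β k * Real.exp (β * s * (k : ℕ)) = x ∧
      s * x - 1 / β * ∑ k ∈ A, cycleWeight d β k * Real.exp (β * s * (k : ℕ)) ≤
        realFreeEnergy d β x + ε := by
  set r := sBeta d β x with hr
  have hr0 : r ≤ 0 := sBeta_nonpos hd hβ hx
  have hnn : ∀ (s : ℝ) (k : ℕ+), 0 ≤ ((k : ℕ) : ℝ) * cycleWeight d β k * Real.exp (β * s * (k : ℕ)) :=
    fun s k => mul_nonneg (mul_cycleWeight_nonneg hβ k) (Real.exp_nonneg _)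
  -- A slight increase of `r = s_β(x)` makes the density exceed `x`, already for large finite `A`,
  -- while at `r` finite sums stay at most `x`. The intermediate value theorem then gives `s`
  -- between `r` and `t` with density exactly `x`.
  obtain ⟨t, hrt, ht1, ht2⟩ : ∃ t, r < t ∧ (t - r) * x ≤ ε / 2 ∧
      ∀ᶠ A : Finset ℕ+ in atTop,
        x < ∑ k ∈ A, ((k : ℕ) : ℝ) * cycleWeight d β k * Real.exp (β * t * (k : ℕ)) := by
    have he : 0 < ε / 2 / x := by positivity
    rcases hr0.lt_or_eq with hneg | hzero
    · refine ⟨r + min (ε / 2 / x) (-r / 2), ?_, ?_, ?_⟩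
      · have : 0 < min (ε / 2 / x) (-r / 2) := lt_min he (by linarith)
        linarith
      · rw [add_sub_cancel_left, ← le_div_iff₀ hx]
        exact min_le_left _ _
      · have h0 : 0 < min (ε / 2 / x) (-r / 2) := lt_min he (by linarith)
        have hneg' : r + min (ε / 2 / x) (-r / 2) < 0 := by
          have := min_le_right (ε / 2 / x) (-r / 2)
          linarith
        have h1 := (sBeta_lt_iff hd hβ hx hneg').1 (by linarith)
        exact (summable_density hd hβ hneg').hasSum.eventually_const_lt h1
    -- When `s_β(x) = 0` the tilt becomes positive. The full series diverges there, but finite sums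
    -- make sense, which is how an excess over the critical density is carried by finitely many
    -- lengths.
    · refine ⟨ε / 2 / x, by rw [hzero]; exact he, ?_, ?_⟩
      · rw [hzero, sub_zero, div_mul_cancel₀ _ hx.ne']
      · have h1 : ∑' k : ℕ+, ENNReal.ofReal
            (((k : ℕ) : ℝ) * cycleWeight d β k * Real.exp (β * (ε / 2 / x) * (k : ℕ))) = ⊤ := by
          have h2 := idealPressure_of_pos (d := d) hβ he
          unfold idealPressure at h2
          rcases ENNReal.mul_eq_top.1 h2 with h3 | h3
          · rw [eq_top_iff, ← h3.2]
            refine ENNReal.tsum_le_tsum fun k => ENNReal.ofReal_le_ofReal ?_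
            have hk : (1 : ℝ) ≤ (k : ℕ) := by exact_mod_cast k.pos
            have hq := cycleWeight_pos (d := d) hβ k
            refine mul_le_mul_of_nonneg_right ?_ (Real.exp_nonneg _)
            nlinarith
          · exact absurd h3.1 ENNReal.ofReal_ne_top
        have h4 := (ENNReal.summable (f := fun k : ℕ+ => ENNReal.ofReal
          (((k : ℕ) : ℝ) * cycleWeight d β k * Real.exp (β * (ε / 2 / x) * (k : ℕ))))).hasSum
        rw [h1] at h4
        filter_upwards [h4.eventually_const_lt (ENNReal.ofReal_lt_top (r := x))] with A hA
        rw [← ENNReal.ofReal_sum_of_nonneg fun k _ => hnn _ k] at hA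
        exact (ENNReal.ofReal_lt_ofReal_iff'.1 hA).1
  have hP : ∀ᶠ A : Finset ℕ+ in atTop, realPressure d β r - ε / 2 <
      1 / β * ∑ k ∈ A, cycleWeight d β k * Real.exp (β * r * (k : ℕ)) := by
    have h1 := (summable_pressure hd hβ hr0).hasSum.const_mul (1 / β)
    exact h1.eventually_const_lt (sub_lt_self _ (by linarith))
  obtain ⟨A, hA1, hA2⟩ := (ht2.and hP).exists
  have hlow : ∑ k ∈ A, ((k : ℕ) : ℝ) * cycleWeight d β k * Real.exp (β * r * (k : ℕ)) ≤ x := by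
    rcases hr0.lt_or_eq with hneg | hzero
    · rw [← realDensity_sBeta hd hβ hx hneg]
      exact (summable_density hd hβ hneg).sum_le_tsum A fun k _ => hnn _ k
    · have hc : criticalDensity d β ≤ ENNReal.ofReal x := by
        by_contra hcon
        push Not at hcon
        have := (sBeta_spec hd hβ hx hcon).1
        linarith
      rw [criticalDensity_eq_tsum hβ] at hc
      rw [← ENNReal.ofReal_le_ofReal_iff hx.le]
      refine le_trans (le_of_eq ?_) ((ENNReal.sum_le_tsum A).trans hc)
      rw [ENNReal.ofReal_sum_of_nonneg fun k _ => hnn _ k, hzero]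
      simp
  have hcont : Continuous fun s : ℝ =>
      ∑ k ∈ A, ((k : ℕ) : ℝ) * cycleWeight d β k * Real.exp (β * s * (k : ℕ)) := by fun_prop
  obtain ⟨s, hs, hsx⟩ := intermediate_value_Icc hrt.le hcont.continuousOn ⟨hlow, hA1.le⟩
  refine ⟨A, s, hsx, ?_⟩
  have h1 : ∑ k ∈ A, cycleWeight d β k * Real.exp (β * r * (k : ℕ)) ≤
      ∑ k ∈ A, cycleWeight d β k * Real.exp (β * s * (k : ℕ)) := by
    refine Finset.sum_le_sum fun k _ => ?_
    have hq := cycleWeight_pos (d := d) hβ k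
    have := hs.1
    gcongr
  have h2 := mul_le_mul_of_nonneg_left h1 (show 0 ≤ 1 / β by positivity)
  have h3 : s * x ≤ t * x := mul_le_mul_of_nonneg_right hs.2 hx.le
  rw [realFreeEnergy_of_pos hx]
  linarith

/-- Stirling asymptotics of Poisson weights. -/
theorem tendsto_log_poisson {q ν : ℝ} (hq : 0 < q) (hν : 0 < ν) :
    Tendsto (fun V : ℝ => Real.log ((V * q) ^ ⌊ν * V⌋₊ / (Nat.factorial ⌊ν * V⌋₊ : ℝ)) / V)
      atTop (𝓝 (ν * (1 - Real.log (ν / q)))) := by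
  have hfl : Tendsto (fun V : ℝ => (⌊ν * V⌋₊ : ℝ) / V) atTop (𝓝 ν) :=
    tendsto_nat_floor_mul_div_atTop hν.le
  have hinf : Tendsto (fun V : ℝ => ⌊ν * V⌋₊) atTop atTop :=
    tendsto_nat_floor_atTop.comp (tendsto_id.const_mul_atTop hν)
  have hst : Tendsto (fun V : ℝ => Real.log (Stirling.stirlingSeq ⌊ν * V⌋₊) / V) atTop (𝓝 0) := by
    have h1 : Tendsto (fun V : ℝ => Real.log (Stirling.stirlingSeq ⌊ν * V⌋₊)) atTop
        (𝓝 (Real.log (√Real.pi))) :=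
      ((Real.continuousAt_log (by positivity)).tendsto.comp
        Stirling.tendsto_stirlingSeq_sqrt_pi).comp hinf
    exact h1.div_atTop tendsto_id
  have hlogV : Tendsto (fun V : ℝ => Real.log V / V) atTop (𝓝 0) :=
    Real.isLittleO_log_id_atTop.tendsto_div_nhds_zero
  have hratio : Tendsto (fun V : ℝ => Real.log ((⌊ν * V⌋₊ : ℝ) / V)) atTop (𝓝 (Real.log ν)) :=
    (Real.continuousAt_log hν.ne').tendsto.comp hfl
  have hlogn : Tendsto (fun V : ℝ => (Real.log 2 + (Real.log ((⌊ν * V⌋₊ : ℝ) / V))) / V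
      + Real.log V / V) atTop (𝓝 0) := by
    have h1 := (tendsto_const_nhds (x := Real.log 2)).add hratio
    simpa using (h1.div_atTop tendsto_id).add hlogV
  have hmain : Tendsto (fun V : ℝ => (⌊ν * V⌋₊ : ℝ) / V *
      (Real.log q - Real.log ((⌊ν * V⌋₊ : ℝ) / V) + 1)
      - 1 / 2 * ((Real.log 2 + (Real.log ((⌊ν * V⌋₊ : ℝ) / V))) / V + Real.log V / V)
      - Real.log (Stirling.stirlingSeq ⌊ν * V⌋₊) / V) atTop
      (𝓝 (ν * (Real.log q - Real.log ν + 1) - 1 / 2 * 0 - 0)) :=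
    ((hfl.mul ((tendsto_const_nhds.sub hratio).add_const 1)).sub (hlogn.const_mul (1 / 2))).sub hst
  have hlim : ν * (Real.log q - Real.log ν + 1) - 1 / 2 * 0 - 0 = ν * (1 - Real.log (ν / q)) := by
    rw [Real.log_div hν.ne' hq.ne']; ring
  rw [hlim] at hmain
  refine hmain.congr' ?_
  filter_upwards [eventually_gt_atTop 0, hinf.eventually_ge_atTop 1] with V hV hn
  have hn0 : (0 : ℝ) < (⌊ν * V⌋₊ : ℝ) := by exact_mod_cast hn
  have hf := Stirling.log_stirlingSeq_formula ⌊ν * V⌋₊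
  set n := ⌊ν * V⌋₊
  have hfac : (0 : ℝ) < (Nat.factorial n : ℝ) := by exact_mod_cast Nat.factorial_pos n
  rw [Real.log_div (by positivity) hfac.ne', Real.log_pow, Real.log_mul hV.ne' hq.ne']
  rw [Real.log_mul (by norm_num) hn0.ne', Real.log_div hn0.ne' (Real.exp_ne_zero 1),
    Real.log_exp] at hf
  rw [hf, Real.log_div hn0.ne' hV.ne']
  field_simp
  ring

/-- The configuration with `⌊ν k V⌋` cycles of each length `k ∈ A`. -/
noncomputable def roundedConfig (A : Finset ℕ+) (ν : ℕ+ → ℝ) (V : ℝ) : CycleCounts :=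
  Finsupp.indicator A fun k _ => ⌊ν k * V⌋₊

theorem roundedConfig_sum (A : Finset ℕ+) (ν : ℕ+ → ℝ) (V : ℝ) (g : ℕ+ → ℕ → ℝ)
    (hg : ∀ k, g k 0 = 0) :
    ((roundedConfig A ν V).sum g) = ∑ k ∈ A, g k ⌊ν k * V⌋₊ := by
  unfold roundedConfig
  rw [Finsupp.sum_of_support_subset _ (Finsupp.support_indicator_subset _ _) _ fun k _ => hg k]
  exact Finset.sum_congr rfl fun k hk => by rw [Finsupp.indicator_of_mem hk]

theorem poissonWeight_roundedConfig (A : Finset ℕ+) (ν : ℕ+ → ℝ) (V : ℝ) (c : ℕ+ → ℝ) :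
    poissonWeight c (roundedConfig A ν V) =
      ∏ k ∈ A, c k ^ ⌊ν k * V⌋₊ / (Nat.factorial ⌊ν k * V⌋₊ : ℝ) := by
  unfold roundedConfig poissonWeight
  rw [Finsupp.prod_of_support_subset _ (Finsupp.support_indicator_subset _ _) _ (by simp)]
  exact Finset.prod_congr rfl fun k hk => by rw [Finsupp.indicator_of_mem hk]

theorem tendsto_log_poissonWeight_roundedConfig (hβ : 0 < β) (A : Finset ℕ+) {ν : ℕ+ → ℝ}
    (hν : ∀ k, 0 < ν k) :
    Tendsto (fun V : ℝ =>
      Real.log (poissonWeight (fun k => V * cycleWeight d β k) (roundedConfig A ν V)) / V) atTop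
      (𝓝 (∑ k ∈ A, ν k * (1 - Real.log (ν k / cycleWeight d β k)))) := by
  have h := tendsto_finsetSum A fun k _ =>
    tendsto_log_poisson (cycleWeight_pos (d := d) hβ k) (hν k)
  refine h.congr' ?_
  filter_upwards [eventually_gt_atTop 0] with V hV
  rw [poissonWeight_roundedConfig, Real.log_prod, Finset.sum_div]
  intro k _
  have := cycleWeight_pos (d := d) hβ k
  positivity

end

/-! ### Lower bound for the partition function, and concentration. -/

section

variable {d : ℕ} {β a b α μ V : ℝ} {m : ℕ} {κ : ℝ≥0∞}

/-- The Gibbs weight of a rounded configuration of short cycles together with `c` long cycles of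
length `K`. -/
theorem le_gibbsWeight_roundedConfig_add (hβ : 0 < β) (hb : 0 < b) (hV : 0 < V) {A : Finset ℕ+}
    {ν : ℕ+ → ℝ} {K : ℕ+} {c : ℕ} (hA : ∀ k ∈ A, PNat.val k < m) (hK : m ≤ PNat.val K)
    {x y : ℝ} (hx : x = ∑ k ∈ A, ((k : ℕ) : ℝ) * ((⌊ν k * V⌋₊ : ℝ) / V))
    (hy : y = ((K : ℕ) : ℝ) * ((c : ℝ) / V)) :
    Real.exp (-(V * totalWeight d β α)) *
      (poissonWeight (fun k => V * cycleWeight d β k) (roundedConfig A ν V) *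
        ((V * cycleWeight d β K) ^ c / (Nat.factorial c : ℝ)) *
        Real.exp (β * V * (μ * (x + y) - a / 2 * (x + y) ^ 2 + b / 2 * y ^ 2))) ≤
      gibbsWeight d β a b α μ V m (roundedConfig A ν V + Finsupp.single K c) := by
  have hKA : K ∉ A := fun h => absurd (hA K h) (not_lt.2 hK)
  set n := roundedConfig A ν V + Finsupp.single K c with hn
  have hdisj : Disjoint (roundedConfig A ν V).support (Finsupp.single K c).support := by
    refine Finset.disjoint_of_subset_left (Finsupp.support_indicator_subset _ _)
      (Finset.disjoint_of_subset_right Finsupp.support_single_subset ?_)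
    rwa [Finset.disjoint_singleton_right]
  have hpw : poissonWeight (fun k => V * cycleWeight d β k) n =
      poissonWeight (fun k => V * cycleWeight d β k) (roundedConfig A ν V) *
        ((V * cycleWeight d β K) ^ c / (Nat.factorial c : ℝ)) := by
    rw [hn, poissonWeight, Finsupp.prod_add_index_of_disjoint hdisj,
      Finsupp.prod_single_index (by simp)]
    rfl
  have hshort : shortDensity V m n = x := by
    have h1 : shortDensity V m n = n.sum fun k j =>
        if PNat.val k < m then ((k : ℕ) : ℝ) * ((j : ℝ) / V) else 0 := by
      unfold shortDensity Finsupp.sum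
      rw [Finset.sum_filter]
      rfl
    rw [h1, hn, Finsupp.sum_add_index' (by simp) (by
      intro k i j
      split_ifs
      · push_cast; ring
      · simp), Finsupp.sum_single_index (by simp), if_neg (not_lt.2 hK), add_zero,
      roundedConfig_sum _ _ _ _ (by simp), hx]
    exact Finset.sum_congr rfl fun k hk => if_pos (hA k hk)
  have hlong : longDensity V m n = y := by
    have h1 : longDensity V m n = n.sum fun k j =>
        if m ≤ PNat.val k then ((k : ℕ) : ℝ) * ((j : ℝ) / V) else 0 := by
      unfold longDensity Finsupp.sum
      rw [Finset.sum_filter]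
      rfl
    rw [h1, hn, Finsupp.sum_add_index' (by simp) (by
      intro k i j
      split_ifs
      · push_cast; ring
      · simp), Finsupp.sum_single_index (by simp), if_pos hK,
      roundedConfig_sum _ _ _ _ (by simp), hy]
    rw [Finset.sum_eq_zero fun k hk => if_neg (not_le.2 (hA k hk)), zero_add]
  -- All long density sits on the single length `K`, so the sum of squares reaches `y²` and nothing
  -- is lost against the upper bound. For `c = 0` the length `K` is not in the support.
  have hsq : y ^ 2 ≤ longSquare V m n := by
    have hnn : ∀ i ∈ n.support.filter fun k => m ≤ PNat.val k,
        0 ≤ ((i : ℕ) : ℝ) ^ 2 * cycleDensity V n i ^ 2 := fun i _ => by positivity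
    rcases Nat.eq_zero_or_pos c with hc | hc
    · have h0 : 0 ≤ longSquare V m n := Finset.sum_nonneg hnn
      rw [hy, hc]
      simpa using h0
    · have hnK : c ≤ n K := by simp [hn]
      have hmem : K ∈ n.support.filter fun k => m ≤ PNat.val k := by
        rw [Finset.mem_filter, Finsupp.mem_support_iff]
        exact ⟨by omega, hK⟩
      refine le_trans ?_ (Finset.single_le_sum hnn hmem)
      rw [hy, mul_pow]
      unfold cycleDensity
      have : (c : ℝ) ≤ n K := by exact_mod_cast hnK
      gcongr
  rw [gibbsWeight_eq hV, hpw, hshort, hlong]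
  have h1 := poissonWeight_nonneg (c := fun k => V * cycleWeight d β k)
    (fun k => (mul_pos hV (cycleWeight_pos hβ k)).le) (roundedConfig A ν V)
  have h2 := cycleWeight_pos (d := d) hβ K
  gcongr

/-- A long cycle of macroscopic length has subexponential weight. -/
theorem tendsto_log_cycleWeight (hβ : 0 < β) {V : ℕ → ℝ} (hV : Tendsto V atTop atTop)
    {K : ℕ → ℕ+} {y : ℝ} (hy : 0 < y)
    (hK : Tendsto (fun j => ((K j : ℕ) : ℝ) / V j) atTop (𝓝 y)) :
    Tendsto (fun j => Real.log (V j * cycleWeight d β (K j)) / V j) atTop (𝓝 0) := by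
  have hpi := Real.pi_pos
  have hlogV : Tendsto (fun j => Real.log (V j) / V j) atTop (𝓝 0) :=
    (Real.isLittleO_log_id_atTop.tendsto_div_nhds_zero).comp hV
  have hlogK : Tendsto (fun j => Real.log (((K j : ℕ) : ℝ) / V j)) atTop (𝓝 (Real.log y)) :=
    (Real.continuousAt_log hy.ne').tendsto.comp hK
  set C := (4 * Real.pi * β) ^ ((d : ℝ) / 2) with hC
  have hC0 : 0 < C := by positivity
  set p := 1 + (d : ℝ) / 2 with hp
  have h1 : Tendsto (fun j => Real.log (V j) / V j - (Real.log C +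
      p * Real.log (((K j : ℕ) : ℝ) / V j)) / V j - p * (Real.log (V j) / V j)) atTop
      (𝓝 (0 - 0 - p * 0)) :=
    (hlogV.sub (((tendsto_const_nhds (x := Real.log C)).add (hlogK.const_mul p)).div_atTop hV)).sub
      (hlogV.const_mul p)
  simp only [sub_zero, mul_zero] at h1
  refine h1.congr' ?_
  filter_upwards [hV.eventually_gt_atTop 0] with j hj
  have hk : (0 : ℝ) < (K j : ℕ) := by exact_mod_cast (K j).pos
  unfold cycleWeight
  rw [← hC, ← hp, Real.log_mul hj.ne' (by positivity), one_div, Real.log_inv,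
    Real.log_mul hC0.ne' (by positivity), Real.log_rpow hk, Real.log_div hk.ne' hj.ne']
  field_simp
  ring

/-- Lower bound for the partition function by the weight of a single configuration. -/
theorem eventually_exists_gibbsWeight_ge (hd : 1 ≤ d) (hβ : 0 < β) (hb : 0 < b)
    {V : ℕ → ℝ} {m : ℕ → ℕ} (hV : Tendsto V atTop atTop) (hm : Tendsto m atTop atTop)
    (hratio : Tendsto (fun j => ENNReal.ofReal ((m j : ℝ) / V j)) atTop (𝓝 κ))
    {x y ε : ℝ} (hz : (x, y) ∈ admissible κ) (hx : 0 < x) (hε : 0 < ε) :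
    ∀ᶠ j in atTop, ∃ n, Real.exp (-(V j * totalWeight d β α)) *
      Real.exp (-(β * V j * (energy d β a b μ (x, y) + ε))) ≤
      gibbsWeight d β a b α μ (V j) (m j) n := by
  obtain ⟨A, s, hAx, hAf⟩ := exists_finite_tilt hd hβ hx (half_pos hε)
  set ν : ℕ+ → ℝ := fun k => cycleWeight d β k * Real.exp (β * s * (k : ℕ)) with hν
  have hν0 : ∀ k, 0 < ν k := fun k => mul_pos (cycleWeight_pos hβ k) (Real.exp_pos _)
  have hlog := (tendsto_log_poissonWeight_roundedConfig (d := d) hβ A hν0).comp hV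
  have hlim : ∑ k ∈ A, ν k * (1 - Real.log (ν k / cycleWeight d β k)) =
      ∑ k ∈ A, ν k - β * s * x := by
    rw [← hAx, Finset.mul_sum, ← Finset.sum_sub_distrib]
    refine Finset.sum_congr rfl fun k _ => ?_
    simp only [hν]
    rw [mul_div_cancel_left₀ _ (cycleWeight_pos hβ k).ne', Real.log_exp]
    ring
  rw [hlim] at hlog
  set X : ℕ → ℝ := fun j => ∑ k ∈ A, ((k : ℕ) : ℝ) * ((⌊ν k * V j⌋₊ : ℝ) / V j) with hX
  have hXlim : Tendsto X atTop (𝓝 x) := by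
    have h1 : Tendsto X atTop (𝓝 (∑ k ∈ A, ((k : ℕ) : ℝ) * ν k)) :=
      tendsto_finsetSum A fun k _ =>
        ((tendsto_nat_floor_mul_div_atTop (hν0 k).le).comp hV).const_mul _
    convert h1 using 2
    rw [← hAx]
    exact Finset.sum_congr rfl fun k _ => by simp only [hν]; ring
  -- A length that is at least the cut-off and close to `yV`; the successor keeps it positive. If `y
  -- > 0`, then `κ ≤ y` yields `K / V → y`, and one cycle (`c = 1`) is used; if `y = 0`, none (`c =
  -- 0`).
  set K : ℕ → ℕ+ := fun j => Nat.succPNat (max (m j) ⌈y * V j⌉₊) with hK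
  have hKval : ∀ j, ((K j : ℕ) : ℝ) = max (m j : ℝ) (⌈y * V j⌉₊ : ℝ) + 1 := by
    intro j
    simp [hK]
  have hKm : ∀ j, m j ≤ PNat.val (K j) := by
    intro j
    have : PNat.val (K j) = max (m j) ⌈y * V j⌉₊ + 1 := Nat.succPNat_coe _
    rw [this]
    exact (le_max_left _ _).trans (Nat.le_succ _)
  have hVinv : Tendsto (fun j => 1 / V j) atTop (𝓝 0) :=
    (tendsto_const_nhds (x := (1 : ℝ))).div_atTop hV
  obtain ⟨c, hc1, hc2⟩ : ∃ c : ℕ, Tendsto (fun j => ((K j : ℕ) : ℝ) * ((c : ℝ) / V j)) atTop (𝓝 y) ∧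
      Tendsto (fun j => Real.log ((V j * cycleWeight d β (K j)) ^ c / (Nat.factorial c : ℝ)) / V j)
        atTop (𝓝 0) := by
    rcases (admissible_nonneg hz).eq_or_lt with hy | hy
    · simp only at hy
      subst hy
      exact ⟨0, by simp, by simp⟩
    · simp only at hy
      have hκ : κ ≤ ENNReal.ofReal y := by
        rcases hz.2 with h | h
        · exact absurd h hy.ne'
        · exact h.2
      have hceil : Tendsto (fun j => (⌈y * V j⌉₊ : ℝ) / V j) atTop (𝓝 y) :=
        (tendsto_nat_ceil_mul_div_atTop hy.le).comp hV
      have hKlim : Tendsto (fun j => ((K j : ℕ) : ℝ) / V j) atTop (𝓝 y) := by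
        rw [tendsto_order]
        constructor
        · intro r hr
          filter_upwards [hceil.eventually_const_lt hr, hV.eventually_gt_atTop 0] with j h1 h2
          refine h1.trans_le ?_
          rw [hKval]
          gcongr
          exact (le_max_right _ _).trans (le_add_of_nonneg_right zero_le_one)
        · intro r hr
          have hr' : y < (y + r) / 2 := by linarith
          have hr2 : 0 < (r - y) / 2 := by linarith
          have hmr : ∀ᶠ j in atTop, ENNReal.ofReal ((m j : ℝ) / V j) < ENNReal.ofReal ((y + r) / 2) :=
            hratio.eventually_lt_const (hκ.trans_lt
              ((ENNReal.ofReal_lt_ofReal_iff (by linarith)).2 hr'))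
          filter_upwards [hceil.eventually_lt_const hr', hV.eventually_gt_atTop 0, hmr,
            hVinv.eventually_lt_const hr2] with j h1 h2 h3 h4
          have h5 := (ENNReal.ofReal_lt_ofReal_iff'.1 h3).1
          rw [hKval, add_div]
          rw [div_lt_iff₀ h2] at h1 h5
          have h6 : max (m j : ℝ) (⌈y * V j⌉₊ : ℝ) / V j < (y + r) / 2 := by
            rw [div_lt_iff₀ h2]
            exact max_lt h5 h1
          linarith
      refine ⟨1, ?_, ?_⟩
      · simpa [div_eq_mul_inv] using hKlim
      · simpa using tendsto_log_cycleWeight (d := d) hβ hV hy hKlim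
  set Y : ℕ → ℝ := fun j => ((K j : ℕ) : ℝ) * ((c : ℝ) / V j) with hY
  set Φ : ℕ → ℝ := fun j =>
    Real.log (poissonWeight (fun k => V j * cycleWeight d β k) (roundedConfig A ν (V j))) / V j +
    Real.log ((V j * cycleWeight d β (K j)) ^ c / (Nat.factorial c : ℝ)) / V j +
    β * (μ * (X j + Y j) - a / 2 * (X j + Y j) ^ 2 + b / 2 * Y j ^ 2) with hΦ
  have hΦlim : Tendsto Φ atTop (𝓝 ((∑ k ∈ A, ν k - β * s * x) + 0 +
      β * (μ * (x + y) - a / 2 * (x + y) ^ 2 + b / 2 * y ^ 2))) := by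
    refine (hlog.add hc2).add (Tendsto.const_mul β ?_)
    have hXY := hXlim.add hc1
    exact ((hXY.const_mul μ).sub ((hXY.pow 2).const_mul (a / 2))).add ((hc1.pow 2).const_mul (b / 2))
  have hgt : -(β * (energy d β a b μ (x, y) + ε)) < (∑ k ∈ A, ν k - β * s * x) + 0 +
      β * (μ * (x + y) - a / 2 * (x + y) ^ 2 + b / 2 * y ^ 2) := by
    have h1 := mul_le_mul_of_nonneg_left hAf hβ.le
    have h2 : β * (s * x - 1 / β * ∑ k ∈ A, cycleWeight d β k * Real.exp (β * s * (k : ℕ))) =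
        β * s * x - ∑ k ∈ A, ν k := by
      simp only [hν]
      field_simp
    rw [h2] at h1
    have h3 := mul_pos hβ hε
    unfold energy
    simp only
    linarith
  have hAm : ∀ᶠ j in atTop, ∀ k ∈ A, PNat.val k < m j := by
    filter_upwards [hm.eventually_gt_atTop (A.sup PNat.val)] with j hj k hk
    exact (Finset.le_sup (f := PNat.val) hk).trans_lt hj
  filter_upwards [hΦlim.eventually_const_lt hgt, hAm, hV.eventually_gt_atTop 0] with j h1 h2 h3
  refine ⟨_, le_trans ?_ (le_gibbsWeight_roundedConfig_add (c := c) hβ hb h3 h2 (hKm j)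
    (x := X j) (y := Y j) rfl rfl)⟩
  refine mul_le_mul_of_nonneg_left ?_ (Real.exp_nonneg _)
  have hp1 : 0 < poissonWeight (fun k => V j * cycleWeight d β k) (roundedConfig A ν (V j)) := by
    rw [poissonWeight_roundedConfig]
    refine Finset.prod_pos fun k _ => ?_
    have := cycleWeight_pos (d := d) hβ k
    positivity
  have hp2 : 0 < (V j * cycleWeight d β (K j)) ^ c / (Nat.factorial c : ℝ) := by
    have := cycleWeight_pos (d := d) hβ (K j)
    positivity
  rw [← Real.exp_log hp1, ← Real.exp_log hp2, ← Real.exp_add, ← Real.exp_add, Real.exp_le_exp]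
  have h4 := mul_le_mul_of_nonneg_left h1.le h3.le
  have h5 : V j * Φ j = Real.log (poissonWeight (fun k => V j * cycleWeight d β k)
      (roundedConfig A ν (V j))) + Real.log ((V j * cycleWeight d β (K j)) ^ c /
      (Nat.factorial c : ℝ)) + β * V j * (μ * (X j + Y j) - a / 2 * (X j + Y j) ^ 2 +
      b / 2 * Y j ^ 2) := by
    rw [hΦ]
    simp only
    rw [mul_add, mul_add, mul_div_cancel₀ _ h3.ne', mul_div_cancel₀ _ h3.ne']
    ring
  rw [h5] at h4
  linarith

/-- The energy exceeds its minimum uniformly away from the minimiser. -/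
theorem energy_gap (hd : 1 ≤ d) (hβ : 0 < β) (hb : 0 < b) (hab : b < a)
    {V : ℕ → ℝ} {m : ℕ → ℕ}
    (hratio : Tendsto (fun j => ENNReal.ofReal ((m j : ℝ) / V j)) atTop (𝓝 κ))
    {z : ℝ × ℝ} (hz : minimisers d β a b μ κ = {z}) {C : Set (ℝ × ℝ)} (hC : IsClosed C)
    (hzC : z ∉ C) :
    ∃ η > 0, ∃ τ > 0, ∀ᶠ j in atTop, ∀ w ∈ C, 0 ≤ w.1 → 0 ≤ w.2 →
      (w.2 = 0 ∨ (m j : ℝ) / V j ≤ w.2) →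
      energy d β a b μ z + η + τ * w.1 ≤ energy d β a b μ w := by
  set E := energy d β a b μ z with hE
  obtain ⟨R, hR, hco⟩ := energy_coercive (d := d) (β := β) hd hβ hb hab μ (E + 1)
  have hzmem : z ∈ minimisers d β a b μ κ := by rw [hz]; rfl
  -- If no uniform gap existed, near-minimising points along a subsequence would accumulate at a
  -- minimiser in `C`, contradicting uniqueness. The limit is admissible: either `w.2 = 0`
  -- infinitely often, or `m / V ≤ w.2` passes to the limit.
  have hcompact : ∃ η > 0, ∀ᶠ j in atTop, ∀ w ∈ C, 0 ≤ w.1 → 0 ≤ w.2 → w.1 + w.2 ≤ R →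
      (w.2 = 0 ∨ (m j : ℝ) / V j ≤ w.2) → E + η ≤ energy d β a b μ w := by
    by_contra hcon
    push Not at hcon
    have hfreq : ∀ i : ℕ, ∃ᶠ j in atTop, ∃ w ∈ C, 0 ≤ w.1 ∧ 0 ≤ w.2 ∧ w.1 + w.2 ≤ R ∧
        (w.2 = 0 ∨ (m j : ℝ) / V j ≤ w.2) ∧ energy d β a b μ w < E + 1 / ((i : ℝ) + 1) := fun i =>
      hcon (1 / ((i : ℝ) + 1)) (by positivity)
    obtain ⟨φ, hφ, hφw⟩ := extraction_forall_of_frequently hfreq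
    choose w hwC hw1 hw2 hwR hwm hwE using hφw
    have hK : IsCompact (Set.Icc ((0 : ℝ), (0 : ℝ)) (R, R)) := isCompact_Icc
    obtain ⟨v, hv, ψ, hψ, hlim⟩ := hK.tendsto_subseq (x := w) fun i =>
      ⟨⟨hw1 i, hw2 i⟩, ⟨by have := hwR i; have := hw2 i; simp only; linarith,
        by have := hwR i; have := hw1 i; simp only; linarith⟩⟩
    have hvC : v ∈ C := hC.mem_of_tendsto hlim (Eventually.of_forall fun i => hwC _)
    have hv1 : 0 ≤ v.1 := hv.1.1
    have hv2 : 0 ≤ v.2 := hv.1.2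
    have hlim2 : Tendsto (fun i => (w (ψ i)).2) atTop (𝓝 v.2) :=
      (continuous_snd.tendsto v).comp hlim
    have hvadm : v ∈ admissible κ := by
      refine ⟨hv1, ?_⟩
      by_cases hfr : ∃ᶠ i in atTop, (w (ψ i)).2 = 0
      · left
        by_contra hne
        exact hfr (hlim2.eventually_ne hne)
      · right
        refine ⟨hv2, ?_⟩
        have h1 : ∀ᶠ i in atTop, ENNReal.ofReal ((m (φ (ψ i)) : ℝ) / V (φ (ψ i))) ≤
            ENNReal.ofReal (w (ψ i)).2 := by
          filter_upwards [not_frequently.1 hfr] with i hi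
          exact ENNReal.ofReal_le_ofReal ((hwm (ψ i)).resolve_left hi)
        exact le_of_tendsto_of_tendsto
          (hratio.comp (hφ.tendsto_atTop.comp hψ.tendsto_atTop))
          ((ENNReal.continuous_ofReal.tendsto _).comp hlim2) h1
    have hEv : energy d β a b μ v ≤ E := by
      have h1 : Tendsto (fun i => energy d β a b μ (w (ψ i))) atTop (𝓝 (energy d β a b μ v)) := by
        refine ((continuousOn_energy (a := a) (b := b) (μ := μ) hd hβ) v hv1).tendsto.comp ?_
        exact tendsto_nhdsWithin_iff.2 ⟨hlim, Eventually.of_forall fun i => hw1 _⟩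
      have h2 : Tendsto (fun i => E + 1 / (((ψ i : ℕ) : ℝ) + 1)) atTop (𝓝 (E + 0)) :=
        ((tendsto_one_div_add_atTop_nhds_zero_nat (𝕜 := ℝ)).comp hψ.tendsto_atTop).const_add E
      rw [add_zero] at h2
      exact le_of_tendsto_of_tendsto h1 h2 (Eventually.of_forall fun i => (hwE (ψ i)).le)
    have hvmin : v ∈ minimisers d β a b μ κ :=
      ⟨hvadm, fun u hu => hEv.trans (hzmem.2 u hu)⟩
    rw [hz] at hvmin
    exact hzC (hvmin ▸ hvC)
  obtain ⟨η, hη, hev⟩ := hcompact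
  -- Where `w.1 + w.2 ≤ R`, half of the gap `η` pays for `τ * w.1`; beyond `R`, coercivity pays for
  -- it.
  refine ⟨min η 1 / 2, by positivity, min (η / (2 * R)) 1, by positivity, ?_⟩
  filter_upwards [hev] with j hj w hwC hw1 hw2 hwm
  have hη1 : min η 1 ≤ η := min_le_left _ _
  have hη2 : min η 1 ≤ 1 := min_le_right _ _
  rcases le_or_gt (w.1 + w.2) R with h | h
  · have h1 := hj w hwC hw1 hw2 h hwm
    have h2 : min (η / (2 * R)) 1 * w.1 ≤ η / (2 * R) * R :=
      mul_le_mul (min_le_left _ _) (by linarith) hw1 (by positivity)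
    have h3 : η / (2 * R) * R = η / 2 := by field_simp
    linarith
  · have h1 := hco w hw1 hw2 h.le
    have h2 : min (η / (2 * R)) 1 * w.1 ≤ 1 * w.1 :=
      mul_le_mul_of_nonneg_right (min_le_right _ _) hw1
    linarith

/-- Completing the square in `x + y`. The linear term feeds the geometric series that makes the
partition function finite. -/
theorem energy_linear_bound (hd : 1 ≤ d) (hβ : 0 < β) (hb : 0 < b) (hab : b < a) (μ : ℝ) :
    ∃ c : ℝ, ∀ z : ℝ × ℝ, 0 ≤ z.1 → 0 ≤ z.2 → c + 1 * z.1 ≤ energy d β a b μ z := by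
  have hab' : 0 < a - b := sub_pos.2 hab
  refine ⟨-realPressure d β 0 - (μ + 1) ^ 2 / (2 * (a - b)), fun z h1 h2 => ?_⟩
  have h3 := le_energy (a := a) (μ := μ) hd hβ hb h1 h2
  have h4 : 0 ≤ ((a - b) * (z.1 + z.2) - (μ + 1)) ^ 2 / (2 * (a - b)) := by positivity
  have h5 : ((a - b) * (z.1 + z.2) - (μ + 1)) ^ 2 / (2 * (a - b)) =
      (a - b) / 2 * (z.1 + z.2) ^ 2 - (μ + 1) * (z.1 + z.2) + (μ + 1) ^ 2 / (2 * (a - b)) := by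
    field_simp
    ring
  linarith

/-- Outside the ball the weight is at most of order `exp(-βV(E + η) + o(V))`, whereas the partition
function is at least of order `exp(-βV(E + η/2))`. The common factor containing `α` cancels in the
quotient. -/
theorem pairDensityConcentratesAt_of_minimisers (hd : 1 ≤ d) (hβ : 0 < β) (hb : 0 < b)
    (hab : b < a) {x y : ℝ} (hz : minimisers d β a b μ κ = {(x, y)}) :
    PairDensityConcentratesAt d β a b α μ κ x y := by
  intro ℓ m hseq δ hδ
  set V : ℕ → ℝ := fun j => boxVolume (ℓ j) with hVdef
  have hV : Tendsto V atTop atTop := hseq.tendsto_volume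
  have hratio : Tendsto (fun j => ENNReal.ofReal ((m j : ℝ) / V j)) atTop (𝓝 κ) :=
    hseq.tendsto_ratio
  set E := energy d β a b μ (x, y) with hE
  have hzmem : (x, y) ∈ minimisers d β a b μ κ := by rw [hz]; rfl
  have hx := (first_order_fst hd hβ hzmem).1
  set C : Set (ℝ × ℝ) := {w | !₂[w.1, w.2] ∉ Metric.ball (!₂[x, y] : EuclideanSpace ℝ (Fin 2)) δ}
    with hCdef
  have hC : IsClosed C := by
    have hcont : Continuous fun w : ℝ × ℝ => (!₂[w.1, w.2] : EuclideanSpace ℝ (Fin 2)) := by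
      refine (PiLp.continuous_toLp 2 _).comp (continuous_pi fun i => ?_)
      fin_cases i
      · exact continuous_fst
      · exact continuous_snd
    exact (Metric.isOpen_ball.preimage hcont).isClosed_compl
  have hzC : (x, y) ∉ C := by
    simp only [hCdef, Set.mem_ofPred_eq, not_not]
    exact Metric.mem_ball_self hδ
  obtain ⟨η, hη, τ, hτ, hgap⟩ := energy_gap hd hβ hb hab hratio hz hC hzC
  have hlower := eventually_exists_gibbsWeight_ge (a := a) (α := α) (μ := μ) hd hβ hb hV
    hseq.tendsto_cutoff hratio hzmem.1 hx (half_pos hη)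
  obtain ⟨c0, hc0⟩ := energy_linear_bound (d := d) (β := β) hd hβ hb hab μ
  set D := (1 - Real.exp (-(β * τ)))⁻¹ with hD
  set bound : ℕ → ℝ := fun j =>
    D * Real.exp (1 + V j * (tailWeight d β (m j) - β * (η / 2))) with hbound
  have hbound0 : Tendsto (fun j => ENNReal.ofReal (bound j)) atTop (𝓝 0) := by
    rw [← ENNReal.ofReal_zero, ← mul_zero D]
    refine (ENNReal.continuous_ofReal.tendsto _).comp (Tendsto.const_mul D ?_)
    refine Real.tendsto_exp_atBot.comp (tendsto_atBot_add_const_left _ _ ?_)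
    have h1 : Tendsto (fun j => tailWeight d β (m j) - β * (η / 2)) atTop
        (𝓝 (0 - β * (η / 2))) :=
      ((tendsto_tailWeight hd hβ).comp hseq.tendsto_cutoff).sub_const _
    refine hV.atTop_mul_neg ?_ h1
    have := mul_pos hβ (half_pos hη)
    linarith
  set S : ℕ → Set CycleCounts := fun j =>
    {n | pairDensity (V j) (m j) n ∈ Metric.ball !₂[x, y] δ} with hS
  have hkey : ∀ᶠ j in atTop, gibbsMeasure d β a b α μ (V j) (m j) (S j)ᶜ ≤ ENNReal.ofReal (bound j) ∧
      gibbsMeasure d β a b α μ (V j) (m j) (S j) =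
        1 - gibbsMeasure d β a b α μ (V j) (m j) (S j)ᶜ := by
    filter_upwards [hgap, hlower, hV.eventually_gt_atTop 0] with j hj1 hj2 hVj
    obtain ⟨n, hn⟩ := hj2
    have hZle : ENNReal.ofReal (Real.exp (-(V j * totalWeight d β α)) *
        Real.exp (-(β * V j * (E + η / 2)))) ≤
        ∑' n, ENNReal.ofReal (gibbsWeight d β a b α μ (V j) (m j) n) :=
      (ENNReal.ofReal_le_ofReal hn).trans (ENNReal.le_tsum n)
    have hpos : ∑' n, ENNReal.ofReal (gibbsWeight d β a b α μ (V j) (m j) n) ≠ 0 := by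
      refine ne_of_gt (lt_of_lt_of_le ?_ hZle)
      rw [ENNReal.ofReal_pos]
      positivity
    have hfin : ∑' n, ENNReal.ofReal (gibbsWeight d β a b α μ (V j) (m j) n) ≠ ⊤ := by
      have h1 := tsum_gibbsWeight_le (a := a) (α := α) (μ := μ) (m := m j) hd hβ hb hVj
        (S := Set.univ) (c := c0) zero_lt_one fun n _ =>
          hc0 (shortDensity (V j) (m j) n, longDensity (V j) (m j) n) (shortDensity_nonneg hVj n) (longDensity_nonneg hVj n)
      simp only [Set.indicator_univ] at h1
      exact ne_top_of_le_ne_top ENNReal.ofReal_ne_top h1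
    have happly := gibbsMeasure_apply hβ hVj hfin hpos
    have huniv : gibbsMeasure d β a b α μ (V j) (m j) Set.univ = 1 := by
      rw [happly, Set.indicator_univ]
      exact ENNReal.div_self hpos hfin
    have hcompl : gibbsMeasure d β a b α μ (V j) (m j) (S j)ᶜ ≤ ENNReal.ofReal (bound j) := by
      have h1 := tsum_gibbsWeight_le (a := a) (α := α) (μ := μ) (m := m j) hd hβ hb hVj
        (S := (S j)ᶜ) (c := E + η) hτ fun n hn => by
          refine hj1 (shortDensity (V j) (m j) n, longDensity (V j) (m j) n) hn
            (shortDensity_nonneg hVj n) (longDensity_nonneg hVj n) (longDensity_cases hVj n)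
      rw [happly]
      refine (ENNReal.div_le_div h1 hZle).trans (le_of_eq ?_)
      rw [← ENNReal.ofReal_div_of_pos (by positivity)]
      congr 1
      rw [mul_div_mul_left _ _ (Real.exp_ne_zero _), mul_div_right_comm, ← Real.exp_sub, hbound]
      simp only
      rw [mul_comm]
      congr 2
      ring
    refine ⟨hcompl, ?_⟩
    have hadd := measure_add_measure_compl (μ := gibbsMeasure d β a b α μ (V j) (m j))
      (s := S j) trivial
    rw [huniv] at hadd
    rw [← hadd]
    exact (ENNReal.add_sub_cancel_right
      (ne_top_of_le_ne_top ENNReal.ofReal_ne_top hcompl)).symm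
  have hcompl0 : Tendsto (fun j => gibbsMeasure d β a b α μ (V j) (m j) (S j)ᶜ) atTop (𝓝 0) :=
    tendsto_of_tendsto_of_tendsto_of_le_of_le' tendsto_const_nhds hbound0
      (Eventually.of_forall fun _ => zero_le) (hkey.mono fun j h => h.1)
  have hsub := ENNReal.Tendsto.sub (tendsto_const_nhds (x := (1 : ℝ≥0∞))) hcompl0
    (Or.inl ENNReal.one_ne_top)
  rw [tsub_zero] at hsub
  exact hsub.congr' (hkey.mono fun j h => h.2.symm)

end

end HYL

theorem mainTheorem7 (d : ℕ) (hd : 1 ≤ d) (β a b : ℝ) (hβ : 0 < β) (hb : 0 < b) (hab : b < a) :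
    -- concentration at the zero of the rate function whenever that zero is unique
    (∀ (κ : ℝ≥0∞) (μ α x y : ℝ), α < 0 → HYL.zeroes d β a b μ κ = {(x, y)} →
      HYL.PairDensityConcentratesAt d β a b α μ κ x y) ∧
    -- the zero is unique for all `μ` when `κ = ∞`
    (∀ μ : ℝ, HYL.zeroes d β a b μ ⊤ = {(HYL.xOne d β a μ, 0)}) ∧
    -- the zero is unique for `μ ≠ μ*` when `κ = 0`
    ∃ μstar : ℝ, HYL.muT d β a b ≤ μstar ∧ (μstar : EReal) ≤ (HYL.muC d β a : EReal) ∧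
      (∀ μ : ℝ, μ < μstar → HYL.zeroes d β a b μ 0 = {(HYL.xOne d β a μ, 0)}) ∧
      (∀ μ : ℝ, μstar < μ → HYL.zeroes d β a b μ 0 =
        {(HYL.xTwo d β a b μ, (μ - a * HYL.xTwo d β a b μ) / (a - b))}) ∧
      -- the zero is unique for `μ ≠ μ*_κ` when `0 < κ < ∞`
      ∀ κ : ℝ, 0 < κ → ∃ μstarκ : ℝ,
        (HYL.muR d β a b κ ≤ μstar → μstarκ = μstar) ∧
        (μstar < HYL.muR d β a b κ → μstar < μstarκ ∧ μstarκ < HYL.muR d β a b κ) ∧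
        (∀ μ : ℝ, μ < μstarκ →
          HYL.zeroes d β a b μ (ENNReal.ofReal κ) = {(HYL.xOne d β a μ, 0)}) ∧
        (∀ μ : ℝ, μstarκ < μ → μ ≤ HYL.muR d β a b κ →
          HYL.zeroes d β a b μ (ENNReal.ofReal κ) = {(HYL.xThree d β a κ μ, κ)}) ∧
        (∀ μ : ℝ, μstarκ < μ → HYL.muR d β a b κ ≤ μ →
          HYL.zeroes d β a b μ (ENNReal.ofReal κ) =
            {(HYL.xTwo d β a b μ, (μ - a * HYL.xTwo d β a b μ) / (a - b))}) := by
  simp only [HYL.zeroes_eq_minimisers hd hβ]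
  refine ⟨fun κ μ α x y _ hz =>
      HYL.pairDensityConcentratesAt_of_minimisers hd hβ hb hab hz,
    HYL.minimisers_top hd hβ hb hab, HYL.transitionPoint d β a b,
    HYL.muT_le_transitionPoint hd hβ hb hab, HYL.transitionPoint_le_muC hd hβ hb hab,
    fun μ hμ => HYL.minimisers_zero_of_lt hd hβ hb hab hμ,
    fun μ hμ => HYL.minimisers_zero_of_gt hd hβ hb hab hμ,
    fun κ hκ => HYL.exists_transition_ofReal hd hβ hb hab hκ⟩
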